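/- **Setting.** All functions are real valued on $\mathbb R$, $\langle u,v\rangle=\int_{\mathbb R}uv\,dx$, $\|u\|_{H^1}^2=\|u\|_{L^2}^2+\|u'\|_{L^2}^2$. Let $f\in C^k(\mathbb R)$ for some $k\ge 3$ with $f^{(k)}$ bounded and $f(0)=f'(0)=0$. Let $I_0\subset(0,\infty)$ be an open interval such that for every $c\in I_0$ the function $g(u)=-cu+f(u)$ satisfies: $g$ is locally Lipschitz with $g(0)=0$; $x^*=\inf\{x>0:\int_0^xg=0\}$ exists, $x^*>0$ and $g(x^*)>0$; $\lim_{s\to0}g(s)/s$ exists and is negative. For $c\in I_0$ let $Q_c\in C^2(\mathbb R)$ be the positive even solution, vanishing at infinity, of $$-Q_c''+cQ_c-f(Q_c)=0 .$$ Assume that $(c,x)\mapsto Q_c(x)$ is $C^2$ on $I_0\times\mathbb R$, that $x^m\partial_c^nQ_c\in L^1$ for $n=1,2,3$, $m=0,1,2$, and that $\int\partial_cQ_c\neq0$ for $c\in I_0$. For $a\in\mathbb R$ put $Q_{ca}(x)=Q_c(x-a)$, $\zeta^{tr}_{ca}=\partial_aQ_{ca}$, $\zeta^n_{ca}=\partial_cQ_{ca}$,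 $T_{ca}=\mathrm{span}\{\zeta^{tr}_{ca},\zeta^n_{ca}\}$, $\delta(c)=\tfrac12\|Q_c\|_{L^2}^2$. For $\alpha>0$ let $$\mathcal K_{Q\alpha}=\mathcal K P_Q+(\partial_x+\alpha)^{-1}(1-P_Q),\quad \mathcal Kg(x)=\int_{-\infty}^xg(y)\,dy,\quad (\partial_x+\alpha)^{-1}g(x)=\int_{-\infty}^xg(y)e^{\alpha(y-x)}\,dy,$$ where $P_Q$ is the $L^2$-orthogonal projection onto the span of $\zeta^{tr}_{ca}$. Let $\mathcal L_Q=-\partial_x^2+c-f'(Q_{ca})$, with quadratic form $\langle\mathcal L_Q\xi,\xi\rangle=\int (\xi')^2+(c-f'(Q_{ca}))\xi^2\,dx$ for $\xi\in H^1$. **Proposition.** Let $I\subset I_0$ be compact with $\delta'(c)>0$ for all $c\in I$. There are $\alpha_0>0$, positive constants $C_1,C_2,C_3,C,C'$ independent of $\alpha$, $c$ and $a$, and a function $\varrho$ such that for every $\alpha\in(0,\alpha_0)$ one has $C_1\alpha\le\varrho(\alpha)\le C_2\alpha$ and, for all $c\in I$ and $a\in\mathbb R$: 1. $\langle\mathcal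 L_Q\xi,\xi\rangle\ge\varrho(\alpha)\|\xi\|_{H^1}^2$ for all $\xi\in H^1$ with $\xi\perp\mathcal K_{Q\alpha}T_{ca}$. 2. The infimum of $\langle\mathcal L_Q\xi,\xi\rangle$ over all $\xi\in H^1$ with $\xi\perp\mathcal K_{Q\alpha}T_{ca}$ and $\|\xi\|_{L^2}=1$ is attained; the minimizer $\eta$ is unique up to sign, and has the form $\eta=\gamma\zeta^{tr}_{ca}+\eta_\perp$ with $\eta_\perp\in H^1$, $\langle\eta_\perp,\zeta^{tr}_{ca}\rangle=0$, $|\gamma|\le C'$ and $\|\eta_\perp\|_{H^1}\le C'\alpha^{1/2}$. 3. Let $\eta$ be such a minimizer, and for $\xi\in H^1$ with $\xi\perp\mathcal K_{Q\alpha}T_{ca}$ put $\xi_b=\langle\xi,\eta\rangle\eta$ and $\xi_g=\xi-\xi_b$. Then $\langle\mathcal L_Q\xi_g,\xi_g\rangle\ge C_3\|\xi_g\|_{H^1}^2$. 4. For $\eta$, $\xi$, $\xi_b$, $\xi_g$ as in 3, $\langle\mathcal L_Q\xi,\xi\rangle\ge C_3\|\xi_g\|_{H^1}^2+C\alpha\|\xi_b\|_{H^1}^2$.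 -/

import Mathlib

open MeasureTheory Set Filter Topology

open scoped ContDiff

noncomputable section

namespace BKdV

/-! ### The Sobolev space `H¹(ℝ)` of real functions -/

/-- The `L²(ℝ)` pairing `⟨u, v⟩ = ∫ u v`. -/
def inner2 (u v : ℝ → ℝ) : ℝ := ∫ x, u x * v x

/-- `v` is the weak derivative of `u` on `ℝ`: `∫ u φ' = -∫ v φ` for every test function `φ`. -/
def HasWeakDeriv (u v : ℝ → ℝ) : Prop :=
  ∀ φ : ℝ → ℝ, ContDiff ℝ ∞ φ → HasCompactSupport φ →
    ∫ x, u x * deriv φ x = -∫ x, v x * φ x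

/-- `u ∈ H¹(ℝ)`: `u` is in `L²` and has a weak derivative in `L²`. -/
def MemH1 (u : ℝ → ℝ) : Prop :=
  MemLp u 2 volume ∧ ∃ v : ℝ → ℝ, MemLp v 2 volume ∧ HasWeakDeriv u v

open Classical in
/-- The weak derivative in `L²` of a function in `H¹(ℝ)`. It is determined up to a null set (see
`weakDeriv_ae_eq`); the value `0` for functions outside `H¹(ℝ)` is never used. -/
def weakDeriv (u : ℝ → ℝ) : ℝ → ℝ :=
  if h : ∃ v : ℝ → ℝ, MemLp v 2 volume ∧ HasWeakDeriv u v then h.choose else 0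

/-- The norm of `H¹(ℝ)`. -/
def normH1 (u : ℝ → ℝ) : ℝ := Real.sqrt ((∫ x, u x ^ 2) + ∫ x, weakDeriv u x ^ 2)

theorem weakDeriv_spec {u : ℝ → ℝ} (hu : MemH1 u) :
    MemLp (weakDeriv u) 2 volume ∧ HasWeakDeriv u (weakDeriv u) := by
  have h := hu.2
  unfold weakDeriv
  rw [dif_pos h]
  exact h.choose_spec

theorem weakDeriv_ae_eq {u v : ℝ → ℝ} (hv : MemLp v 2 volume) (huv : HasWeakDeriv u v) :
    weakDeriv u =ᵐ[volume] v := by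
  have h : ∃ v : ℝ → ℝ, MemLp v 2 volume ∧ HasWeakDeriv u v := ⟨v, hv, huv⟩
  have hw : MemLp (weakDeriv u) 2 volume ∧ HasWeakDeriv u (weakDeriv u) := by
    unfold weakDeriv
    rw [dif_pos h]
    exact h.choose_spec
  refine ae_eq_of_integral_contDiff_smul_eq (hw.1.locallyIntegrable (by norm_num))
    (hv.locallyIntegrable (by norm_num)) fun g hg hgs => ?_
  have h1 := hw.2 g hg hgs
  have h2 := huv g hg hgs
  simp only [smul_eq_mul, mul_comm (g _)]
  linarith

/-! ### The nonlinearity and the solitary waves -/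

/-- The nonlinearity `f` is `k ≥ 3` times continuously differentiable, with `f⁽ᵏ⁾` bounded and
`f(0) = f'(0) = 0`. -/
structure IsNonlinearity (f : ℝ → ℝ) : Prop where
  regular : ∃ k : ℕ, 3 ≤ k ∧ ContDiff ℝ k f ∧ ∃ M : ℝ, ∀ u, |iteratedDeriv k f u| ≤ M
  map_zero : f 0 = 0
  deriv_zero : deriv f 0 = 0

/-- The existence conditions of Berestycki and Lions for the field equation with
`g(u) = -c u + f(u)`. -/
structure BerestyckiLions (g : ℝ → ℝ) : Prop where
  locallyLipschitz : LocallyLipschitz g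
  map_zero : g 0 = 0
  first_zero : ∃ x₀ : ℝ, IsGLB {x : ℝ | 0 < x ∧ ∫ y in (0 : ℝ)..x, g y = 0} x₀ ∧
    0 < x₀ ∧ 0 < g x₀
  slope_neg : ∃ m l : ℝ, 0 < m ∧ l ≤ -m ∧ Tendsto (fun s => g s / s) (𝓝[≠] 0) (𝓝 l)

/-- `q` is the solitary wave profile of speed `c` centred at the origin: the positive even `C²`
solution of `-q'' + c q - f(q) = 0` that vanishes at infinity. -/
structure IsSolitaryWave (f : ℝ → ℝ) (c : ℝ) (q : ℝ → ℝ) : Prop where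
  contDiff : ContDiff ℝ 2 q
  pos : ∀ x, 0 < q x
  even : ∀ x, q (-x) = q x
  tendsto_zero : Tendsto q (cocompact ℝ) (𝓝 0)
  equation : ∀ x, -iteratedDeriv 2 q x + c * q x - f (q x) = 0

/-- `Q` is a family of solitary waves of speeds `c` in the open interval `I₀ ⊆ (0, ∞)`, depending
in a `C²` way on the speed, with `xᵐ ∂_cⁿ Q_c ∈ L¹` for `n = 1, 2, 3`, `m = 0, 1, 2`, and
`∫ ∂_c Q_c ≠ 0`. -/
structure IsSolitaryWaveFamily (f : ℝ → ℝ) (I₀ : Set ℝ) (Q : ℝ → ℝ → ℝ) : Prop where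
  isOpen : IsOpen I₀
  ordConnected : I₀.OrdConnected
  speed_pos : ∀ c ∈ I₀, 0 < c
  conditions : ∀ c ∈ I₀, BerestyckiLions fun u => -c * u + f u
  isSolitaryWave : ∀ c ∈ I₀, IsSolitaryWave f c (Q c)
  contDiffOn : ContDiffOn ℝ 2 (fun p : ℝ × ℝ => Q p.1 p.2) (I₀ ×ˢ univ)
  integrable : ∀ c ∈ I₀, ∀ n ∈ Finset.Icc 1 3, ∀ m ∈ Finset.range 3,
    Integrable fun x : ℝ => x ^ m * iteratedDeriv n (fun c' => Q c' x) c
  integral_ne_zero : ∀ c ∈ I₀, ∫ x, deriv (fun c' => Q c' x) c ≠ 0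

/-- The momentum `P(u) = ½ ‖u‖²` in `L²`. -/
def momentum (u : ℝ → ℝ) : ℝ := (1 / 2) * ∫ x, u x ^ 2

/-- The translated wave `Q_{ca}(x) = Q_c(x - a)`. -/
def wave (Q : ℝ → ℝ → ℝ) (c a : ℝ) : ℝ → ℝ := fun x => Q c (x - a)

/-- The translation vector `ζᵗʳ_{ca} = ∂_a Q_{ca}`. -/
def zetaTr (Q : ℝ → ℝ → ℝ) (c a : ℝ) : ℝ → ℝ := fun x => deriv (fun a' => wave Q c a' x) a

/-- The normalization vector `ζⁿ_{ca} = ∂_c Q_{ca}`. -/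
def zetaN (Q : ℝ → ℝ → ℝ) (c a : ℝ) : ℝ → ℝ := fun x => deriv (fun c' => wave Q c' a x) c

/-- The tangent space at `Q_{ca}` of the manifold of solitary waves. -/
def tangentSpace (Q : ℝ → ℝ → ℝ) (c a : ℝ) : Submodule ℝ (ℝ → ℝ) :=
  Submodule.span ℝ {zetaTr Q c a, zetaN Q c a}

/-! ### The regularized symplectic operator -/

/-- `𝒦 g (x) = ∫_{-∞}^x g(y) dy`. -/
def opK (g : ℝ → ℝ) : ℝ → ℝ := fun x => ∫ y in Iic x, g y

/-- `(∂ₓ + α)⁻¹ g (x) = ∫_{-∞}^x g(y) e^{α(y-x)} dy`. -/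
def opResolvent (α : ℝ) (g : ℝ → ℝ) : ℝ → ℝ := fun x => ∫ y in Iic x, g y * Real.exp (α * (y - x))

/-- The `L²`-orthogonal projection onto the line spanned by `e`. -/
def projLine (e g : ℝ → ℝ) : ℝ → ℝ := (inner2 g e / inner2 e e) • e

/-- The anisotropic regularization `𝒦_{Qα} = 𝒦 P_Q + (∂ₓ + α)⁻¹ (1 - P_Q)` of `𝒦` at `Q_{ca}`,
where `P_Q` is the orthogonal projection onto the span of `ζᵗʳ_{ca}`. -/
def opKα (Q : ℝ → ℝ → ℝ) (c a α : ℝ) (g : ℝ → ℝ) : ℝ → ℝ :=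
  opK (projLine (zetaTr Q c a) g) + opResolvent α (g - projLine (zetaTr Q c a) g)

/-- `ξ` is orthogonal to `𝒦_{Qα}` of the tangent space at `Q_{ca}`. -/
def IsSymplOrthogonal (Q : ℝ → ℝ → ℝ) (c a α : ℝ) (ξ : ℝ → ℝ) : Prop :=
  ∀ v ∈ tangentSpace Q c a, inner2 ξ (opKα Q c a α v) = 0

/-! ### The Hessian -/

/-- The operator `ℒ_Q = -∂ₓ² + c - f'(Q_{ca})` on twice differentiable functions. -/
def hessian (f : ℝ → ℝ) (Q : ℝ → ℝ → ℝ) (c a : ℝ) (ξ : ℝ → ℝ) : ℝ → ℝ :=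
  fun x => -iteratedDeriv 2 ξ x + (c - deriv f (wave Q c a x)) * ξ x

/-- The quadratic form `⟨ℒ_Q ξ, ξ⟩` of `ℒ_Q`, on its form domain `H¹(ℝ)`. -/
def hessianForm (f : ℝ → ℝ) (Q : ℝ → ℝ → ℝ) (c a : ℝ) (ξ : ℝ → ℝ) : ℝ :=
  ∫ x, (weakDeriv ξ x ^ 2 + (c - deriv f (wave Q c a x)) * ξ x ^ 2)

/-- On test functions the quadratic form is given by the operator. -/
theorem hessianForm_eq {f : ℝ → ℝ} {Q : ℝ → ℝ → ℝ} {c a : ℝ} {ξ : ℝ → ℝ}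
    (hf : Continuous (deriv f)) (hQ : Continuous (Q c))
    (hξ : ContDiff ℝ ∞ ξ) (hξs : HasCompactSupport ξ) :
    hessianForm f Q c a ξ = inner2 (hessian f Q c a ξ) ξ := by
  have hd : ContDiff ℝ ∞ (deriv ξ) := (contDiff_infty_iff_deriv.1 hξ).2
  have hdd : ContDiff ℝ ∞ (deriv (deriv ξ)) := (contDiff_infty_iff_deriv.1 hd).2
  have hds : HasCompactSupport (deriv ξ) := hξs.deriv
  have hdds : HasCompactSupport (deriv (deriv ξ)) := hds.deriv
  have parts : ∀ u φ : ℝ → ℝ, ContDiff ℝ ∞ u → HasCompactSupport u → ContDiff ℝ ∞ φ →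
      ∫ x, u x * deriv φ x = -∫ x, deriv u x * φ x := by
    intro u φ hu hus hφ
    have hu' : Continuous (deriv u) := (contDiff_infty_iff_deriv.1 hu).2.continuous
    have hφ' : Continuous (deriv φ) := (contDiff_infty_iff_deriv.1 hφ).2.continuous
    refine integral_mul_deriv_eq_deriv_mul_of_integrable
      (fun x _ => (hu.differentiable (by simp) x).hasDerivAt)
      (fun x _ => (hφ.differentiable (by simp) x).hasDerivAt) ?_ ?_ ?_
    · exact (hu.continuous.mul hφ').integrable_of_hasCompactSupport hus.mul_right
    · exact (hu'.mul hφ.continuous).integrable_of_hasCompactSupport hus.deriv.mul_right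
    · exact (hu.continuous.mul hφ.continuous).integrable_of_hasCompactSupport hus.mul_right
  have hae : weakDeriv ξ =ᵐ[volume] deriv ξ :=
    weakDeriv_ae_eq (hd.continuous.memLp_of_hasCompactSupport hds)
      fun φ hφ _ => parts ξ φ hξ hξs hφ
  have hV : Continuous fun x => c - deriv f (wave Q c a x) := by
    unfold wave
    fun_prop
  have hi1 : Integrable fun x => deriv ξ x * deriv ξ x :=
    (hd.continuous.mul hd.continuous).integrable_of_hasCompactSupport hds.mul_right
  have hi2 : Integrable fun x => (c - deriv f (wave Q c a x)) * (ξ x * ξ x) :=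
    (hV.mul (hξ.continuous.mul hξ.continuous)).integrable_of_hasCompactSupport
      hξs.mul_right.mul_left
  have hi3 : Integrable fun x => -(deriv (deriv ξ) x * ξ x) :=
    ((hdd.continuous.mul hξ.continuous).integrable_of_hasCompactSupport hdds.mul_right).neg
  have e1 : hessianForm f Q c a ξ =
      (∫ x, deriv ξ x * deriv ξ x) + ∫ x, (c - deriv f (wave Q c a x)) * (ξ x * ξ x) := by
    unfold hessianForm
    rw [← integral_add hi1 hi2]
    refine integral_congr_ae ?_
    filter_upwards [hae] with x hx
    rw [hx]
    ring
  have e2 : inner2 (hessian f Q c a ξ) ξ =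
      -(∫ x, deriv (deriv ξ) x * ξ x) + ∫ x, (c - deriv f (wave Q c a x)) * (ξ x * ξ x) := by
    unfold inner2 hessian
    rw [← integral_neg, ← integral_add hi3 hi2]
    refine integral_congr_ae (Eventually.of_forall fun x => ?_)
    simp only [iteratedDeriv_succ, iteratedDeriv_zero]
    ring
  rw [e1, e2, parts (deriv ξ) ξ hd hds hξ]

/-- The constraint set: functions in `H¹` orthogonal to `𝒦_{Qα}` of the tangent space at `Q_{ca}`
and of unit `L²` norm. -/
def constraintSet (Q : ℝ → ℝ → ℝ) (c a α : ℝ) : Set (ℝ → ℝ) :=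
  {ξ | MemH1 ξ ∧ IsSymplOrthogonal Q c a α ξ ∧ inner2 ξ ξ = 1}

/-- `η` is a minimizer of `⟨ℒ_Q ξ, ξ⟩` over the constraint set. -/
def IsMinimizer (f : ℝ → ℝ) (Q : ℝ → ℝ → ℝ) (c a α : ℝ) (η : ℝ → ℝ) : Prop :=
  η ∈ constraintSet Q c a α ∧ IsMinOn (hessianForm f Q c a) (constraintSet Q c a α) η

/-- The component `ξ_b = ⟨ξ, η⟩ η` of `ξ` along `η`. -/
def badPart (η ξ : ℝ → ℝ) : ℝ → ℝ := inner2 ξ η • η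

/-- The component `ξ_g = ξ - ⟨ξ, η⟩ η` of `ξ` orthogonal to `η`. -/
def goodPart (η ξ : ℝ → ℝ) : ℝ → ℝ := ξ - inner2 ξ η • η

end BKdV

end

/-!
# Anisotropic coercivity of the Hessian at a solitary wave

The theorem is an instance of a statement on symmetric forms, collected in `AnisotropicForm`. Let `B`
be bounded for the `H¹` norm, with `B z = 0`, and coercive on the complement of `q` and `z`, and let
`w` be a vector of squared length comparable to `1/α` whose product with `z` is bounded above and
below. On the complement of `q` and `w` a vector is the sum of a multiple `γ z` and a part `p`
orthogonal to `z`. The constraint gives `γ ⟨z, w⟩ = -⟨p, w⟩`, so that `γ²` is at most of the order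
`‖p‖²/α`, while `B` controls `‖p‖²`; this is coercivity with a constant of order `α`
(`AnisotropicForm.coercive_constraint`). Moving `z` into the constraint space by a multiple of `w` of
order `α` shows that the infimum is indeed of order `α` (`exists_test_vector`). It is attained
(`exists_isMin`), and the part of a minimizer orthogonal to `z` has squared norm of order `α`
(`IsMin.h_perp_le`). Hence a vector orthogonal to the minimizer is almost orthogonal to `z`, and `B`
is coercive there with a constant independent of `α` (`IsMin.coercive_orthogonal`). The
Euler–Lagrange equation then gives the anisotropic bound (`IsMin.anisotropic`) and the uniqueness of
the minimizer (`IsMin.unique`).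

For the Hessian `ℒ` at `Q_{ca}`, `z` is the translation vector. The operator `𝒦_{Qα}` maps it to
`-Q_{ca}`, and acts on the normalization vector as `(∂ₓ + α)⁻¹`. Thus `q = Q_{ca}` and
`w = (∂ₓ + α)⁻¹ ∂_c Q_{ca}` (`LinearizedWave.isSymplOrthogonal_iff`). Far to the right `w` is close
to `e^{-α(x-a)} ∫ ∂_c Q_c`, and this integral is not zero; hence the order `1/α` of its squared
length (`integral_opResolvent_sq_le`, `le_integral_opResolvent_sq`). An integration by parts shows
that `⟨z, w⟩` is `⟨Q_c, ∂_c Q_c⟩ = δ'(c) > 0` up to a term of order `α`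
(`integral_deriv_mul_opResolvent`, `IsSolitaryWaveFamily.deriv_momentum`).

It remains to see that `ℒ` is coercive on the complement of `Q` and `Q'`, uniformly in the speed. On
the half-line `-Q'` is a positive solution of `ℒ ψ = 0`, so that the form is nonnegative on functions
vanishing at the origin, with a quantitative remainder (`interval_coercive`, `halfLine_coercive`);
its null directions on such functions are `Q'` and `|Q'|` (`LinearizedWave.bound_of_zero`). Now
`ℒ ∂_c Q = -Q`, hence for `u ⊥ Q` one has
`⟨ℒ(u - t ∂_c Q), u - t ∂_c Q⟩ = ⟨ℒ u, u⟩ - t² δ'(c)`. With `t` such that `u - t ∂_c Q` vanishes at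
the origin, the left-hand side controls `u - t ∂_c Q` up to multiples of `Q'` and `|Q'|`, which the
two orthogonality conditions determine (`LinearizedWave.coercive`). No spectral theory enters.

The constants are uniform in the speed because the waves and their speed derivatives decay
exponentially at a common rate on a compact set of speeds, by the maximum principle
(`IsSolitaryWaveFamily.exists_uniformBounds`), so that the relevant integrals are continuous in the
speed (`IsSolitaryWaveFamily.exists_linearizedWave`). They do not depend on the translation, since
all forms are translation invariant.
-/

noncomputable section

namespace BKdV

/-! ### Anisotropic coercivity in an abstract space -/

section Abstract

variable {V : Type*} [AddCommGroup V] [Module ℝ V]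

/-- A form `B` that is coercive on the complement of `q` and of a null vector `z`, together with a
long vector `w` that is not orthogonal to `z`. The constraint space is the complement of `q` and
`w`. In the application `m`, `h`, `B` are the `L²` pairing, the `H¹` pairing and the Hessian, `z` is
the translation vector, `q` the wave and `w` the image of the normalization vector under the
regularized operator. All lower bounds are expressed by the single constant `k ≤ 1` and all upper
bounds by the single constant `K ≥ 1`, and `w` has squared length of the order `1/α`; the results
are of use when `k` and `K` do not depend on `α`. The field `complete` replaces a completeness
instance, since `h` is only positive semidefinite on a space of functions. -/
structure AnisotropicForm (m h B : V →ₗ[ℝ] V →ₗ[ℝ] ℝ) (z q w : V) (k K α : ℝ) : Prop where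
  k_pos : 0 < k
  k_le : k ≤ 1
  le_K : 1 ≤ K
  α_pos : 0 < α
  m_psd : m.IsPosSemidef
  h_psd : h.IsPosSemidef
  B_symm : ∀ x y, B x y = B y x
  m_le_h : ∀ x, m x x ≤ h x x
  complete : ∀ u : ℕ → V, (∀ ε > 0, ∃ N, ∀ i ≥ N, ∀ j ≥ N, h (u i - u j) (u i - u j) < ε) →
    ∃ x, Tendsto (fun n => h (u n - x) (u n - x)) atTop (𝓝 0)
  B_bound : ∀ x, |B x x| ≤ K * h x x
  B_z : ∀ x, B z x = 0
  z_q : m z q = 0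
  coercive : ∀ x, m x q = 0 → m x z = 0 → k * h x x ≤ B x x
  h_z : h z z ≤ K
  m_z : k ≤ m z z
  h_q : h q q ≤ K
  m_q : k ≤ m q q
  h_w : h w w ≤ K / α
  m_w : k / α ≤ m w w
  m_w_q : |m w q| ≤ K
  m_z_w : k ≤ |m z w|
  m_z_w' : |m z w| ≤ K

namespace AnisotropicForm

variable {m h B : V →ₗ[ℝ] V →ₗ[ℝ] ℝ} {z q w : V} {k K α : ℝ}

/-- The component of `x` orthogonal to `z`. -/
def perp (m : V →ₗ[ℝ] V →ₗ[ℝ] ℝ) (z x : V) : V := x - (m x z / m z z) • z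

theorem psd_add_le {P : V →ₗ[ℝ] V →ₗ[ℝ] ℝ} (hP : P.IsPosSemidef) (x y : V) :
    P (x + y) (x + y) ≤ 2 * P x x + 2 * P y y := by
  have h1 := hP.2.nonneg (x - y)
  have h2 : P x y = P y x := hP.1.eq x y
  simp only [map_sub, map_add, LinearMap.sub_apply, LinearMap.add_apply] at h1 ⊢
  linarith

theorem psd_cauchy_schwarz {P : V →ₗ[ℝ] V →ₗ[ℝ] ℝ} (hP : P.IsPosSemidef) (x y : V) :
    P x y ^ 2 ≤ P x x * P y y :=
  LinearMap.BilinForm.apply_sq_le_of_symm P hP.2.nonneg hP.1 x y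

/-- A positive semidefinite form dominated by `h` is continuous along `h`-convergent sequences. -/
theorem tendsto_of_le {P : V →ₗ[ℝ] V →ₗ[ℝ] ℝ} (hP : P.IsPosSemidef) {C : ℝ}
    (hPh : ∀ x, P x x ≤ C * h x x) {u : ℕ → V} {x : V}
    (hu : Tendsto (fun n => h (u n - x) (u n - x)) atTop (𝓝 0)) (y : V) :
    Tendsto (fun n => P (u n) y) atTop (𝓝 (P x y)) ∧
    Tendsto (fun n => P (u n) (u n)) atTop (𝓝 (P x x)) := by
  have h0 : Tendsto (fun n => P (u n - x) (u n - x)) atTop (𝓝 0) := by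
    refine squeeze_zero (fun n => hP.2.nonneg _) (fun n => hPh _) ?_
    simpa using hu.const_mul C
  have h1 : ∀ y, Tendsto (fun n => P (u n - x) y) atTop (𝓝 0) := by
    intro y
    have : Tendsto (fun n => P (u n - x) y ^ 2) atTop (𝓝 0) := by
      refine squeeze_zero (fun n => sq_nonneg _) (fun n => psd_cauchy_schwarz hP _ _) ?_
      simpa using h0.mul_const (P y y)
    have h2 := (Real.continuous_sqrt.tendsto 0).comp this
    rw [Real.sqrt_zero] at h2
    refine (tendsto_zero_iff_abs_tendsto_zero _).2 (h2.congr fun n => ?_)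
    exact Real.sqrt_sq_eq_abs _
  constructor
  · have := (h1 y).add_const (P x y)
    rw [zero_add] at this
    refine this.congr fun n => ?_
    simp
  · have := (h0.add ((h1 x).const_mul 2)).add_const (P x x)
    rw [mul_zero, zero_add, zero_add] at this
    refine this.congr fun n => ?_
    have h2 : P x (u n) = P (u n) x := hP.1.eq x (u n)
    simp only [map_sub, LinearMap.sub_apply, h2]
    ring

variable (A : AnisotropicForm m h B z q w k K α)
include A

theorem z_pos : 0 < m z z := A.k_pos.trans_le A.m_z

theorem K_pos : 0 < K := one_pos.trans_le A.le_K

theorem h_nonneg (x : V) : 0 ≤ h x x := A.h_psd.2.nonneg x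

theorem m_nonneg (x : V) : 0 ≤ m x x := A.m_psd.2.nonneg x

theorem m_comm (x y : V) : m x y = m y x := A.m_psd.1.eq x y

theorem B_z_right (x : V) : B x z = 0 := by rw [A.B_symm, A.B_z]

theorem perp_z (x : V) : m (perp m z x) z = 0 := by
  simp [perp, div_mul_cancel₀ _ A.z_pos.ne']

theorem perp_q {x : V} (hx : m x q = 0) : m (perp m z x) q = 0 := by
  simp [perp, hx, A.z_q]

omit A in
theorem eq_add_perp (x : V) : x = (m x z / m z z) • z + perp m z x := by
  simp [perp]

theorem B_perp (x y : V) : B (perp m z x) (perp m z y) = B x y := by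
  simp [perp, A.B_z, A.B_z_right]

theorem coercive_perp {x : V} (hx : m x q = 0) :
    k * h (perp m z x) (perp m z x) ≤ B x x := by
  rw [← A.B_perp x x]
  exact A.coercive _ (A.perp_q hx) (A.perp_z x)

theorem m_self_eq (x : V) :
    m x x = (m x z / m z z) ^ 2 * m z z + m (perp m z x) (perp m z x) := by
  have hz := A.z_pos.ne'
  simp only [perp, map_sub, map_smul, LinearMap.sub_apply, LinearMap.smul_apply, smul_eq_mul,
    A.m_comm z x]
  field_simp
  ring

theorem h_le_perp (x : V) :
    h x x ≤ 2 * (m x z / m z z) ^ 2 * K + 2 * h (perp m z x) (perp m z x) := by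
  have h1 := psd_add_le A.h_psd ((m x z / m z z) • z) (perp m z x)
  rw [← eq_add_perp x] at h1
  have h2 : h ((m x z / m z z) • z) ((m x z / m z z) • z) ≤ (m x z / m z z) ^ 2 * K := by
    simp only [map_smul, LinearMap.smul_apply, smul_eq_mul, ← mul_assoc, ← sq]
    exact mul_le_mul_of_nonneg_left A.h_z (sq_nonneg _)
  linarith

/-- The form is coercive on the constraint space with a constant of order `α`: the component of `x`
along `z` is determined through the constraint `m x w = 0`, at the cost of a factor `‖w‖²`. -/
theorem coercive_constraint (hα : α ≤ 1) {x : V} (hq : m x q = 0) (hw : m x w = 0) :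
    k ^ 3 / (4 * K ^ 2) * α * h x x ≤ B x x := by
  have hk := A.k_pos
  have hK := A.K_pos
  have hα0 := A.α_pos
  set γ := m x z / m z z with hγ
  set p := perp m z x with hp
  have hH := A.h_nonneg p
  have h1 : γ * m z w = -m p w := by
    have := hw
    rw [eq_add_perp (m := m) (z := z) x] at this
    simp only [map_add, map_smul, LinearMap.add_apply, LinearMap.smul_apply, smul_eq_mul] at this
    linarith
  have h2 : γ ^ 2 * k ^ 2 ≤ h p p * (K / α) := by
    calc γ ^ 2 * k ^ 2 ≤ γ ^ 2 * (m z w) ^ 2 := by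
          refine mul_le_mul_of_nonneg_left ?_ (sq_nonneg _)
          rw [← sq_abs (m z w)]
          exact pow_le_pow_left₀ hk.le A.m_z_w 2
      _ = m p w ^ 2 := by rw [← mul_pow, h1, neg_sq]
      _ ≤ m p p * m w w := psd_cauchy_schwarz A.m_psd _ _
      _ ≤ h p p * (K / α) := mul_le_mul (A.m_le_h p) ((A.m_le_h w).trans A.h_w)
          (A.m_nonneg w) hH
  have h3 : γ ^ 2 * k ^ 2 * α ≤ h p p * K := by
    calc γ ^ 2 * k ^ 2 * α ≤ h p p * (K / α) * α := mul_le_mul_of_nonneg_right h2 hα0.le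
      _ = h p p * K := by field_simp
  have h4 := A.coercive_perp hq
  refine le_trans ?_ h4
  have h5 := A.h_le_perp x
  have h6 : k ^ 2 * α ≤ K ^ 2 := by
    calc k ^ 2 * α ≤ 1 * 1 := mul_le_mul (pow_le_one₀ hk.le A.k_le) hα hα0.le one_pos.le
      _ ≤ K ^ 2 := by rw [one_mul]; exact one_le_pow₀ A.le_K
  have h7 : k ^ 2 * α * h x x ≤ 4 * K ^ 2 * h p p := by
    calc k ^ 2 * α * h x x ≤ k ^ 2 * α * (2 * γ ^ 2 * K + 2 * h p p) :=
          mul_le_mul_of_nonneg_left h5 (by positivity)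
      _ = 2 * K * (γ ^ 2 * k ^ 2 * α) + 2 * (k ^ 2 * α) * h p p := by ring
      _ ≤ 2 * K * (h p p * K) + 2 * K ^ 2 * h p p := by
          gcongr
      _ = 4 * K ^ 2 * h p p := by ring
  calc k ^ 3 / (4 * K ^ 2) * α * h x x = k / (4 * K ^ 2) * (k ^ 2 * α * h x x) := by ring
    _ ≤ k / (4 * K ^ 2) * (4 * K ^ 2 * h p p) := mul_le_mul_of_nonneg_left h7 (by positivity)
    _ = k * h p p := by field_simp

/-- The range of the small parameter in which all estimates below hold. -/
theorem small (hα : α < k ^ 5 / (128 * K ^ 5)) :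
    α ≤ 1 ∧ 4 * K ^ 2 * α ≤ k ^ 2 ∧ 32 * K ^ 4 / k ^ 3 * α ≤ k / 2 ∧
      32 * K ^ 4 / k ^ 3 * α < k ^ 2 / (4 * K) := by
  have hk := A.k_pos
  have hK := A.K_pos
  have h0 : 128 * K ^ 5 * α < k ^ 5 := by
    have := (lt_div_iff₀ (by positivity)).1 hα
    linarith
  have h1 : 64 * K ^ 4 * α ≤ k ^ 4 := by
    have e1 : K ^ 4 ≤ K ^ 5 := pow_le_pow_right₀ A.le_K (by norm_num)
    have e2 : k ^ 5 ≤ k ^ 4 := pow_le_pow_of_le_one hk.le A.k_le (by norm_num)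
    have e3 := mul_le_mul_of_nonneg_right e1 A.α_pos.le
    have e4 : 0 ≤ K ^ 5 * α := mul_nonneg (pow_nonneg hK.le 5) A.α_pos.le
    linarith
  have hK2 : 1 ≤ K ^ 2 := one_le_pow₀ A.le_K
  have hK4 : K ^ 2 ≤ K ^ 4 := pow_le_pow_right₀ A.le_K (by norm_num)
  have hk4 : k ^ 4 ≤ k ^ 2 := pow_le_pow_of_le_one hk.le A.k_le (by norm_num)
  have hk2 : k ^ 2 ≤ 1 := pow_le_one₀ hk.le A.k_le
  have hα0 := A.α_pos
  refine ⟨?_, ?_, ?_, ?_⟩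
  · nlinarith
  · nlinarith
  · rw [div_mul_eq_mul_div, div_le_iff₀ (by positivity)]
    nlinarith
  · rw [div_mul_eq_mul_div, div_lt_div_iff₀ (by positivity) (by positivity)]
    nlinarith

/-- The infimum of the form is at most of order `α`: the vector `z` is moved into the constraint
space by a small multiple of the component of `w` orthogonal to `q`. -/
theorem exists_test_vector (hα : α < k ^ 5 / (128 * K ^ 5)) :
    ∃ x, m x q = 0 ∧ m x w = 0 ∧ m x x = 1 ∧ B x x ≤ 32 * K ^ 4 / k ^ 3 * α := by
  obtain ⟨hα1, hα2, -, -⟩ := A.small hα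
  have hk := A.k_pos
  have hK := A.K_pos
  have hα0 := A.α_pos
  have hmq : 0 < m q q := hk.trans_le A.m_q
  -- the component of `w` orthogonal to `q`, whose squared length is still of the order `1/α`
  set s := m w q / m q q with hs
  set v := w - s • q with hv
  have hvq : m v q = 0 := by
    simp [hv, hs, div_mul_cancel₀ _ hmq.ne']
  have hs1 : |s| ≤ K / k := by
    rw [hs, abs_div, abs_of_pos hmq]
    exact div_le_div₀ hK.le A.m_w_q hk A.m_q
  have hs2 : s ^ 2 ≤ K ^ 2 / k ^ 2 := by
    rw [← sq_abs, ← div_pow]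
    exact pow_le_pow_left₀ (abs_nonneg _) hs1 2
  have hvw : m v w = m v v := by
    have : m v v = m v w - s * m v q := by
      simp only [hv, map_sub, map_smul, LinearMap.sub_apply, LinearMap.smul_apply, smul_eq_mul]
    rw [this, hvq]
    ring
  have hzv : m z v = m z w := by simp [hv, A.z_q]
  have hvv : k / (2 * α) ≤ m v v := by
    have e : m v v = m w w - s * m w q := by
      rw [← hvw, A.m_comm w q]
      simp [hv]
    have e1 : s * m w q ≤ K ^ 2 / k := by
      calc s * m w q ≤ |s| * |m w q| := by rw [← abs_mul]; exact le_abs_self _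
        _ ≤ K / k * K := mul_le_mul hs1 A.m_w_q (abs_nonneg _) (by positivity)
        _ = K ^ 2 / k := by ring
    have e2 : K ^ 2 / k ≤ k / (2 * α) := by
      rw [div_le_div_iff₀ hk (by positivity)]
      nlinarith
    have e3 : k / α = k / (2 * α) + k / (2 * α) := by field_simp; ring
    have := A.m_w
    linarith
  have hvv0 : 0 < m v v := lt_of_lt_of_le (by positivity) hvv
  have hhv : h v v ≤ 4 * K / α := by
    have e := psd_add_le A.h_psd w (-(s • q))
    rw [← sub_eq_add_neg, ← hv] at e
    have e1 : h (-(s • q)) (-(s • q)) ≤ K ^ 2 / k ^ 2 * K := by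
      have e2 : h (-(s • q)) (-(s • q)) = s ^ 2 * h q q := by
        simp only [map_neg, map_smul, LinearMap.neg_apply, LinearMap.smul_apply, smul_eq_mul]
        ring
      rw [e2]
      exact mul_le_mul hs2 A.h_q (A.h_nonneg q) (by positivity)
    have e2 : K ^ 2 / k ^ 2 * K ≤ K / α := by
      rw [div_mul_eq_mul_div, div_le_div_iff₀ (by positivity) hα0]
      nlinarith
    have := A.h_w
    have e3 : 4 * K / α = 2 * (K / α) + 2 * (K / α) := by ring
    linarith
  -- `β` is such that `z - β v` satisfies both constraints; it is of the order `α`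
  set d := m z w with hd
  set β := d / m v v with hβ
  have hβ1 : |β| ≤ 2 * K * α / k := by
    rw [hβ, abs_div, abs_of_pos hvv0]
    calc |d| / m v v ≤ K / (k / (2 * α)) :=
          div_le_div₀ hK.le A.m_z_w' (by positivity) hvv
      _ = 2 * K * α / k := by field_simp
  have hβ2 : β ^ 2 ≤ (2 * K * α / k) ^ 2 := by
    rw [← sq_abs]
    exact pow_le_pow_left₀ (abs_nonneg _) hβ1 2
  set y := z - β • v with hy
  have hyq : m y q = 0 := by simp [hy, A.z_q, hvq]
  have hyw : m y w = 0 := by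
    simp [hy, hvw, hβ, hd, div_mul_cancel₀ _ hvv0.ne']
  have hyy : k / 2 ≤ m y y := by
    have e : m y y = m z z - β * d := by
      have hvz : m v z = d := by rw [A.m_comm, hzv]
      have hbv : β * m v v = d := by rw [hβ, div_mul_cancel₀ _ hvv0.ne']
      simp only [hy, map_sub, map_smul, LinearMap.sub_apply, LinearMap.smul_apply, smul_eq_mul,
        hzv, hvz, hbv]
      ring
    have e1 : β * d ≤ 2 * K * α / k * K := by
      calc β * d ≤ |β| * |d| := by rw [← abs_mul]; exact le_abs_self _
        _ ≤ _ := mul_le_mul hβ1 A.m_z_w' (abs_nonneg _) (by positivity)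
    have e2 : 2 * K * α / k * K ≤ k / 2 := by
      rw [div_mul_eq_mul_div, div_le_div_iff₀ hk two_pos]
      nlinarith
    have := A.m_z
    linarith
  have hyy0 : 0 < m y y := lt_of_lt_of_le (by positivity) hyy
  have hBy : B y y ≤ 16 * K ^ 4 / k ^ 2 * α := by
    have e : B y y = β ^ 2 * B v v := by
      simp only [hy, map_sub, map_smul, LinearMap.sub_apply, LinearMap.smul_apply, smul_eq_mul,
        A.B_z, A.B_z_right]
      ring
    rw [e]
    calc β ^ 2 * B v v ≤ (2 * K * α / k) ^ 2 * (K * (4 * K / α)) := by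
          refine (mul_le_mul_of_nonneg_left ((le_abs_self _).trans (A.B_bound v))
            (sq_nonneg _)).trans (mul_le_mul hβ2 (mul_le_mul_of_nonneg_left hhv hK.le)
            (mul_nonneg hK.le (A.h_nonneg v)) (sq_nonneg _))
      _ = 16 * K ^ 4 / k ^ 2 * α := by field_simp; ring
  set r := (Real.sqrt (m y y))⁻¹ with hr
  have hr2 : r * r = (m y y)⁻¹ := by
    rw [hr, ← mul_inv, Real.mul_self_sqrt hyy0.le]
  refine ⟨r • y, by simp [hyq], by simp [hyw], ?_, ?_⟩
  · simp only [map_smul, LinearMap.smul_apply, smul_eq_mul, ← mul_assoc, hr2]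
    exact inv_mul_cancel₀ hyy0.ne'
  · simp only [map_smul, LinearMap.smul_apply, smul_eq_mul, ← mul_assoc, hr2]
    calc (m y y)⁻¹ * B y y ≤ (m y y)⁻¹ * (16 * K ^ 4 / k ^ 2 * α) :=
          mul_le_mul_of_nonneg_left hBy (by positivity)
      _ ≤ (k / 2)⁻¹ * (16 * K ^ 4 / k ^ 2 * α) := by gcongr
      _ = 32 * K ^ 4 / k ^ 3 * α := by field_simp; ring

omit A in
/-- `x` minimizes `B` among the vectors orthogonal to `q` and `w` of unit length for `m`. -/
def IsMin (m B : V →ₗ[ℝ] V →ₗ[ℝ] ℝ) (q w x : V) : Prop :=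
  m x q = 0 ∧ m x w = 0 ∧ m x x = 1 ∧
    ∀ y, m y q = 0 → m y w = 0 → m y y = 1 → B x x ≤ B y y

theorem nonneg_constraint (hα : α ≤ 1) {x : V} (hq : m x q = 0) (hw : m x w = 0) : 0 ≤ B x x := by
  refine le_trans ?_ (A.coercive_constraint hα hq hw)
  have := A.k_pos
  have := A.α_pos
  have := A.h_nonneg x
  positivity

/-- A minimizing sequence whose components along `z` converge is a Cauchy sequence, since the form
minus a small multiple of `m` is coercive on the complement of `z`. -/
theorem exists_isMin (hα : α < k ^ 5 / (128 * K ^ 5)) : ∃ x, IsMin m B q w x := by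
  obtain ⟨hα1, -, hα3, -⟩ := A.small hα
  have hk := A.k_pos
  have hK := A.K_pos
  set S : Set ℝ := {b | ∃ x, m x q = 0 ∧ m x w = 0 ∧ m x x = 1 ∧ B x x = b} with hS
  have hSbdd : BddBelow S := ⟨0, by
    rintro b ⟨x, h1, h2, -, rfl⟩
    exact A.nonneg_constraint hα1 h1 h2⟩
  obtain ⟨x₀, hx1, hx2, hx3, hx4⟩ := A.exists_test_vector hα
  have hSne : S.Nonempty := ⟨_, x₀, hx1, hx2, hx3, rfl⟩
  set l := sInf S with hl
  have hl_le : l ≤ k / 2 := (csInf_le hSbdd ⟨x₀, hx1, hx2, hx3, rfl⟩).trans (hx4.trans hα3)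
  have hl_nonneg : 0 ≤ l := le_csInf hSne (by
    rintro b ⟨x, h1, h2, -, rfl⟩
    exact A.nonneg_constraint hα1 h1 h2)
  have hlm : ∀ y, m y q = 0 → m y w = 0 → l * m y y ≤ B y y := by
    intro y hyq hyw
    rcases (A.m_nonneg y).eq_or_lt with h0 | h0
    · rw [← h0, mul_zero]
      exact A.nonneg_constraint hα1 hyq hyw
    · set r := (Real.sqrt (m y y))⁻¹ with hr
      have hr2 : r * r = (m y y)⁻¹ := by rw [hr, ← mul_inv, Real.mul_self_sqrt h0.le]
      have : l ≤ (m y y)⁻¹ * B y y := csInf_le hSbdd ⟨r • y, by simp [hyq], by simp [hyw], by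
        simp only [map_smul, LinearMap.smul_apply, smul_eq_mul, ← mul_assoc, hr2]
        exact inv_mul_cancel₀ h0.ne', by
        simp only [map_smul, LinearMap.smul_apply, smul_eq_mul, ← mul_assoc, hr2]⟩
      rwa [inv_mul_eq_div, le_div_iff₀ h0] at this
  -- a minimizing sequence whose components along `z` are bounded, hence converge on a subsequence
  have hseq : ∀ n : ℕ, ∃ x, m x q = 0 ∧ m x w = 0 ∧ m x x = 1 ∧ B x x < l + 1 / ((n : ℝ) + 1) := by
    intro n
    obtain ⟨b, ⟨x, h1, h2, h3, rfl⟩, hb⟩ :=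
      exists_lt_of_csInf_lt hSne (show sInf S < l + 1 / ((n : ℝ) + 1) by
        rw [← hl]; linarith [Nat.one_div_pos_of_nat (α := ℝ) (n := n)])
    exact ⟨x, h1, h2, h3, hb⟩
  choose u huq huw hum huB using hseq
  have hγ : ∀ n, |m (u n) z / m z z| ≤ 1 / k := by
    intro n
    have e := A.m_self_eq (u n)
    rw [hum] at e
    have e1 := A.m_nonneg (perp m z (u n))
    have e2 : (m (u n) z / m z z) ^ 2 * k ≤ 1 := by
      have := mul_le_mul_of_nonneg_left A.m_z (sq_nonneg (m (u n) z / m z z))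
      linarith
    refine abs_le_of_sq_le_sq ?_ (by positivity)
    calc (m (u n) z / m z z) ^ 2 ≤ 1 / k := by rwa [le_div_iff₀ hk]
      _ ≤ (1 / k) ^ 2 := by
          rw [sq]
          exact le_mul_of_one_le_left (by positivity) (by rw [le_div_iff₀ hk]; linarith [A.k_le])
  obtain ⟨γ, -, φ, hφ, hγφ⟩ := tendsto_subseq_of_bounded (Metric.isBounded_closedBall
    (x := (0 : ℝ)) (r := 1 / k)) (x := fun n => m (u n) z / m z z) (fun n => by
      rw [mem_closedBall_zero_iff, Real.norm_eq_abs]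
      exact hγ n)
  -- the parallelogram identity bounds `B - l m` on the difference of two terms of the sequence
  have key : ∀ i j, h (u i - u j) (u i - u j) ≤
      4 * K * (m (u i) z / m z z - m (u j) z / m z z) ^ 2 +
        8 / k * (1 / ((i : ℝ) + 1) + 1 / ((j : ℝ) + 1)) := by
    intro i j
    set e := 1 / ((i : ℝ) + 1) + 1 / ((j : ℝ) + 1) with he
    set D := u i - u j with hD
    have hDq : m D q = 0 := by simp [hD, huq]
    have hg : m D z / m z z = m (u i) z / m z z - m (u j) z / m z z := by
      simp [hD, sub_div]
    have h1 := hlm (u i + u j) (by simp [huq]) (by simp [huw])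
    have h2 : B D D = 2 * B (u i) (u i) + 2 * B (u j) (u j) - B (u i + u j) (u i + u j) := by
      simp only [hD, map_sub, map_add, LinearMap.sub_apply, LinearMap.add_apply]
      ring
    have h3 : m D D = 4 - m (u i + u j) (u i + u j) := by
      have : m D D = 2 * m (u i) (u i) + 2 * m (u j) (u j) - m (u i + u j) (u i + u j) := by
        simp only [hD, map_sub, map_add, LinearMap.sub_apply, LinearMap.add_apply]
        ring
      rw [this, hum, hum]
      ring
    have h4 := A.coercive_perp hDq
    have h5 := A.m_self_eq D
    have h6 := A.h_le_perp D
    rw [hg] at h5 h6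
    set g := m (u i) z / m z z - m (u j) z / m z z with hgdef
    set p := perp m z D with hp
    have h7 : B D D - l * m D D ≤ 2 * e := by
      have := huB i
      have := huB j
      rw [h2, h3, he]
      linarith
    have h8 : m D D ≤ g ^ 2 * K + h p p := by
      rw [h5]
      exact add_le_add (mul_le_mul_of_nonneg_left ((A.m_le_h z).trans A.h_z) (sq_nonneg _))
        (A.m_le_h p)
    have h9 : l * m D D ≤ k / 2 * (g ^ 2 * K + h p p) :=
      mul_le_mul hl_le h8 (A.m_nonneg D) (by positivity)
    have h10 : h p p ≤ 4 / k * e + g ^ 2 * K := by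
      have : k * h p p ≤ 4 * e + k * (g ^ 2 * K) := by linarith
      rw [← sub_nonneg] at this ⊢
      have h11 : 4 / k * e + g ^ 2 * K - h p p = (4 * e + k * (g ^ 2 * K) - k * h p p) / k := by
        field_simp
      rw [h11]
      positivity
    calc h D D ≤ 2 * g ^ 2 * K + 2 * h p p := h6
      _ ≤ 2 * g ^ 2 * K + 2 * (4 / k * e + g ^ 2 * K) := by linarith
      _ = _ := by ring
  set r : ℕ → ℝ := fun n => 8 * K * (m (u (φ n)) z / m z z - γ) ^ 2 +
    8 / k * (1 / ((φ n : ℝ) + 1)) with hrdef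
  have ht : Tendsto (fun n => 1 / ((φ n : ℝ) + 1)) atTop (𝓝 0) :=
    (tendsto_one_div_add_atTop_nhds_zero_nat (𝕜 := ℝ)).comp hφ.tendsto_atTop
  have hr : Tendsto r atTop (𝓝 0) := by
    have h1 := (((hγφ.sub_const γ).pow 2).const_mul (8 * K)).add (ht.const_mul (8 / k))
    simpa [hrdef] using h1
  obtain ⟨x, hx⟩ := A.complete (u ∘ φ) (by
    intro ε hε
    obtain ⟨N, hN⟩ := eventually_atTop.1 (hr.eventually_lt_const (half_pos hε))
    refine ⟨N, fun i hi j hj => ?_⟩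
    have h1 := hN i hi
    have h2 := hN j hj
    refine (key (φ i) (φ j)).trans_lt ?_
    simp only [hrdef] at h1 h2
    have h3 : ∀ a b : ℝ, 4 * K * (a - b) ^ 2 ≤ 8 * K * (a - γ) ^ 2 + 8 * K * (b - γ) ^ 2 := by
      intro a b
      have : 0 ≤ 4 * K * (a - γ + (b - γ)) ^ 2 := by positivity
      linarith
    have := h3 (m (u (φ i)) z / m z z) (m (u (φ j)) z / m z z)
    rw [mul_add]
    linarith)
  have hm1 := fun y => tendsto_of_le A.m_psd (C := 1) (h := h) (by simpa using A.m_le_h) hx y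
  have hh1 := tendsto_of_le A.h_psd (C := 1) (h := h) (by simp) hx x
  -- `B` is the difference of two positive semidefinite forms dominated by `h`, hence continuous
  have hKB : (K • h + B).IsPosSemidef := by
    refine ⟨⟨fun x y => ?_⟩, ⟨fun x => ?_⟩⟩
    · have : h x y = h y x := A.h_psd.1.eq x y
      simp [this, A.B_symm x y]
    · have := (abs_le.1 (A.B_bound x)).1
      simp only [LinearMap.add_apply, LinearMap.smul_apply, smul_eq_mul]
      linarith
  have hB1 := (tendsto_of_le hKB (C := 2 * K) (h := h) (fun x => by
    have := (abs_le.1 (A.B_bound x)).2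
    simp only [LinearMap.add_apply, LinearMap.smul_apply, smul_eq_mul]
    linarith) hx x).2.sub (hh1.2.const_mul K)
  simp only [LinearMap.add_apply, LinearMap.smul_apply, smul_eq_mul, Function.comp,
    add_sub_cancel_left] at hB1
  have hBx : B x x ≤ l := by
    refine le_of_tendsto_of_tendsto' hB1 (g := fun n => l + 1 / ((φ n : ℝ) + 1)) ?_
      fun n => (huB _).le
    simpa using ht.const_add l
  refine ⟨x, tendsto_nhds_unique (hm1 q).1 (by simp [huq]),
    tendsto_nhds_unique (hm1 w).1 (by simp [huw]),
    tendsto_nhds_unique (hm1 x).2 (by simp [hum]), fun y hyq hyw hyy => hBx.trans ?_⟩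
  exact csInf_le hSbdd ⟨y, hyq, hyw, hyy, rfl⟩

section Minimizer

variable {x : V} (hα : α < k ^ 5 / (128 * K ^ 5)) (hx : IsMin m B q w x)
include hα hx

theorem IsMin.value_le : B x x ≤ 32 * K ^ 4 / k ^ 3 * α := by
  obtain ⟨y, h1, h2, h3, h4⟩ := A.exists_test_vector hα
  exact (hx.2.2.2 y h1 h2 h3).trans h4

/-- The minimum property, extended to vectors of arbitrary length. -/
theorem IsMin.homogeneous {y : V} (hyq : m y q = 0) (hyw : m y w = 0) :
    B x x * m y y ≤ B y y := by
  rcases (A.m_nonneg y).eq_or_lt with h0 | h0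
  · rw [← h0, mul_zero]
    exact A.nonneg_constraint (A.small hα).1 hyq hyw
  · set r := (Real.sqrt (m y y))⁻¹ with hr
    have hr2 : r * r = (m y y)⁻¹ := by rw [hr, ← mul_inv, Real.mul_self_sqrt h0.le]
    have := hx.2.2.2 (r • y) (by simp [hyq]) (by simp [hyw])
      (by simp only [map_smul, LinearMap.smul_apply, smul_eq_mul, ← mul_assoc, hr2]
          exact inv_mul_cancel₀ h0.ne')
    simp only [map_smul, LinearMap.smul_apply, smul_eq_mul, ← mul_assoc, hr2] at this
    rwa [inv_mul_eq_div, le_div_iff₀ h0] at this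

/-- The Euler–Lagrange equation of a minimizer. No multipliers appear, since `y` satisfies the two
orthogonality constraints. -/
theorem IsMin.euler_lagrange {y : V} (hyq : m y q = 0) (hyw : m y w = 0) :
    B x y = B x x * m x y := by
  have h1 : ∀ t : ℝ, 0 ≤ (B y y - B x x * m y y) * (t * t) + 2 * (B x y - B x x * m x y) * t + 0 := by
    intro t
    have h2 := IsMin.homogeneous A hα hx (y := x + t • y) (by simp [hx.1, hyq])
      (by simp [hx.2.1, hyw])
    simp only [map_add, map_smul, LinearMap.add_apply, LinearMap.smul_apply, smul_eq_mul,
      hx.2.2.1, A.B_symm y x, A.m_comm y x] at h2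
    linarith
  have h2 := discrim_le_zero h1
  rw [discrim] at h2
  have h3 : (B x y - B x x * m x y) ^ 2 ≤ 0 := by linarith
  have h4 := pow_eq_zero_iff two_ne_zero |>.1 (le_antisymm h3 (sq_nonneg _))
  linarith

theorem IsMin.h_perp_le : h (perp m z x) (perp m z x) ≤ 32 * K ^ 4 / k ^ 4 * α := by
  have hk := A.k_pos
  have h1 := (A.coercive_perp hx.1).trans (IsMin.value_le A hα hx)
  rw [← le_div_iff₀' hk] at h1
  refine h1.trans_eq ?_
  field_simp

theorem IsMin.h_perp_le_half : h (perp m z x) (perp m z x) ≤ 1 / 2 := by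
  have hk := A.k_pos
  refine (IsMin.h_perp_le A hα hx).trans ?_
  have h1 := (A.small hα).2.2.1
  have : 32 * K ^ 4 / k ^ 4 * α = (32 * K ^ 4 / k ^ 3 * α) / k := by field_simp
  rw [this, div_le_iff₀ hk]
  linarith

omit hα in
theorem IsMin.abs_coeff_le : |m x z / m z z| ≤ 32 * K ^ 4 / k ^ 4 := by
  have hk := A.k_pos
  have e := A.m_self_eq x
  rw [hx.2.2.1] at e
  have e1 := A.m_nonneg (perp m z x)
  have e2 : (m x z / m z z) ^ 2 * k ≤ 1 := by
    have := mul_le_mul_of_nonneg_left A.m_z (sq_nonneg (m x z / m z z))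
    linarith
  have e3 : 1 ≤ 1 / k := by rw [le_div_iff₀ hk]; linarith [A.k_le]
  have e4 : |m x z / m z z| ≤ 1 / k := by
    refine abs_le_of_sq_le_sq ?_ (by positivity)
    calc (m x z / m z z) ^ 2 ≤ 1 / k := by rwa [le_div_iff₀ hk]
      _ ≤ (1 / k) ^ 2 := by
          rw [sq]
          exact le_mul_of_one_le_left (by positivity) e3
  refine e4.trans ?_
  rw [div_le_div_iff₀ hk (by positivity)]
  have e5 : k ^ 4 ≤ k := pow_le_of_le_one hk.le A.k_le (by norm_num)
  have e6 : 1 ≤ K ^ 4 := one_le_pow₀ A.le_K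
  nlinarith

/-- On the complement of a minimizer the form is coercive with a constant independent of `α`, since
the minimizer is close to a multiple of `z`. -/
theorem IsMin.coercive_orthogonal {y : V} (hyq : m y q = 0) (hyx : m y x = 0) :
    k ^ 2 / (4 * K) * h y y ≤ B y y := by
  have hk := A.k_pos
  have hK := A.K_pos
  have hz := A.z_pos
  set γ := m x z / m z z with hγ
  set γ' := m y z / m z z with hγ'
  set p := perp m z y with hp
  set p' := perp m z x with hp'
  have h1 : γ * γ' * m z z = -m p p' := by
    have e : m y x = γ * γ' * m z z + m p p' := by
      simp only [hp, hp', perp, hγ, hγ', map_sub, map_smul, LinearMap.sub_apply,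
        LinearMap.smul_apply, smul_eq_mul, A.m_comm z x]
      field_simp
      ring
    rw [hyx] at e
    linarith
  have h2 : 1 / 2 ≤ γ ^ 2 * m z z := by
    have e := A.m_self_eq x
    rw [hx.2.2.1] at e
    have := (A.m_le_h p').trans (IsMin.h_perp_le_half A hα hx)
    linarith
  have hH := A.h_nonneg p
  have h3 : (γ ^ 2 * m z z) * (γ' ^ 2 * m z z) ≤ h p p * (1 / 2) := by
    calc (γ ^ 2 * m z z) * (γ' ^ 2 * m z z) = (γ * γ' * m z z) ^ 2 := by ring
      _ = m p p' ^ 2 := by rw [h1, neg_sq]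
      _ ≤ m p p * m p' p' := psd_cauchy_schwarz A.m_psd _ _
      _ ≤ h p p * (1 / 2) := mul_le_mul (A.m_le_h p)
          ((A.m_le_h p').trans (IsMin.h_perp_le_half A hα hx)) (A.m_nonneg _) hH
  have h4 : γ' ^ 2 * m z z ≤ h p p := by
    have e0 : 0 ≤ γ' ^ 2 * m z z := by positivity
    have := mul_le_mul_of_nonneg_right h2 e0
    linarith
  have h5 : γ' ^ 2 * k ≤ h p p :=
    (mul_le_mul_of_nonneg_left A.m_z (sq_nonneg _)).trans h4
  have h6 := A.h_le_perp y
  have h7 : k * h y y ≤ 4 * K * h p p := by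
    calc k * h y y ≤ k * (2 * γ' ^ 2 * K + 2 * h p p) := mul_le_mul_of_nonneg_left h6 hk.le
      _ = 2 * K * (γ' ^ 2 * k) + 2 * k * h p p := by ring
      _ ≤ 2 * K * h p p + 2 * K * h p p := by
          have := A.k_le.trans A.le_K
          gcongr
      _ = 4 * K * h p p := by ring
  calc k ^ 2 / (4 * K) * h y y = k / (4 * K) * (k * h y y) := by ring
    _ ≤ k / (4 * K) * (4 * K * h p p) := mul_le_mul_of_nonneg_left h7 (by positivity)
    _ = k * h p p := by field_simp
    _ ≤ B y y := A.coercive_perp hyq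

/-- The Euler–Lagrange equation makes the two parts of `y` orthogonal for `B`, so that the bounds
on the complement of the minimizer and on its span add up. -/
theorem IsMin.anisotropic {y : V} (hyq : m y q = 0) (hyw : m y w = 0) :
    k ^ 2 / (4 * K) * h (y - m y x • x) (y - m y x • x) +
      k ^ 3 / (4 * K ^ 2) * α * h (m y x • x) (m y x • x) ≤ B y y := by
  set s := m y x with hs
  have hgq : m (y - s • x) q = 0 := by simp [hyq, hx.1]
  have hgw : m (y - s • x) w = 0 := by simp [hyw, hx.2.1]
  have hgx : m (y - s • x) x = 0 := by simp [hs, hx.2.2.1]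
  have h1 := IsMin.coercive_orthogonal A hα hx hgq hgx
  have h2 := A.coercive_constraint (A.small hα).1 (x := s • x) (by simp [hx.1]) (by simp [hx.2.1])
  have h3 : B x (y - s • x) = 0 := by
    rw [IsMin.euler_lagrange A hα hx hgq hgw, A.m_comm, hgx, mul_zero]
  have h4 : B y y = B (y - s • x) (y - s • x) + B (s • x) (s • x) + 2 * (s * B x (y - s • x)) := by
    simp only [map_sub, map_smul, LinearMap.sub_apply, LinearMap.smul_apply, smul_eq_mul,
      A.B_symm y x]
    ring
  rw [h4, h3]
  linarith

/-- Minimizers agree up to sign and up to a vector that is null for `h`: the component of one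
orthogonal to the other would have a quotient both of order `α` and bounded below. -/
theorem IsMin.unique {y : V} (hy : IsMin m B q w y) :
    h (y - x) (y - x) = 0 ∨ h (y + x) (y + x) = 0 := by
  have hk := A.k_pos
  set s := m y x with hs
  set g := y - s • x with hg
  have hgq : m g q = 0 := by simp [hg, hy.1, hx.1]
  have hgw : m g w = 0 := by simp [hg, hy.2.1, hx.2.1]
  have hgx : m g x = 0 := by simp [hg, hs, hx.2.2.1]
  have h0 : B g g = B x x * m g g := by
    have e1 := IsMin.euler_lagrange A hα hx hgq hgw
    have e2 := IsMin.euler_lagrange A hα hy hgq hgw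
    have e3 : B y y = B x x := le_antisymm (hy.2.2.2 x hx.1 hx.2.1 hx.2.2.1)
      (hx.2.2.2 y hy.1 hy.2.1 hy.2.2.1)
    have e4 : B g g = B y g - s * B x g := by
      conv_lhs => rw [hg]
      simp [hg]
    have e5 : m g g = m y g - s * m x g := by
      conv_lhs => rw [hg]
      simp [hg]
    rw [e4, e5, e1, e2, e3]
    ring
  have h2 : h g g = 0 := by
    have e1 := IsMin.coercive_orthogonal A hα hx hgq hgx
    have e2 : B x x * m g g ≤ 32 * K ^ 4 / k ^ 3 * α * h g g :=
      mul_le_mul (IsMin.value_le A hα hx) (A.m_le_h g) (A.m_nonneg g)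
        ((A.nonneg_constraint (A.small hα).1 hx.1 hx.2.1).trans (IsMin.value_le A hα hx))
    rw [← h0] at e2
    have e3 := (A.small hα).2.2.2
    have e4 := A.h_nonneg g
    by_contra hne
    have e5 : 0 < h g g := lt_of_le_of_ne e4 (Ne.symm hne)
    have e6 := mul_lt_mul_of_pos_right e3 e5
    linarith
  have h3 : s ^ 2 = 1 := by
    have e : m g g = 1 - s ^ 2 := by
      have e1 : m g g = m y g - s * m x g := by
        conv_lhs => rw [hg]
        simp [hg]
      rw [e1, A.m_comm x g, hgx, hg]
      simp [hy.2.2.1, ← hs]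
      ring
    have e2 : m g g = 0 := le_antisymm ((A.m_le_h g).trans h2.le) (A.m_nonneg g)
    linarith
  rcases (sq_eq_sq_iff_eq_or_eq_neg (b := (1 : ℝ))).1 (h3.trans (one_pow 2).symm) with h4 | h4
  · left
    rw [hg, h4, one_smul] at h2
    exact h2
  · right
    rw [hg, h4, neg_one_smul, sub_neg_eq_add] at h2
    exact h2

end Minimizer

end AnisotropicForm

end Abstract

/-! ### Weak derivatives and absolutely continuous functions -/

/-- `u` is absolutely continuous on every bounded interval, with derivative `v` almost everywhere.
This is the working description of a function with the weak derivative `v`. -/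
structure HasACDeriv (u v : ℝ → ℝ) : Prop where
  absCont : ∀ a b, AbsolutelyContinuousOnInterval u a b
  ae_hasDerivAt : ∀ᵐ x, HasDerivAt u (v x) x

namespace HasACDeriv

variable {u v u' v' : ℝ → ℝ}

theorem intervalIntegrable (h : HasACDeriv u v) (a b : ℝ) : IntervalIntegrable v volume a b :=
  (h.absCont a b).intervalIntegrable_deriv.congr_ae (ae_restrict_of_ae (by
    filter_upwards [h.ae_hasDerivAt] with x hx using hx.deriv))

theorem integral_eq (h : HasACDeriv u v) (a b : ℝ) : ∫ x in a..b, v x = u b - u a := by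
  rw [← (h.absCont a b).integral_deriv_eq_sub]
  refine intervalIntegral.integral_congr_ae ?_
  filter_upwards [h.ae_hasDerivAt] with x hx _ using hx.deriv.symm

theorem continuous (h : HasACDeriv u v) : Continuous u := by
  refine continuous_iff_continuousAt.2 fun x => ?_
  refine (h.absCont (x - 1) (x + 1)).continuousOn.continuousAt ?_
  rw [uIcc_of_le (by linarith)]
  exact Icc_mem_nhds (by linarith) (by linarith)

theorem add (h : HasACDeriv u v) (h' : HasACDeriv u' v') : HasACDeriv (u + u') (v + v') :=
  ⟨fun a b => (h.absCont a b).add (h'.absCont a b), by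
    filter_upwards [h.ae_hasDerivAt, h'.ae_hasDerivAt] with x hx hx' using hx.add hx'⟩

theorem const_smul (h : HasACDeriv u v) (t : ℝ) : HasACDeriv (t • u) (t • v) :=
  ⟨fun a b => (h.absCont a b).const_mul t, by
    filter_upwards [h.ae_hasDerivAt] with x hx using hx.const_mul t⟩

theorem sub (h : HasACDeriv u v) (h' : HasACDeriv u' v') : HasACDeriv (u - u') (v - v') :=
  ⟨fun a b => (h.absCont a b).sub (h'.absCont a b), by
    filter_upwards [h.ae_hasDerivAt, h'.ae_hasDerivAt] with x hx hx' using hx.sub hx'⟩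

theorem mul (h : HasACDeriv u v) (h' : HasACDeriv u' v') :
    HasACDeriv (u * u') (fun x => v x * u' x + u x * v' x) :=
  ⟨fun a b => (h.absCont a b).mul (h'.absCont a b), by
    filter_upwards [h.ae_hasDerivAt, h'.ae_hasDerivAt] with x hx hx' using hx.mul hx'⟩

theorem of_hasDerivAt (h : ∀ x, HasDerivAt u (v x) x) (hv : Continuous v) : HasACDeriv u v := by
  refine ⟨fun a b => ContDiffOn.absolutelyContinuousOnInterval ?_, ae_of_all _ h⟩
  have : deriv u = v := funext fun x => (h x).deriv
  exact (contDiff_one_iff_deriv.2 ⟨fun x => (h x).differentiableAt, this ▸ hv⟩).contDiffOn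

theorem of_contDiff (h : ContDiff ℝ 1 u) : HasACDeriv u (deriv u) :=
  of_hasDerivAt (fun x => (h.differentiable one_ne_zero x).hasDerivAt)
    (contDiff_one_iff_deriv.1 h).2

theorem primitive (hv : LocallyIntegrable v) : HasACDeriv (fun x => ∫ t in (0 : ℝ)..x, v t) v := by
  refine ⟨fun a b => ?_, ?_⟩
  · have hi : ∀ a b, IntervalIntegrable v volume a b := fun a b =>
      intervalIntegrable_iff.mpr
        ((hv.integrableOn_isCompact isCompact_uIcc).mono_set uIoc_subset_uIcc)
    exact ((hi (min a (min b 0)) (max a (max b 0))).absolutelyContinuousOnInterval_intervalIntegral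
      (c := 0) (by rw [mem_uIcc]; left; simp)).mono (by
        rw [uIcc_of_le (a := min a (min b 0)) (by simp)]
        intro x hx
        rw [mem_uIcc] at hx
        simp only [mem_Icc, min_le_iff, le_max_iff]
        rcases hx with hx | hx
        · exact ⟨Or.inl hx.1, Or.inr (Or.inl hx.2)⟩
        · exact ⟨Or.inr (Or.inl hx.1), Or.inl hx.2⟩)
  · filter_upwards [LocallyIntegrable.ae_hasDerivAt_integral hv] with x hx using hx 0

theorem hasWeakDeriv (h : HasACDeriv u v) : HasWeakDeriv u v := by
  intro φ hφ hφs
  obtain ⟨R, hR⟩ := hφs.isCompact.isBounded.subset_closedBall (0 : ℝ)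
  have hφ0 : ∀ x, x ∉ Icc (-R) R → φ x = 0 := fun x hx => by
    refine image_eq_zero_of_notMem_tsupport fun hx' => hx ?_
    simpa [Real.closedBall_eq_Icc] using hR hx'
  have hφ'0 : ∀ x, x ∉ Icc (-R) R → deriv φ x = 0 := fun x hx => by
    refine image_eq_zero_of_notMem_tsupport fun hx' => hx ?_
    simpa [Real.closedBall_eq_Icc] using hR (closure_minimal (support_deriv_subset)
      (isClosed_tsupport φ) hx')
  have hφ1 := HasACDeriv.of_contDiff (hφ.of_le (by exact_mod_cast le_top) : ContDiff ℝ 1 φ)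
  have hm := h.mul hφ1
  -- `R` may be negative, if the test function vanishes; `|R| + 1` is beyond the support in any case
  have key : ∀ g : ℝ → ℝ, (∀ x, x ∉ Icc (-R) R → g x = 0) →
      ∫ x in (-(|R| + 1))..(|R| + 1), g x = ∫ x, g x := by
    intro g hg
    refine intervalIntegral.integral_eq_integral_of_support_subset fun x hx => ?_
    by_contra hx'
    refine hx (hg x fun hxR => hx' ?_)
    have := le_abs_self R
    exact ⟨by linarith [hxR.1], by linarith [hxR.2]⟩
  have h0 : ∀ x, |R| < |x| → φ x = 0 := fun x hx => hφ0 x fun hxR => by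
    have := abs_le.2 hxR
    linarith [le_abs_self R]
  have h1 := hm.integral_eq (-(|R| + 1)) (|R| + 1)
  have hpos : |R| < |(|R| + 1)| := by
    rw [abs_of_pos (a := |R| + 1) (by positivity)]
    linarith
  have hneg : |R| < |(-(|R| + 1))| := by rwa [abs_neg]
  simp only [Pi.mul_apply, h0 _ hpos, h0 _ hneg, mul_zero, sub_zero] at h1
  have i1 : IntervalIntegrable (fun x => v x * φ x) volume (-(|R| + 1)) (|R| + 1) :=
    (h.intervalIntegrable _ _).mul_continuousOn hφ.continuous.continuousOn
  have i2 : IntervalIntegrable (fun x => u x * deriv φ x) volume (-(|R| + 1)) (|R| + 1) :=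
    (hφ1.intervalIntegrable _ _).continuousOn_mul h.continuous.continuousOn
  rw [intervalIntegral.integral_add i1 i2, key _ fun x hx => by simp [hφ0 x hx],
    key _ fun x hx => by simp [hφ'0 x hx]] at h1
  linarith

end HasACDeriv

/-- A locally integrable function whose weak derivative vanishes is constant. -/
theorem ae_const_of_hasWeakDeriv_zero {D : ℝ → ℝ} (hD : LocallyIntegrable D)
    (h : ∀ φ : ℝ → ℝ, ContDiff ℝ ∞ φ → HasCompactSupport φ → ∫ x, D x * deriv φ x = 0) :
    ∃ C : ℝ, D =ᵐ[volume] fun _ => C := by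
  let b : ContDiffBump (0 : ℝ) := ⟨1, 2, one_pos, by norm_num⟩
  set ρ : ℝ → ℝ := b.normed volume with hρ
  have hρc : ContDiff ℝ ∞ ρ := b.contDiff_normed
  have hρs : HasCompactSupport ρ := b.hasCompactSupport_normed
  have hρ1 : ∫ x, ρ x = 1 := b.integral_normed
  have hint : ∀ g : ℝ → ℝ, Continuous g → HasCompactSupport g →
      Integrable (fun x => g x * D x) := fun g hg hgs => by
    simpa using hD.integrable_smul_left_of_hasCompactSupport hg hgs
  -- a test function of integral zero is the derivative of a test function
  have prim : ∀ ψ : ℝ → ℝ, ContDiff ℝ ∞ ψ → HasCompactSupport ψ → ∫ x, ψ x = 0 →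
      ∫ x, ψ x * D x = 0 := by
    intro ψ hψ hψs hψ0
    obtain ⟨R, hR⟩ := hψs.isCompact.isBounded.subset_closedBall (0 : ℝ)
    have hψz : ∀ x, x ∉ Icc (-R) R → ψ x = 0 := fun x hx => by
      refine image_eq_zero_of_notMem_tsupport fun hx' => hx ?_
      simpa [Real.closedBall_eq_Icc] using hR hx'
    set r := |R| + 1 with hr
    have hrR : R < r := by linarith [le_abs_self R]
    set Φ : ℝ → ℝ := fun x => ∫ t in (-r)..x, ψ t with hΦ
    have hd : ∀ x, HasDerivAt Φ (ψ x) x := fun x =>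
      intervalIntegral.integral_hasDerivAt_right (hψ.continuous.intervalIntegrable _ _)
        (hψ.continuous.stronglyMeasurableAtFilter _ _) hψ.continuous.continuousAt
    have hd' : deriv Φ = ψ := funext fun x => (hd x).deriv
    have hΦc : ContDiff ℝ ∞ Φ :=
      contDiff_infty_iff_deriv.2 ⟨fun x => (hd x).differentiableAt, hd' ▸ hψ⟩
    have hΦs : HasCompactSupport Φ := by
      refine HasCompactSupport.intro (isCompact_Icc (a := -r) (b := r)) fun x hx => ?_
      rcases lt_or_ge x (-r) with hx1 | hx1
      · refine intervalIntegral.integral_zero_ae (ae_of_all _ fun t ht => hψz t fun htR => ?_)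
        rw [uIoc_of_ge hx1.le] at ht
        linarith [ht.2, htR.1]
      · have hx2 : r < x := by
          by_contra hx2
          exact hx ⟨hx1, not_lt.1 hx2⟩
        change ∫ t in (-r)..x, ψ t = 0
        rw [← hψ0]
        refine intervalIntegral.integral_eq_integral_of_support_subset fun t ht => ?_
        by_contra ht'
        refine ht (hψz t fun htR => ht' ⟨by linarith [htR.1], by linarith [htR.2]⟩)
    have := h Φ hΦc hΦs
    rw [hd'] at this
    simpa only [mul_comm] using this
  refine ⟨∫ x, ρ x * D x, ?_⟩
  refine ae_eq_of_integral_contDiff_smul_eq hD (locallyIntegrable_const _) fun g hg hgs => ?_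
  have hi : Integrable g := hg.continuous.integrable_of_hasCompactSupport hgs
  have hiρ : Integrable ρ := hρc.continuous.integrable_of_hasCompactSupport hρs
  -- subtracting a multiple of the bump makes the integral of the test function vanish
  have h1 := prim (fun x => g x - (∫ y, g y) * ρ x) (hg.sub (contDiff_const.mul hρc))
    (hgs.sub (hρs.mul_left (f := fun _ => ∫ y, g y))) (by
      rw [integral_sub hi (hiρ.const_mul _), integral_const_mul, hρ1]
      ring)
  have h2 : ∫ x, (g x - (∫ y, g y) * ρ x) * D x =
      (∫ x, g x * D x) - (∫ y, g y) * ∫ x, ρ x * D x := by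
    rw [← integral_const_mul, ← integral_sub (hint g hg.continuous hgs)
      ((hint ρ hρc.continuous hρs).const_mul _)]
    congr 1
    ext x
    ring
  simp only [smul_eq_mul, integral_mul_const]
  linarith

/-- The absolutely continuous representative of a function with a locally integrable weak
derivative. -/
theorem HasWeakDeriv.exists_hasACDeriv {u v : ℝ → ℝ} (hu : LocallyIntegrable u)
    (hv : LocallyIntegrable v) (h : HasWeakDeriv u v) :
    ∃ U : ℝ → ℝ, U =ᵐ[volume] u ∧ HasACDeriv U v := by
  have hG := HasACDeriv.primitive hv
  set G : ℝ → ℝ := fun x => ∫ t in (0 : ℝ)..x, v t with hGdef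
  have hGl : LocallyIntegrable G := hG.continuous.locallyIntegrable
  obtain ⟨C, hC⟩ := ae_const_of_hasWeakDeriv_zero (D := u - G) (hu.sub hGl) (by
    intro φ hφ hφs
    have h1 := h φ hφ hφs
    have h2 := hG.hasWeakDeriv φ hφ hφs
    have hφ' : Continuous (deriv φ) := (contDiff_infty_iff_deriv.1 hφ).2.continuous
    have i1 : Integrable fun x => u x * deriv φ x := by
      simpa [mul_comm] using hu.integrable_smul_left_of_hasCompactSupport hφ' hφs.deriv
    have i2 : Integrable fun x => G x * deriv φ x := by
      simpa [mul_comm] using hGl.integrable_smul_left_of_hasCompactSupport hφ' hφs.deriv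
    simp only [Pi.sub_apply, sub_mul]
    rw [integral_sub i1 i2, h1, h2, sub_self])
  refine ⟨G + fun _ => C, ?_, ?_⟩
  · filter_upwards [hC] with x hx
    simp only [Pi.sub_apply] at hx
    simp only [Pi.add_apply]
    linarith
  · have := hG.add (HasACDeriv.of_hasDerivAt (u := fun _ => C) (v := 0)
      (fun x => hasDerivAt_const x C) continuous_const)
    simpa using this

/-! ### The space `H¹` -/

theorem memLp_mul_integrable {u v : ℝ → ℝ} (hu : MemLp u 2 volume) (hv : MemLp v 2 volume) :
    Integrable fun x => u x * v x :=
  hu.integrable_mul hv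

theorem integrable_mul_test {u φ : ℝ → ℝ} (hu : MemLp u 2 volume) (hφ : Continuous φ)
    (hφs : HasCompactSupport φ) : Integrable fun x => u x * φ x :=
  memLp_mul_integrable hu (hφ.memLp_of_hasCompactSupport hφs)

theorem HasWeakDeriv.add {u v u' v' : ℝ → ℝ} (hu : MemLp u 2 volume) (hv : MemLp v 2 volume)
    (hu' : MemLp u' 2 volume) (hv' : MemLp v' 2 volume) (h : HasWeakDeriv u v)
    (h' : HasWeakDeriv u' v') : HasWeakDeriv (u + u') (v + v') := by
  intro φ hφ hφs
  have hc : Continuous (deriv φ) := (contDiff_infty_iff_deriv.1 hφ).2.continuous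
  simp only [Pi.add_apply, add_mul]
  rw [integral_add (integrable_mul_test hu hc hφs.deriv) (integrable_mul_test hu' hc hφs.deriv),
    integral_add (integrable_mul_test hv hφ.continuous hφs)
      (integrable_mul_test hv' hφ.continuous hφs), h φ hφ hφs, h' φ hφ hφs]
  ring

theorem HasWeakDeriv.const_smul {u v : ℝ → ℝ} (h : HasWeakDeriv u v) (t : ℝ) :
    HasWeakDeriv (t • u) (t • v) := by
  intro φ hφ hφs
  simp only [Pi.smul_apply, smul_eq_mul, mul_assoc, integral_const_mul, h φ hφ hφs]
  ring

theorem MemH1.of_hasACDeriv {u v : ℝ → ℝ} (h : HasACDeriv u v) (hu : MemLp u 2 volume)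
    (hv : MemLp v 2 volume) : MemH1 u :=
  ⟨hu, v, hv, h.hasWeakDeriv⟩

theorem MemH1.exists_hasACDeriv {u : ℝ → ℝ} (hu : MemH1 u) :
    ∃ U : ℝ → ℝ, U =ᵐ[volume] u ∧ HasACDeriv U (weakDeriv u) :=
  (weakDeriv_spec hu).2.exists_hasACDeriv (hu.1.locallyIntegrable (by norm_num))
    ((weakDeriv_spec hu).1.locallyIntegrable (by norm_num))

theorem MemH1.add {u v : ℝ → ℝ} (hu : MemH1 u) (hv : MemH1 v) : MemH1 (u + v) :=
  ⟨hu.1.add hv.1, _, (weakDeriv_spec hu).1.add (weakDeriv_spec hv).1,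
    HasWeakDeriv.add hu.1 (weakDeriv_spec hu).1 hv.1 (weakDeriv_spec hv).1
      (weakDeriv_spec hu).2 (weakDeriv_spec hv).2⟩

theorem MemH1.const_smul {u : ℝ → ℝ} (hu : MemH1 u) (t : ℝ) : MemH1 (t • u) :=
  ⟨hu.1.const_smul t, _, (weakDeriv_spec hu).1.const_smul t, (weakDeriv_spec hu).2.const_smul t⟩

theorem weakDeriv_add {u v : ℝ → ℝ} (hu : MemH1 u) (hv : MemH1 v) :
    weakDeriv (u + v) =ᵐ[volume] weakDeriv u + weakDeriv v :=
  weakDeriv_ae_eq ((weakDeriv_spec hu).1.add (weakDeriv_spec hv).1)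
    (HasWeakDeriv.add hu.1 (weakDeriv_spec hu).1 hv.1 (weakDeriv_spec hv).1
      (weakDeriv_spec hu).2 (weakDeriv_spec hv).2)

theorem weakDeriv_smul {u : ℝ → ℝ} (hu : MemH1 u) (t : ℝ) :
    weakDeriv (t • u) =ᵐ[volume] t • weakDeriv u :=
  weakDeriv_ae_eq ((weakDeriv_spec hu).1.const_smul t) ((weakDeriv_spec hu).2.const_smul t)

/-- The real vector space of functions in `H¹(ℝ)`. Functions are not identified when they agree
almost everywhere. -/
def h1Space : Submodule ℝ (ℝ → ℝ) where
  carrier := {u | MemH1 u}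
  add_mem' := MemH1.add
  zero_mem' := MemH1.of_hasACDeriv (HasACDeriv.of_hasDerivAt (u := 0) (v := 0)
    (fun x => hasDerivAt_const x 0) continuous_const) MemLp.zero MemLp.zero
  smul_mem' t _ hu := MemH1.const_smul hu t

theorem h1Space_memLp (u : h1Space) : MemLp (u : ℝ → ℝ) 2 volume := u.2.1

theorem h1Space_memLp_weakDeriv (u : h1Space) : MemLp (weakDeriv u) 2 volume :=
  (weakDeriv_spec u.2).1

/-- The bilinear form `∫ W u v` on `H¹`, for a bounded continuous weight `W`. -/
def weightForm (W : ℝ → ℝ) (hW : Continuous W) (hWb : ∃ C, ∀ x, |W x| ≤ C) :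
    h1Space →ₗ[ℝ] h1Space →ₗ[ℝ] ℝ :=
  have hi : ∀ u v : h1Space, Integrable fun x => W x * ((u : ℝ → ℝ) x * (v : ℝ → ℝ) x) :=
    fun u v => (memLp_mul_integrable (h1Space_memLp u) (h1Space_memLp v)).bdd_mul
      hW.aestronglyMeasurable (ae_of_all _ hWb.choose_spec)
  LinearMap.mk₂ ℝ (fun u v => ∫ x, W x * ((u : ℝ → ℝ) x * (v : ℝ → ℝ) x))
    (fun u u' v => by
      rw [← integral_add (hi u v) (hi u' v)]
      congr 1; ext x; simp only [Submodule.coe_add, Pi.add_apply]; ring)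
    (fun t u v => by
      rw [smul_eq_mul, ← integral_const_mul]
      congr 1; ext x; simp only [Submodule.coe_smul, Pi.smul_apply, smul_eq_mul]; ring)
    (fun u v v' => by
      rw [← integral_add (hi u v) (hi u v')]
      congr 1; ext x; simp only [Submodule.coe_add, Pi.add_apply]; ring)
    (fun t u v => by
      rw [smul_eq_mul, ← integral_const_mul]
      congr 1; ext x; simp only [Submodule.coe_smul, Pi.smul_apply, smul_eq_mul]; ring)

/-- The bilinear form `∫ u' v'` on `H¹`. -/
def derivForm : h1Space →ₗ[ℝ] h1Space →ₗ[ℝ] ℝ :=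
  have hi : ∀ u v : h1Space, Integrable fun x => weakDeriv u x * weakDeriv v x :=
    fun u v => memLp_mul_integrable (h1Space_memLp_weakDeriv u) (h1Space_memLp_weakDeriv v)
  LinearMap.mk₂ ℝ (fun u v => ∫ x, weakDeriv u x * weakDeriv v x)
    (fun u u' v => by
      rw [← integral_add (hi u v) (hi u' v)]
      refine integral_congr_ae ?_
      filter_upwards [weakDeriv_add u.2 u'.2] with x hx
      simp only [Submodule.coe_add, hx, Pi.add_apply]; ring)
    (fun t u v => by
      rw [smul_eq_mul, ← integral_const_mul]
      refine integral_congr_ae ?_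
      filter_upwards [weakDeriv_smul u.2 t] with x hx
      simp only [Submodule.coe_smul, hx, Pi.smul_apply, smul_eq_mul]; ring)
    (fun u v v' => by
      rw [← integral_add (hi u v) (hi u v')]
      refine integral_congr_ae ?_
      filter_upwards [weakDeriv_add v.2 v'.2] with x hx
      simp only [Submodule.coe_add, hx, Pi.add_apply]; ring)
    (fun t u v => by
      rw [smul_eq_mul, ← integral_const_mul]
      refine integral_congr_ae ?_
      filter_upwards [weakDeriv_smul v.2 t] with x hx
      simp only [Submodule.coe_smul, hx, Pi.smul_apply, smul_eq_mul]; ring)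

/-- The `L²` pairing on `H¹`. -/
def l2Form : h1Space →ₗ[ℝ] h1Space →ₗ[ℝ] ℝ := weightForm 1 continuous_const ⟨1, by simp⟩

theorem l2Form_apply (u v : h1Space) : l2Form u v = inner2 u v := by
  simp [l2Form, weightForm, inner2]

theorem weightForm_apply {W : ℝ → ℝ} (hW : Continuous W) (hWb : ∃ C, ∀ x, |W x| ≤ C)
    (u v : h1Space) :
    weightForm W hW hWb u v = ∫ x, W x * ((u : ℝ → ℝ) x * (v : ℝ → ℝ) x) := rfl

theorem derivForm_apply (u v : h1Space) :
    derivForm u v = ∫ x, weakDeriv u x * weakDeriv v x := rfl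

/-- The `H¹` pairing. -/
def h1Form : h1Space →ₗ[ℝ] h1Space →ₗ[ℝ] ℝ := l2Form + derivForm

theorem h1Form_self (u : h1Space) : h1Form u u = normH1 u ^ 2 := by
  rw [normH1, Real.sq_sqrt (by positivity), h1Form]
  simp only [LinearMap.add_apply, l2Form_apply, derivForm_apply, inner2, ← sq]

theorem l2Form_psd : l2Form.IsPosSemidef := by
  refine ⟨⟨fun u v => ?_⟩, ⟨fun u => ?_⟩⟩
  · simp only [l2Form_apply, inner2, RingHom.id_apply, mul_comm]
  · rw [l2Form_apply]
    exact integral_nonneg fun x => mul_self_nonneg _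

theorem derivForm_psd : derivForm.IsPosSemidef := by
  refine ⟨⟨fun u v => ?_⟩, ⟨fun u => ?_⟩⟩
  · simp only [derivForm_apply, RingHom.id_apply, mul_comm]
  · rw [derivForm_apply]
    exact integral_nonneg fun x => mul_self_nonneg _

theorem h1Form_psd : h1Form.IsPosSemidef := l2Form_psd.add derivForm_psd

theorem l2Form_le_h1Form (u : h1Space) : l2Form u u ≤ h1Form u u :=
  le_add_of_nonneg_right (derivForm_psd.2.nonneg u)

theorem eLpNorm_two_sq {u : ℝ → ℝ} (hu : MemLp u 2 volume) :
    eLpNorm u 2 volume = ENNReal.ofReal (Real.sqrt (∫ x, u x ^ 2)) := by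
  have h := hu.eLpNorm_eq_integral_rpow_norm two_ne_zero ENNReal.ofNat_ne_top
  rw [h, Real.sqrt_eq_rpow]
  simp

/-- A sequence of square integrable functions that is Cauchy in `L²` converges in `L²`. -/
theorem exists_tendsto_of_cauchy_l2 (u : ℕ → ℝ → ℝ) (hu : ∀ n, MemLp (u n) 2 volume)
    (hc : ∀ ε > 0, ∃ N, ∀ i ≥ N, ∀ j ≥ N, ∫ x, (u i x - u j x) ^ 2 < ε) :
    ∃ U : ℝ → ℝ, MemLp U 2 volume ∧
      Tendsto (fun n => ∫ x, (u n x - U x) ^ 2) atTop (𝓝 0) := by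
  have hdist : ∀ (f g : ℝ → ℝ) (hf : MemLp f 2 volume) (hg : MemLp g 2 volume),
      dist (hf.toLp f) (hg.toLp g) = Real.sqrt (∫ x, (f x - g x) ^ 2) := by
    intro f g hf hg
    rw [Lp.dist_def, eLpNorm_congr_ae ((hf.coeFn_toLp).sub (hg.coeFn_toLp)),
      eLpNorm_two_sq (hf.sub hg), ENNReal.toReal_ofReal (Real.sqrt_nonneg _)]
    rfl
  have hcs : CauchySeq fun n => (hu n).toLp (u n) := by
    rw [Metric.cauchySeq_iff]
    intro ε hε
    obtain ⟨N, hN⟩ := hc (ε ^ 2) (by positivity)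
    refine ⟨N, fun i hi j hj => ?_⟩
    rw [hdist, Real.sqrt_lt' hε]
    exact hN i hi j hj
  obtain ⟨F, hF⟩ := cauchySeq_tendsto_of_complete hcs
  refine ⟨F, Lp.memLp F, ?_⟩
  have h1 : Tendsto (fun n => dist ((hu n).toLp (u n)) F ^ 2) atTop (𝓝 0) := by
    simpa using (tendsto_iff_dist_tendsto_zero.1 hF).pow 2
  refine h1.congr fun n => ?_
  have h2 := hdist (u n) F (hu n) (Lp.memLp F)
  rw [Lp.toLp_coeFn] at h2
  rw [h2, Real.sq_sqrt (integral_nonneg fun x => sq_nonneg _)]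

theorem sq_integral_mul_le {u v : ℝ → ℝ} (hu : MemLp u 2 volume) (hv : MemLp v 2 volume) :
    (∫ x, u x * v x) ^ 2 ≤ (∫ x, u x ^ 2) * ∫ x, v x ^ 2 := by
  have hi1 := memLp_mul_integrable hu hu
  have hi2 := memLp_mul_integrable hv hv
  have hi3 := memLp_mul_integrable hu hv
  simp only [← sq] at hi1 hi2
  have h : ∀ t : ℝ, 0 ≤ (∫ x, v x ^ 2) * (t * t) + 2 * (∫ x, u x * v x) * t + ∫ x, u x ^ 2 := by
    intro t
    have e : ∫ x, (u x + t * v x) ^ 2 =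
        (∫ x, v x ^ 2) * (t * t) + 2 * (∫ x, u x * v x) * t + ∫ x, u x ^ 2 := by
      have : (fun x => (u x + t * v x) ^ 2) =
          fun x => (t * t) * v x ^ 2 + (2 * t) * (u x * v x) + u x ^ 2 := by
        ext x; ring
      have e1 : Integrable fun x => (t * t) * v x ^ 2 := hi2.const_mul _
      have e2 : Integrable fun x => (2 * t) * (u x * v x) := hi3.const_mul _
      have e3 : Integrable fun x => (t * t) * v x ^ 2 + (2 * t) * (u x * v x) := e1.add e2
      rw [this, integral_add e3 hi1, integral_add e1 e2, integral_const_mul, integral_const_mul]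
      ring
    rw [← e]
    exact integral_nonneg fun x => sq_nonneg _
  have := discrim_le_zero h
  rw [discrim] at this
  linarith

theorem tendsto_integral_mul_of_l2 {u : ℕ → ℝ → ℝ} {U φ : ℝ → ℝ} (hu : ∀ n, MemLp (u n) 2 volume)
    (hU : MemLp U 2 volume) (hφ : MemLp φ 2 volume)
    (h : Tendsto (fun n => ∫ x, (u n x - U x) ^ 2) atTop (𝓝 0)) :
    Tendsto (fun n => ∫ x, u n x * φ x) atTop (𝓝 (∫ x, U x * φ x)) := by
  have h1 : Tendsto (fun n => (∫ x, (u n x - U x) * φ x) ^ 2) atTop (𝓝 0) := by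
    refine squeeze_zero (fun n => sq_nonneg _)
      (fun n => sq_integral_mul_le ((hu n).sub hU) hφ) ?_
    simpa using h.mul_const (∫ x, φ x ^ 2)
  have h2 : Tendsto (fun n => ∫ x, (u n x - U x) * φ x) atTop (𝓝 0) := by
    have h3 := (Real.continuous_sqrt.tendsto 0).comp h1
    rw [Real.sqrt_zero] at h3
    refine (tendsto_zero_iff_abs_tendsto_zero _).2 (h3.congr fun n => ?_)
    exact Real.sqrt_sq_eq_abs _
  have h4 := h2.add_const (∫ x, U x * φ x)
  rw [zero_add] at h4
  refine h4.congr fun n => ?_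
  simp only [sub_mul]
  rw [integral_sub (memLp_mul_integrable (hu n) hφ) (memLp_mul_integrable hU hφ)]
  ring

theorem h1Form_self_sub (u v : h1Space) : h1Form (u - v) (u - v) =
    (∫ x, ((u : ℝ → ℝ) x - (v : ℝ → ℝ) x) ^ 2) + ∫ x, (weakDeriv u x - weakDeriv v x) ^ 2 := by
  have h1 : weakDeriv ((u - v : h1Space) : ℝ → ℝ) =ᵐ[volume] weakDeriv u - weakDeriv v := by
    have e : ((u - v : h1Space) : ℝ → ℝ) = u + (-1 : ℝ) • (v : ℝ → ℝ) := by
      ext x; simp [sub_eq_add_neg]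
    rw [e]
    filter_upwards [weakDeriv_add u.2 (MemH1.const_smul v.2 (-1)), weakDeriv_smul v.2 (-1)]
      with x hx1 hx2
    rw [hx1, Pi.add_apply, hx2]
    simp [sub_eq_add_neg]
  simp only [h1Form, LinearMap.add_apply, l2Form_apply, derivForm_apply, inner2]
  congr 1
  · congr 1; ext x; simp [sq]
  · refine integral_congr_ae ?_
    filter_upwards [h1] with x hx
    rw [hx, Pi.sub_apply, sq]

/-- The space `H¹` is complete. -/
theorem h1Space_complete (u : ℕ → h1Space)
    (hc : ∀ ε > 0, ∃ N, ∀ i ≥ N, ∀ j ≥ N, h1Form (u i - u j) (u i - u j) < ε) :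
    ∃ x, Tendsto (fun n => h1Form (u n - x) (u n - x)) atTop (𝓝 0) := by
  simp only [h1Form_self_sub] at hc
  obtain ⟨U, hU, hUt⟩ := exists_tendsto_of_cauchy_l2 (fun n => u n) (fun n => h1Space_memLp _)
    (fun ε hε => by
      obtain ⟨N, hN⟩ := hc ε hε
      exact ⟨N, fun i hi j hj => lt_of_le_of_lt
        (le_add_of_nonneg_right (integral_nonneg fun x => sq_nonneg _)) (hN i hi j hj)⟩)
  obtain ⟨V, hV, hVt⟩ := exists_tendsto_of_cauchy_l2 (fun n => weakDeriv (u n))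
    (fun n => h1Space_memLp_weakDeriv _)
    (fun ε hε => by
      obtain ⟨N, hN⟩ := hc ε hε
      exact ⟨N, fun i hi j hj => lt_of_le_of_lt
        (le_add_of_nonneg_left (integral_nonneg fun x => sq_nonneg _)) (hN i hi j hj)⟩)
  have hUV : HasWeakDeriv U V := by
    intro φ hφ hφs
    have hc : Continuous (deriv φ) := (contDiff_infty_iff_deriv.1 hφ).2.continuous
    have t1 := tendsto_integral_mul_of_l2 (fun n => h1Space_memLp (u n)) hU
      (hc.memLp_of_hasCompactSupport hφs.deriv) hUt
    have t2 := tendsto_integral_mul_of_l2 (fun n => h1Space_memLp_weakDeriv (u n)) hV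
      (hφ.continuous.memLp_of_hasCompactSupport hφs) hVt
    refine tendsto_nhds_unique t1 (t2.neg.congr fun n => ?_)
    exact ((weakDeriv_spec (u n).2).2 φ hφ hφs).symm
  have hmem : MemH1 U := ⟨hU, V, hV, hUV⟩
  refine ⟨⟨U, hmem⟩, ?_⟩
  have := hUt.add hVt
  rw [zero_add] at this
  refine this.congr fun n => ?_
  rw [h1Form_self_sub]
  congr 1
  refine integral_congr_ae ?_
  filter_upwards [weakDeriv_ae_eq hV hUV] with x hx
  simp only [hx]

/-! ### The profile of a single solitary wave -/

theorem IsNonlinearity.contDiff_three {f : ℝ → ℝ} (hf : IsNonlinearity f) : ContDiff ℝ 3 f := by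
  obtain ⟨k, hk, h, -⟩ := hf.regular
  exact h.of_le (by exact_mod_cast hk)

theorem IsNonlinearity.hasDerivAt {f : ℝ → ℝ} (hf : IsNonlinearity f) (x : ℝ) :
    HasDerivAt f (deriv f x) x :=
  (hf.contDiff_three.differentiable (by norm_num) x).hasDerivAt

theorem IsNonlinearity.contDiff_deriv {f : ℝ → ℝ} (hf : IsNonlinearity f) :
    ContDiff ℝ 2 (deriv f) :=
  (contDiff_succ_iff_deriv (n := 2)).1 (by exact_mod_cast hf.contDiff_three) |>.2.2

theorem IsNonlinearity.continuous_deriv {f : ℝ → ℝ} (hf : IsNonlinearity f) :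
    Continuous (deriv f) := hf.contDiff_deriv.continuous

theorem IsNonlinearity.continuous {f : ℝ → ℝ} (hf : IsNonlinearity f) : Continuous f :=
  hf.contDiff_three.continuous

/-- Uniqueness for the linear second order initial value problem, in the form of a differential
inequality. -/
theorem eq_zero_of_abs_deriv_two_le {D D' D'' : ℝ → ℝ} {K : ℝ} (hK : 0 ≤ K)
    (h : ∀ x, HasDerivAt D (D' x) x) (h' : ∀ x, HasDerivAt D' (D'' x) x)
    (hD : ∀ x, |D'' x| ≤ K * |D x|) (h0 : D 0 = 0) (h0' : D' 0 = 0) {x : ℝ} (hx : 0 ≤ x) :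
    D x = 0 := by
  set E : ℝ → ℝ := fun x => (D x ^ 2 + D' x ^ 2) * Real.exp (-((1 + K) * x)) with hE
  have hd : ∀ x, HasDerivAt E ((2 * D x * D' x + 2 * D' x * D'' x) * Real.exp (-((1 + K) * x)) +
      (D x ^ 2 + D' x ^ 2) * (Real.exp (-((1 + K) * x)) * -(1 + K))) x := by
    intro x
    have e1 : HasDerivAt (fun x => D x ^ 2 + D' x ^ 2) (2 * D x * D' x + 2 * D' x * D'' x) x := by
      simpa using ((h x).fun_pow 2).fun_add ((h' x).fun_pow 2)
    have e2 : HasDerivAt (fun x : ℝ => Real.exp (-((1 + K) * x)))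
        (Real.exp (-((1 + K) * x)) * -(1 + K)) x := by
      have := ((hasDerivAt_id x).const_mul (1 + K)).neg.exp
      simpa using this
    exact e1.mul e2
  have hanti : Antitone E := by
    refine antitone_of_deriv_nonpos (fun x => (hd x).differentiableAt) fun x => ?_
    rw [(hd x).deriv]
    have e1 : 2 * D x * D' x ≤ D x ^ 2 + D' x ^ 2 := two_mul_le_add_sq _ _
    have e2 : 2 * D' x * D'' x ≤ K * (D x ^ 2 + D' x ^ 2) := by
      calc 2 * D' x * D'' x ≤ 2 * (|D' x| * |D'' x|) := by
            rw [← abs_mul]; linarith [le_abs_self (D' x * D'' x)]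
        _ ≤ 2 * (|D' x| * (K * |D x|)) := by gcongr; exact hD x
        _ = K * (2 * |D x| * |D' x|) := by ring
        _ ≤ K * (|D x| ^ 2 + |D' x| ^ 2) := by gcongr; exact two_mul_le_add_sq _ _
        _ = _ := by simp
    have e3 := Real.exp_pos (-((1 + K) * x))
    have e4 : (2 * D x * D' x + 2 * D' x * D'' x) - (1 + K) * (D x ^ 2 + D' x ^ 2) ≤ 0 := by
      linarith
    have := mul_nonpos_of_nonpos_of_nonneg e4 e3.le
    linarith
  have h1 := hanti hx
  simp only [hE, h0, h0'] at h1
  have h2 : (D x ^ 2 + D' x ^ 2) * Real.exp (-((1 + K) * x)) ≤ 0 := by simpa using h1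
  have h3 : D x ^ 2 + D' x ^ 2 ≤ 0 := by
    by_contra hne
    exact absurd h2 (not_le.2 (mul_pos (not_le.1 hne) (Real.exp_pos _)))
  have h4 : D x ^ 2 ≤ 0 := by linarith [sq_nonneg (D' x)]
  exact pow_eq_zero_iff two_ne_zero |>.1 (le_antisymm h4 (sq_nonneg _))

namespace IsSolitaryWave

variable {f : ℝ → ℝ} {c : ℝ} {q : ℝ → ℝ}

theorem hasDerivAt (h : IsSolitaryWave f c q) (x : ℝ) : HasDerivAt q (deriv q x) x :=
  (h.contDiff.differentiable two_ne_zero x).hasDerivAt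

theorem hasDerivAt_deriv (h : IsSolitaryWave f c q) (x : ℝ) :
    HasDerivAt (deriv q) (c * q x - f (q x)) x := by
  have h1 : ContDiff ℝ 1 (deriv q) :=
    ((contDiff_succ_iff_deriv (n := 1)).1 (by exact_mod_cast h.contDiff)).2.2
  have h2 := (h1.differentiable one_ne_zero x).hasDerivAt
  have h3 := h.equation x
  simp only [iteratedDeriv_succ, iteratedDeriv_zero] at h3
  have : deriv (deriv q) x = c * q x - f (q x) := by linarith
  rwa [this] at h2

theorem continuous (h : IsSolitaryWave f c q) : Continuous q := h.contDiff.continuous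

theorem continuous_deriv (h : IsSolitaryWave f c q) : Continuous (deriv q) :=
  h.contDiff.continuous_deriv (by norm_num)

theorem deriv_neg (h : IsSolitaryWave f c q) (x : ℝ) : deriv q (-x) = -deriv q x := by
  have h1 : HasDerivAt (fun y => q (-y)) (-deriv q (-x)) x := by
    simpa [Function.comp_def] using (h.hasDerivAt (-x)).scomp x (hasDerivAt_neg x)
  have h2 : (fun y => q (-y)) = q := funext h.even
  rw [h2] at h1
  have := h1.deriv
  linarith

theorem deriv_zero (h : IsSolitaryWave f c q) : deriv q 0 = 0 := by
  have := h.deriv_neg 0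
  rw [neg_zero] at this
  linarith

theorem exists_bound (h : IsSolitaryWave f c q) : ∃ M, ∀ x, q x ∈ Icc 0 M := by
  have h1 := h.tendsto_zero.eventually (gt_mem_nhds one_pos)
  obtain ⟨s, hs, hs'⟩ := mem_cocompact.1 h1
  obtain ⟨M, hM⟩ := hs.bddAbove_image h.continuous.continuousOn
  refine ⟨max M 1, fun x => ⟨(h.pos x).le, ?_⟩⟩
  by_cases hx : x ∈ s
  · exact (hM ⟨x, hx, rfl⟩).trans (le_max_left _ _)
  · exact (le_of_lt (hs' hx)).trans (le_max_right _ _)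

/-- Two solutions of the profile equation with bounded ranges that have the same data at a point
agree to the right of it. -/
theorem eq_of_eq_data (hf : IsNonlinearity f) {u u' v v' : ℝ → ℝ} {M : ℝ}
    (hu : ∀ x, HasDerivAt u (u' x) x) (hu' : ∀ x, HasDerivAt u' (c * u x - f (u x)) x)
    (hv : ∀ x, HasDerivAt v (v' x) x) (hv' : ∀ x, HasDerivAt v' (c * v x - f (v x)) x)
    (huM : ∀ x, u x ∈ Icc 0 M) (hvM : ∀ x, v x ∈ Icc 0 M) (h0 : u 0 = v 0) (h0' : u' 0 = v' 0)
    {x : ℝ} (hx : 0 ≤ x) : u x = v x := by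
  obtain ⟨K, hK⟩ := (hf.contDiff_three.contDiffOn (s := Icc 0 M)).exists_lipschitzOnWith
    (by norm_num) (convex_Icc _ _) isCompact_Icc
  have := eq_zero_of_abs_deriv_two_le (D := fun x => u x - v x) (D' := fun x => u' x - v' x)
    (D'' := fun x => (c * u x - f (u x)) - (c * v x - f (v x))) (K := |c| + K) (by positivity)
    (fun x => (hu x).sub (hv x)) (fun x => (hu' x).sub (hv' x)) (fun x => by
      have h1 := hK.dist_le_mul _ (huM x) _ (hvM x)
      simp only [Real.dist_eq] at h1
      calc |(c * u x - f (u x)) - (c * v x - f (v x))|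
          = |c * (u x - v x) - (f (u x) - f (v x))| := by ring_nf
        _ ≤ |c * (u x - v x)| + |f (u x) - f (v x)| := abs_sub _ _
        _ ≤ |c| * |u x - v x| + K * |u x - v x| := by rw [abs_mul]; linarith
        _ = _ := by ring) (by simp [h0]) (by simp [h0']) hx
  exact sub_eq_zero.1 this

theorem tendsto_atTop (h : IsSolitaryWave f c q) : Tendsto q atTop (𝓝 0) :=
  h.tendsto_zero.mono_left atTop_le_cocompact

/-- A further critical point would be a centre of symmetry and make the profile periodic. -/
theorem deriv_ne_zero (hf : IsNonlinearity f) (h : IsSolitaryWave f c q) {x₀ : ℝ} (hx₀ : 0 < x₀) :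
    deriv q x₀ ≠ 0 := by
  intro hcrit
  obtain ⟨M, hM⟩ := h.exists_bound
  have hsymm : ∀ y, 0 ≤ y → q (x₀ + y) = q (x₀ - y) := fun y hy =>
    eq_of_eq_data hf (u := fun y => q (x₀ + y)) (u' := fun y => deriv q (x₀ + y))
      (v := fun y => q (x₀ - y)) (v' := fun y => -deriv q (x₀ - y))
      (fun x => (h.hasDerivAt (x₀ + x)).comp_const_add x₀ x)
      (fun x => (h.hasDerivAt_deriv (x₀ + x)).comp_const_add x₀ x)
      (fun x => (h.hasDerivAt (x₀ - x)).comp_const_sub x₀ x)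
      (fun x => by simpa using ((h.hasDerivAt_deriv (x₀ - x)).comp_const_sub x₀ x).fun_neg)
      (fun x => hM _) (fun x => hM _) (by simp) (by simp [hcrit]) hy
  have hper : ∀ n : ℕ, q (2 * x₀ * n) = q 0 := by
    intro n
    induction n with
    | zero => simp
    | succ n ih =>
      have h1 := hsymm (x₀ + 2 * x₀ * n) (by positivity)
      have e1 : x₀ + (x₀ + 2 * x₀ * n) = 2 * x₀ * (n + 1 : ℕ) := by push_cast; ring
      have e2 : x₀ - (x₀ + 2 * x₀ * n) = -(2 * x₀ * n) := by ring
      rw [e1, e2, h.even, ih] at h1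
      exact h1
  have h1 : Tendsto (fun n : ℕ => q (2 * x₀ * n)) atTop (𝓝 0) :=
    h.tendsto_atTop.comp (tendsto_natCast_atTop_atTop.const_mul_atTop (by positivity))
  simp only [hper] at h1
  exact (h.pos 0).ne' (tendsto_nhds_unique tendsto_const_nhds h1)

theorem deriv_neg_of_pos (hf : IsNonlinearity f) (h : IsSolitaryWave f c q) {x : ℝ} (hx : 0 < x) :
    deriv q x < 0 := by
  by_contra hcon
  have hpos : 0 < deriv q x := lt_of_le_of_ne (not_lt.1 hcon) (h.deriv_ne_zero hf hx).symm
  have hall : ∀ y, x ≤ y → 0 < deriv q y := by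
    intro y hy
    by_contra hy'
    obtain ⟨t, ht, ht0⟩ := intermediate_value_Icc' hy h.continuous_deriv.continuousOn
      (show (0 : ℝ) ∈ Icc (deriv q y) (deriv q x) from ⟨not_lt.1 hy', hpos.le⟩)
    exact h.deriv_ne_zero hf (hx.trans_le ht.1) ht0
  have hmono : MonotoneOn q (Ici x) := monotoneOn_of_deriv_nonneg (convex_Ici x)
    h.continuous.continuousOn (fun y _ => (h.hasDerivAt y).differentiableAt.differentiableWithinAt)
    fun y hy => (hall y (interior_subset hy)).le
  have h1 : q x ≤ 0 := ge_of_tendsto h.tendsto_atTop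
    (eventually_ge_atTop x |>.mono fun y hy => hmono self_mem_Ici hy hy)
  exact absurd (h.pos x) (not_lt.2 h1)

theorem antitoneOn (hf : IsNonlinearity f) (h : IsSolitaryWave f c q) : AntitoneOn q (Ici 0) :=
  antitoneOn_of_deriv_nonpos (convex_Ici 0) h.continuous.continuousOn
    (fun y _ => (h.hasDerivAt y).differentiableAt.differentiableWithinAt) fun y hy => by
      rw [interior_Ici] at hy
      exact (h.deriv_neg_of_pos hf hy).le

/-- The curvature at the crest is nonzero, since the profile is not constant. -/
theorem second_deriv_zero_neg (hf : IsNonlinearity f) (h : IsSolitaryWave f c q) :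
    c * q 0 - f (q 0) < 0 := by
  rcases lt_trichotomy (c * q 0 - f (q 0)) 0 with h0 | h0 | h0
  · exact h0
  · exfalso
    obtain ⟨M, hM⟩ := h.exists_bound
    have hc : ∀ y, 0 ≤ y → q y = q 0 := fun y hy =>
      eq_of_eq_data hf (u := q) (u' := deriv q) (v := fun _ => q 0) (v' := fun _ => 0)
        h.hasDerivAt h.hasDerivAt_deriv (fun x => hasDerivAt_const x _)
        (fun x => by rw [h0]; exact hasDerivAt_const x _) hM (fun x => hM 0) rfl h.deriv_zero hy
    have h1 : Tendsto q atTop (𝓝 (q 0)) :=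
      tendsto_const_nhds.congr' (eventually_ge_atTop 0 |>.mono fun y hy => (hc y hy).symm)
    exact (h.pos 0).ne' (tendsto_nhds_unique h1 h.tendsto_atTop)
  · exfalso
    have h1 := (h.hasDerivAt_deriv 0).tendsto_slope_zero_right
    have h2 := h1.eventually (lt_mem_nhds h0)
    obtain ⟨t, ht, ht0⟩ := (h2.and self_mem_nhdsWithin).exists
    rw [zero_add, h.deriv_zero, sub_zero, smul_eq_mul] at ht
    have h3 := h.deriv_neg_of_pos hf ht0
    have h4 : t⁻¹ * deriv q t < 0 := mul_neg_of_pos_of_neg (inv_pos.2 ht0) h3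
    linarith

end IsSolitaryWave

/-! ### Decay of solutions of linear equations at infinity -/

/-- A one-sided maximum principle on a half-line: a function that is concave where it is negative,
starts nonnegative and does not tend to `-∞` is nonnegative. -/
theorem nonneg_of_concave_of_neg {u u' u'' : ℝ → ℝ} {X : ℝ}
    (hu : ∀ x, HasDerivAt u (u' x) x) (hu' : ∀ x, HasDerivAt u' (u'' x) x)
    (h : ∀ x, X ≤ x → u x < 0 → u'' x ≤ 0) (h0 : 0 ≤ u X) (hlim : ¬Tendsto u atTop atBot)
    {x : ℝ} (hx : X ≤ x) : 0 ≤ u x := by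
  by_contra hneg
  rw [not_le] at hneg
  have hcont : Continuous u := continuous_iff_continuousAt.2 fun x => (hu x).continuousAt
  have hcont' : Continuous u' := continuous_iff_continuousAt.2 fun x => (hu' x).continuousAt
  -- the last zero before `x`
  set S := Icc X x ∩ u ⁻¹' Ici 0 with hS
  have hSc : IsCompact S := isCompact_Icc.inter_right (isClosed_Ici.preimage hcont)
  obtain ⟨a, haS, ha⟩ := hSc.exists_isGreatest ⟨X, ⟨le_rfl, hx⟩, h0⟩
  have hax : a < x := lt_of_le_of_ne haS.1.2 fun e => by
    have := haS.2
    rw [e] at this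
    exact absurd hneg (not_lt.2 this)
  have hneg' : ∀ t, a < t → t ≤ x → u t < 0 := by
    intro t h1 h2
    by_contra h3
    exact absurd (ha ⟨⟨haS.1.1.trans h1.le, h2⟩, not_lt.1 h3⟩) (not_le.2 h1)
  obtain ⟨y, hy, hyd⟩ := exists_hasDerivAt_eq_slope u u' hax hcont.continuousOn fun t _ => hu t
  have hy' : u' y < 0 := by
    rw [hyd]
    have : 0 ≤ u a := haS.2
    exact div_neg_of_neg_of_pos (by linarith) (by linarith)
  have hyneg : u y < 0 := hneg' y hy.1 hy.2.le
  have hXy : X ≤ y := haS.1.1.trans hy.1.le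
  -- as long as `u` is negative to the right of `y`, it stays below its tangent at `y`
  have htan : ∀ t, y ≤ t → (∀ s ∈ Ioo y t, u s < 0) → u t ≤ u y + u' y * (t - y) := by
    intro t hyt hst
    have hanti : AntitoneOn u' (Icc y t) := antitoneOn_of_deriv_nonpos (convex_Icc _ _)
      hcont'.continuousOn (fun s _ => (hu' s).differentiableAt.differentiableWithinAt)
      fun s hs => by
        rw [interior_Icc] at hs
        rw [(hu' s).deriv]
        exact h s (hXy.trans hs.1.le) (hst s hs)
    rcases hyt.eq_or_lt with rfl | hlt
    · simp
    · obtain ⟨s, hs, hsd⟩ :=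
        exists_hasDerivAt_eq_slope u u' hlt hcont.continuousOn fun t _ => hu t
      have h1 := hanti ⟨le_rfl, hyt⟩ ⟨hs.1.le, hs.2.le⟩ hs.1.le
      rw [hsd, div_le_iff₀ (by linarith)] at h1
      linarith
  have hall : ∀ t, y ≤ t → u t < 0 := by
    intro t hyt
    by_contra ht
    set T := Icc y t ∩ u ⁻¹' Ici 0 with hT
    have hTc : IsCompact T := isCompact_Icc.inter_right (isClosed_Ici.preimage hcont)
    obtain ⟨b, hbT, hb⟩ := hTc.exists_isLeast ⟨t, ⟨hyt, le_rfl⟩, not_lt.1 ht⟩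
    have h1 := htan b hbT.1.1 fun s hs => by
      by_contra h3
      exact absurd (hb ⟨⟨hs.1.le, hs.2.le.trans hbT.1.2⟩, not_lt.1 h3⟩) (not_le.2 hs.2)
    have h2 : 0 ≤ u b := hbT.2
    have h3 : u' y * (b - y) ≤ 0 :=
      mul_nonpos_of_nonpos_of_nonneg hy'.le (by linarith [hbT.1.1])
    linarith
  refine hlim (tendsto_atBot_mono' atTop (eventually_ge_atTop y |>.mono fun t ht =>
    htan t ht fun s hs => hall s hs.1.le) ?_)
  refine tendsto_atBot_add_const_left _ _ ?_
  exact Tendsto.const_mul_atTop_of_neg hy' (tendsto_atTop_add_const_right _ _ tendsto_id)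

/-- Exponential decay of a function and of its second derivative passes to the first derivative. -/
theorem abs_deriv_le_of_exp_decay {u u' u'' : ℝ → ℝ} {A ν : ℝ} (hν : 0 ≤ ν)
    (hu : ∀ x, HasDerivAt u (u' x) x) (hu' : ∀ x, HasDerivAt u' (u'' x) x)
    (h : ∀ x, 0 ≤ x → |u x| ≤ A * Real.exp (-(ν * x)))
    (h'' : ∀ x, 0 ≤ x → |u'' x| ≤ A * Real.exp (-(ν * x))) {x : ℝ} (hx : 0 ≤ x) :
    |u' x| ≤ 3 * A * Real.exp (-(ν * x)) := by
  have hcont : Continuous u := continuous_iff_continuousAt.2 fun x => (hu x).continuousAt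
  have hcont' : Continuous u' := continuous_iff_continuousAt.2 fun x => (hu' x).continuousAt
  have hA : 0 ≤ A := by
    have := (abs_nonneg _).trans (h 0 le_rfl)
    simpa using this
  have hexp : ∀ y, x ≤ y → A * Real.exp (-(ν * y)) ≤ A * Real.exp (-(ν * x)) := by
    intro y hy
    gcongr
  obtain ⟨y, hy, hyd⟩ := exists_hasDerivAt_eq_slope u u' (show x < x + 1 by linarith)
    hcont.continuousOn fun t _ => hu t
  rw [add_sub_cancel_left, div_one] at hyd
  obtain ⟨s, hs, hsd⟩ := exists_hasDerivAt_eq_slope u' u'' hy.1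
    hcont'.continuousOn fun t _ => hu' t
  have hyx : 0 < y - x := by linarith [hy.1]
  have h1 : u' x = u (x + 1) - u x - u'' s * (y - x) := by
    rw [hsd, div_mul_cancel₀ _ hyx.ne', hyd]
    ring
  have h2 := (h (x + 1) (by linarith)).trans (hexp (x + 1) (by linarith))
  have h3 := h x hx
  have h4 : |u'' s * (y - x)| ≤ A * Real.exp (-(ν * x)) := by
    rw [abs_mul, abs_of_pos hyx]
    calc |u'' s| * (y - x) ≤ |u'' s| * 1 := by gcongr; linarith [hy.2]
      _ ≤ _ := by
        rw [mul_one]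
        exact (h'' s (by linarith [hs.1])).trans (hexp s hs.1.le)
  rw [h1]
  calc |u (x + 1) - u x - u'' s * (y - x)|
      ≤ |u (x + 1) - u x| + |u'' s * (y - x)| := abs_sub _ _
    _ ≤ |u (x + 1)| + |u x| + |u'' s * (y - x)| := by gcongr; exact abs_sub _ _
    _ ≤ _ := by linarith

/-! ### Dependence of the solitary wave on the speed -/

/-- The derivative `∂_c Q_c` of the centred wave with respect to the speed. -/
def speedDeriv (Q : ℝ → ℝ → ℝ) (c : ℝ) : ℝ → ℝ := fun x => deriv (fun c' => Q c' x) c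

/-- The right-hand side of the linearized profile equation `∂ₓ² ∂_c Q_c = (c - f'(Q_c)) ∂_c Q_c + Q_c`
for `∂_c Q_c`. -/
def speedDerivTwo (f : ℝ → ℝ) (Q : ℝ → ℝ → ℝ) (c : ℝ) : ℝ → ℝ := fun x =>
  (c - deriv f (Q c x)) * speedDeriv Q c x + Q c x

/-- The derivative `∂ₓ ∂_c Q_c`, which vanishes at the origin. -/
def speedDerivOne (f : ℝ → ℝ) (Q : ℝ → ℝ → ℝ) (c : ℝ) : ℝ → ℝ := fun x =>
  ∫ y in (0 : ℝ)..x, speedDerivTwo f Q c y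

/-- Differentiation under the integral sign over a bounded interval. -/
theorem hasDerivAt_intervalIntegral_of_continuousOn {F F' : ℝ → ℝ → ℝ} {U : Set ℝ} (hU : IsOpen U)
    (hF : ∀ c ∈ U, ∀ y, HasDerivAt (fun c' => F c' y) (F' c y) c)
    (hFc : ∀ c ∈ U, Continuous (F c))
    (hF' : ContinuousOn (fun p : ℝ × ℝ => F' p.1 p.2) (U ×ˢ univ)) {c : ℝ} (hc : c ∈ U) (a b : ℝ) :
    HasDerivAt (fun c' => ∫ y in a..b, F c' y) (∫ y in a..b, F' c y) c := by
  obtain ⟨r, hr, hrU⟩ := Metric.isOpen_iff.1 hU c hc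
  have hsub : Metric.closedBall c (r / 2) ⊆ U :=
    (Metric.closedBall_subset_ball (by linarith)).trans hrU
  have hcomp : IsCompact (Metric.closedBall c (r / 2) ×ˢ uIcc a b) :=
    (isCompact_closedBall c (r / 2)).prod isCompact_uIcc
  obtain ⟨M, hM⟩ := hcomp.exists_bound_of_continuousOn
    (hF'.mono (prod_mono hsub (subset_univ _)))
  have hF'c : Continuous (F' c) := by
    rw [← continuousOn_univ]
    exact hF'.comp (f := fun y : ℝ => (c, y)) (by fun_prop) fun y _ => ⟨hc, mem_univ _⟩
  refine (intervalIntegral.hasDerivAt_integral_of_dominated_loc_of_deriv_le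
    (s := Metric.closedBall c (r / 2)) (bound := fun _ => M) (F' := F')
    (Metric.closedBall_mem_nhds c (by linarith)) ?_ ((hFc c hc).intervalIntegrable _ _)
    hF'c.aestronglyMeasurable ?_ intervalIntegrable_const ?_).2
  · filter_upwards [hU.mem_nhds hc] with c' hc'
    exact (hFc c' hc').aestronglyMeasurable
  · exact ae_of_all _ fun y hy c' hc' => hM (c', y) ⟨hc', uIoc_subset_uIcc hy⟩
  · exact ae_of_all _ fun y _ c' hc' => hF c' (hsub hc') y

section Family

variable {f : ℝ → ℝ} {I₀ : Set ℝ} {Q : ℝ → ℝ → ℝ}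

theorem IsSolitaryWaveFamily.isOpen_prod (hQ : IsSolitaryWaveFamily f I₀ Q) :
    IsOpen (I₀ ×ˢ (univ : Set ℝ)) := hQ.isOpen.prod isOpen_univ

theorem IsSolitaryWaveFamily.hasFDerivAt (hQ : IsSolitaryWaveFamily f I₀ Q) {c : ℝ} (hc : c ∈ I₀)
    (x : ℝ) : HasFDerivAt (fun p : ℝ × ℝ => Q p.1 p.2)
      (fderiv ℝ (fun p : ℝ × ℝ => Q p.1 p.2) (c, x)) (c, x) :=
  ((hQ.contDiffOn.contDiffAt (hQ.isOpen_prod.mem_nhds ⟨hc, mem_univ x⟩)).differentiableAt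
    two_ne_zero).hasFDerivAt

theorem IsSolitaryWaveFamily.continuousOn (hQ : IsSolitaryWaveFamily f I₀ Q) :
    ContinuousOn (fun p : ℝ × ℝ => Q p.1 p.2) (I₀ ×ˢ univ) := hQ.contDiffOn.continuousOn

theorem IsSolitaryWaveFamily.continuousOn_fderiv (hQ : IsSolitaryWaveFamily f I₀ Q) :
    ContinuousOn (fderiv ℝ (fun p : ℝ × ℝ => Q p.1 p.2)) (I₀ ×ˢ univ) :=
  hQ.contDiffOn.continuousOn_fderiv_of_isOpen hQ.isOpen_prod (by norm_num)

theorem IsSolitaryWaveFamily.hasDerivAt_speed_fderiv (hQ : IsSolitaryWaveFamily f I₀ Q) {c : ℝ}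
    (hc : c ∈ I₀) (x : ℝ) : HasDerivAt (fun c' => Q c' x)
      (fderiv ℝ (fun p : ℝ × ℝ => Q p.1 p.2) (c, x) (1, 0)) c :=
  (hQ.hasFDerivAt hc x).comp_hasDerivAt (f := fun c' : ℝ => (c', x)) c
    ((hasDerivAt_id c).prodMk (hasDerivAt_const c x))

theorem IsSolitaryWaveFamily.hasDerivAt_speed (hQ : IsSolitaryWaveFamily f I₀ Q) {c : ℝ}
    (hc : c ∈ I₀) (x : ℝ) : HasDerivAt (fun c' => Q c' x) (speedDeriv Q c x) c :=
  (hQ.hasDerivAt_speed_fderiv hc x).differentiableAt.hasDerivAt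

theorem IsSolitaryWaveFamily.continuousOn_speedDeriv (hQ : IsSolitaryWaveFamily f I₀ Q) :
    ContinuousOn (fun p : ℝ × ℝ => speedDeriv Q p.1 p.2) (I₀ ×ˢ univ) :=
  (hQ.continuousOn_fderiv.clm_apply (continuousOn_const (c := ((1 : ℝ), (0 : ℝ))))).congr
    fun p hp => (hQ.hasDerivAt_speed_fderiv hp.1 p.2).deriv

theorem IsSolitaryWaveFamily.continuousOn_deriv (hQ : IsSolitaryWaveFamily f I₀ Q) :
    ContinuousOn (fun p : ℝ × ℝ => deriv (Q p.1) p.2) (I₀ ×ˢ univ) :=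
  (hQ.continuousOn_fderiv.clm_apply (continuousOn_const (c := ((0 : ℝ), (1 : ℝ))))).congr
    fun p hp => ((hQ.hasFDerivAt hp.1 p.2).comp_hasDerivAt (f := fun x : ℝ => (p.1, x)) p.2
      ((hasDerivAt_const p.2 p.1).prodMk (hasDerivAt_id p.2))).deriv

theorem continuous_slice {G : ℝ → ℝ → ℝ} {U : Set ℝ}
    (hG : ContinuousOn (fun p : ℝ × ℝ => G p.1 p.2) (U ×ˢ univ)) {c : ℝ} (hc : c ∈ U) :
    Continuous (G c) := by
  rw [← continuousOn_univ]
  exact hG.comp (f := fun y : ℝ => (c, y)) (by fun_prop) fun y _ => ⟨hc, mem_univ _⟩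

theorem continuousOn_slice {G : ℝ → ℝ → ℝ} {U : Set ℝ}
    (hG : ContinuousOn (fun p : ℝ × ℝ => G p.1 p.2) (U ×ˢ univ)) (x : ℝ) :
    ContinuousOn (fun c => G c x) U :=
  hG.comp (f := fun c : ℝ => (c, x)) (by fun_prop) fun y hy => ⟨hy, mem_univ _⟩

theorem IsSolitaryWaveFamily.continuousOn_speedDerivTwo (hf : IsNonlinearity f)
    (hQ : IsSolitaryWaveFamily f I₀ Q) :
    ContinuousOn (fun p : ℝ × ℝ => speedDerivTwo f Q p.1 p.2) (I₀ ×ˢ univ) :=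
  ((continuousOn_fst.sub (hf.continuous_deriv.comp_continuousOn hQ.continuousOn)).mul
    hQ.continuousOn_speedDeriv).add hQ.continuousOn

theorem IsSolitaryWaveFamily.speedDeriv_neg (hQ : IsSolitaryWaveFamily f I₀ Q) {c : ℝ}
    (hc : c ∈ I₀) (x : ℝ) : speedDeriv Q c (-x) = speedDeriv Q c x := by
  have h1 : (fun c' => Q c' (-x)) =ᶠ[𝓝 c] fun c' => Q c' x := by
    filter_upwards [hQ.isOpen.mem_nhds hc] with c' hc' using (hQ.isSolitaryWave c' hc').even x
  exact h1.deriv_eq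

theorem IsSolitaryWaveFamily.hasDerivAt_speedDerivOne (hf : IsNonlinearity f)
    (hQ : IsSolitaryWaveFamily f I₀ Q) {c : ℝ} (hc : c ∈ I₀) (x : ℝ) :
    HasDerivAt (speedDerivOne f Q c) (speedDerivTwo f Q c x) x := by
  have hcont := continuous_slice (hQ.continuousOn_speedDerivTwo hf) hc
  exact intervalIntegral.integral_hasDerivAt_right (hcont.intervalIntegrable _ _)
    (hcont.stronglyMeasurableAtFilter _ _) hcont.continuousAt

/-- The profile equation in integrated form is differentiated with respect to the speed, since
third derivatives of `Q` are not available. -/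
theorem IsSolitaryWaveFamily.hasDerivAt_speedDeriv (hf : IsNonlinearity f)
    (hQ : IsSolitaryWaveFamily f I₀ Q) {c : ℝ} (hc : c ∈ I₀) (x : ℝ) :
    HasDerivAt (speedDeriv Q c) (speedDerivOne f Q c x) x := by
  have hcont := continuous_slice (hQ.continuousOn_speedDerivTwo hf) hc
  have hrep : ∀ c ∈ I₀, ∀ x, Q c x = Q c 0 + ∫ y in (0 : ℝ)..x, (x - y) * (c * Q c y - f (Q c y)) := by
    intro c hc x
    have hw := hQ.isSolitaryWave c hc
    have hcq : Continuous fun y => (x - y) * (c * Q c y - f (Q c y)) := by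
      have := hw.continuous
      have := hf.continuous
      fun_prop
    rw [intervalIntegral.integral_eq_sub_of_hasDerivAt
      (f := fun y => (x - y) * deriv (Q c) y + Q c y) (fun y _ => ?_)
      (hcq.intervalIntegrable _ _)]
    · simp [hw.deriv_zero]
    · have h1 := (((hasDerivAt_id y).const_sub x).fun_mul (hw.hasDerivAt_deriv y)).fun_add
        (hw.hasDerivAt y)
      refine h1.congr_deriv ?_
      simp
  have hrep' : ∀ x, speedDeriv Q c x = speedDeriv Q c 0 +
      ∫ y in (0 : ℝ)..x, (x - y) * speedDerivTwo f Q c y := by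
    intro x
    have h1 : HasDerivAt (fun c' => ∫ y in (0 : ℝ)..x, (x - y) * (c' * Q c' y - f (Q c' y)))
        (∫ y in (0 : ℝ)..x, (x - y) * speedDerivTwo f Q c y) c := by
      refine hasDerivAt_intervalIntegral_of_continuousOn
        (F' := fun c' y => (x - y) * speedDerivTwo f Q c' y) hQ.isOpen ?_ ?_ ?_ hc 0 x
      · intro c' hc' y
        have h2 := hQ.hasDerivAt_speed hc' y
        have h3 := (((hasDerivAt_id c').fun_mul h2).fun_sub
          ((hf.hasDerivAt (Q c' y)).comp c' h2)).const_mul (x - y)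
        refine h3.congr_deriv ?_
        simp only [speedDerivTwo, id]
        ring
      · intro c' hc'
        have := (hQ.isSolitaryWave c' hc').continuous
        have := hf.continuous
        fun_prop
      · exact ContinuousOn.mul (by fun_prop) (hQ.continuousOn_speedDerivTwo hf)
    have h4 : HasDerivAt (fun c' => Q c' x) (speedDeriv Q c 0 +
        ∫ y in (0 : ℝ)..x, (x - y) * speedDerivTwo f Q c y) c := by
      refine ((hQ.hasDerivAt_speed hc 0).fun_add h1).congr_of_eventuallyEq ?_
      filter_upwards [hQ.isOpen.mem_nhds hc] with c' hc' using hrep c' hc' x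
    exact h4.deriv
  have hrep'' : speedDeriv Q c = fun x => speedDeriv Q c 0 +
      (x * speedDerivOne f Q c x - ∫ y in (0 : ℝ)..x, y * speedDerivTwo f Q c y) := by
    ext x
    have e1 : Continuous fun y => x * speedDerivTwo f Q c y := continuous_const.mul hcont
    have e2 : Continuous fun y => y * speedDerivTwo f Q c y := continuous_id.mul hcont
    rw [hrep' x, speedDerivOne, ← intervalIntegral.integral_const_mul,
      ← intervalIntegral.integral_sub (e1.intervalIntegrable _ _) (e2.intervalIntegrable _ _)]
    simp only [sub_mul]
  rw [hrep'']
  have h5 : HasDerivAt (fun x => ∫ y in (0 : ℝ)..x, y * speedDerivTwo f Q c y)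
      (x * speedDerivTwo f Q c x) x := by
    have hc2 : Continuous fun y => y * speedDerivTwo f Q c y := continuous_id.mul hcont
    exact intervalIntegral.integral_hasDerivAt_right (hc2.intervalIntegrable _ _)
      (hc2.stronglyMeasurableAtFilter _ _) hc2.continuousAt
  have h6 := (((hasDerivAt_id x).fun_mul (hQ.hasDerivAt_speedDerivOne hf hc x)).fun_sub h5).const_add
    (speedDeriv Q c 0)
  refine h6.congr_deriv ?_
  simp

theorem IsSolitaryWaveFamily.speedDerivOne_neg (hQ : IsSolitaryWaveFamily f I₀ Q) {c : ℝ}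
    (hc : c ∈ I₀) (x : ℝ) : speedDerivOne f Q c (-x) = -speedDerivOne f Q c x := by
  have h1 : ∀ y, speedDerivTwo f Q c (-y) = speedDerivTwo f Q c y := fun y => by
    simp only [speedDerivTwo, hQ.speedDeriv_neg hc, (hQ.isSolitaryWave c hc).even]
  simp only [speedDerivOne]
  have h2 := intervalIntegral.integral_comp_neg (a := 0) (b := x) (speedDerivTwo f Q c)
  simp only [h1, neg_zero] at h2
  rw [h2, intervalIntegral.integral_symm]

/-- Uniform bounds for the waves of speeds in `J`: exponential decay at the rate `ν`, with the
constant `A`, and a positive potential outside `[-X, X]`. -/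
structure UniformBounds (f : ℝ → ℝ) (Q : ℝ → ℝ → ℝ) (J : Set ℝ) (ν A X : ℝ) : Prop where
  ν_pos : 0 < ν
  X_pos : 0 < X
  wave : ∀ c ∈ J, ∀ x, |Q c x| ≤ A * Real.exp (-(ν * |x|))
  wave_deriv : ∀ c ∈ J, ∀ x, |deriv (Q c) x| ≤ A * Real.exp (-(ν * |x|))
  wave_deriv_two : ∀ c ∈ J, ∀ x, |c * Q c x - f (Q c x)| ≤ A * Real.exp (-(ν * |x|))
  speed : ∀ c ∈ J, ∀ x, |speedDeriv Q c x| ≤ A * Real.exp (-(ν * |x|))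
  speed_deriv : ∀ c ∈ J, ∀ x, |speedDerivOne f Q c x| ≤ A * Real.exp (-(ν * |x|))
  potential_ge : ∀ c ∈ J, ∀ x, X ≤ |x| → ν ^ 2 ≤ c - deriv f (Q c x)
  potential_le : ∀ c ∈ J, ∀ x, |c - deriv f (Q c x)| ≤ A

/-- Waves of speeds in a compact set vanish uniformly at infinity, because they are monotone on
the half-line. -/
theorem IsSolitaryWaveFamily.exists_uniform_tail (hf : IsNonlinearity f)
    (hQ : IsSolitaryWaveFamily f I₀ Q) {J : Set ℝ} (hJ : IsCompact J) (hJI : J ⊆ I₀) {ε : ℝ}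
    (hε : 0 < ε) : ∃ X, 0 < X ∧ ∀ c ∈ J, ∀ x, X ≤ x → Q c x ≤ ε := by
  refine hJ.induction_on (p := fun s => ∃ X, 0 < X ∧ ∀ c ∈ s, ∀ x, X ≤ x → Q c x ≤ ε)
    ⟨1, one_pos, by simp⟩ ?_ ?_ ?_
  · rintro s t hst ⟨X, hX, h⟩
    exact ⟨X, hX, fun c hc => h c (hst hc)⟩
  · rintro s t ⟨X, hX, h⟩ ⟨Y, hY, h'⟩
    refine ⟨max X Y, lt_max_of_lt_left hX, fun c hc x hx => ?_⟩
    rcases hc with hc | hc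
    · exact h c hc x ((le_max_left _ _).trans hx)
    · exact h' c hc x ((le_max_right _ _).trans hx)
  · intro c hc
    have hw := hQ.isSolitaryWave c (hJI hc)
    obtain ⟨X, hXε, hX⟩ := ((hw.tendsto_atTop.eventually (gt_mem_nhds hε)).and
      (eventually_gt_atTop 0)).exists
    have h1 : ContinuousAt (fun c' => Q c' X) c :=
      (continuousOn_slice hQ.continuousOn X).continuousAt (hQ.isOpen.mem_nhds (hJI hc))
    have h2 : {c' | Q c' X < ε ∧ c' ∈ I₀} ∈ 𝓝 c :=
      (h1.eventually (gt_mem_nhds hXε)).and (hQ.isOpen.mem_nhds (hJI hc))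
    refine ⟨_, mem_nhdsWithin_of_mem_nhds h2, X, hX, fun c' hc' x hx => ?_⟩
    exact (((hQ.isSolitaryWave c' hc'.2).antitoneOn hf) (mem_Ici.2 hX.le)
      (mem_Ici.2 (hX.le.trans hx)) hx).trans hc'.1.le

theorem hasDerivAt_exp_decay (A ν X x : ℝ) :
    HasDerivAt (fun x => A * Real.exp (-(ν * (x - X)))) (-ν * (A * Real.exp (-(ν * (x - X))))) x := by
  have h1 : HasDerivAt (fun x => -(ν * (x - X))) (-ν) x := by
    simpa using (((hasDerivAt_id x).sub_const X).const_mul ν).fun_neg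
  refine (h1.exp.const_mul A).congr_deriv ?_
  ring

theorem tendsto_exp_decay (A X : ℝ) {ν : ℝ} (hν : 0 < ν) :
    Tendsto (fun x => A * Real.exp (-(ν * (x - X)))) atTop (𝓝 0) := by
  have h1 : Tendsto (fun x : ℝ => -(ν * (x - X))) atTop atBot :=
    tendsto_neg_atTop_atBot.comp
      ((tendsto_atTop_add_const_right _ (-X) tendsto_id).const_mul_atTop hν)
  simpa using (Real.tendsto_exp_atBot.comp h1).const_mul A

end Family

/-! ### Exponential decay uniform in the speed -/

section Family

variable {f : ℝ → ℝ} {I₀ : Set ℝ} {Q : ℝ → ℝ → ℝ}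

/-- Where the wave is small it is a subsolution of `u'' = ν² u`, hence below an exponential. -/
theorem IsSolitaryWave.le_exp {c : ℝ} {q : ℝ → ℝ} (h : IsSolitaryWave f c q) {ν M X : ℝ}
    (hν : 0 < ν) (hM : q X ≤ M) (hX : ∀ x, X ≤ x → ν ^ 2 * q x ≤ c * q x - f (q x)) {x : ℝ}
    (hx : X ≤ x) : q x ≤ M * Real.exp (-(ν * (x - X))) := by
  have h1 := nonneg_of_concave_of_neg (X := X)
    (fun x => (hasDerivAt_exp_decay M ν X x).fun_sub (h.hasDerivAt x))
    (fun x => ((hasDerivAt_exp_decay M ν X x).const_mul (-ν)).fun_sub (h.hasDerivAt_deriv x))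
    (fun x hx hneg => by
      have h2 := hX x hx
      have h3 := mul_le_mul_of_nonneg_left hneg.le (sq_nonneg ν)
      linarith) (by simpa using hM) (fun hlim => by
      have h2 := (tendsto_exp_decay M X hν).sub h.tendsto_atTop
      exact not_tendsto_nhds_of_tendsto_atBot hlim _ h2) hx
  linarith

/-- A solution of `χ'' = V χ + q` that is integrable decays exponentially wherever `V ≥ ν²`
and `q` decays exponentially; the barrier has half the rate. -/
theorem abs_le_exp_of_linear {χ χ' V q : ℝ → ℝ} {ν M S X : ℝ} (hν : 0 < ν) (hM : 0 ≤ M)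
    (h : ∀ x, HasDerivAt χ (χ' x) x) (h' : ∀ x, HasDerivAt χ' (V x * χ x + q x) x)
    (hi : Integrable χ) (hV : ∀ x, X ≤ x → ν ^ 2 ≤ V x)
    (hq : ∀ x, X ≤ x → |q x| ≤ M * Real.exp (-(ν * (x - X)))) (hS : |χ X| ≤ S) {x : ℝ}
    (hx : X ≤ x) : |χ x| ≤ (S + 2 * M / ν ^ 2) * Real.exp (-(ν / 2 * (x - X))) := by
  set A := S + 2 * M / ν ^ 2 with hA
  have hS0 : 0 ≤ S := (abs_nonneg _).trans hS
  have hA0 : 0 ≤ A := by positivity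
  have hAM : M ≤ 3 / 4 * ν ^ 2 * A := by
    have : 3 / 4 * ν ^ 2 * A = 3 / 4 * ν ^ 2 * S + 3 / 2 * M := by rw [hA]; field_simp; ring
    rw [this]
    have : 0 ≤ 3 / 4 * ν ^ 2 * S := by positivity
    linarith
  have key : ∀ σ : ℝ, |σ| = 1 → ∀ x, X ≤ x →
      0 ≤ A * Real.exp (-(ν / 2 * (x - X))) - σ * χ x := by
    intro σ hσ x hx
    refine nonneg_of_concave_of_neg (X := X)
      (fun x => (hasDerivAt_exp_decay A (ν / 2) X x).fun_sub ((h x).const_mul σ))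
      (fun x => ((hasDerivAt_exp_decay A (ν / 2) X x).const_mul (-(ν / 2))).fun_sub
        ((h' x).const_mul σ)) (fun x hx hneg => ?_) ?_ (fun hlim => ?_) hx
    · set φ := A * Real.exp (-(ν / 2 * (x - X))) with hφ
      have hφ0 : 0 ≤ φ := by positivity
      have h1 : V x * φ ≤ V x * (σ * χ x) :=
        mul_le_mul_of_nonneg_left (by linarith) ((sq_nonneg ν).trans (hV x hx))
      have h2 : ν ^ 2 * φ ≤ V x * φ := mul_le_mul_of_nonneg_right (hV x hx) hφ0
      have h3 : -(σ * q x) ≤ 3 / 4 * ν ^ 2 * φ := by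
        calc -(σ * q x) ≤ |σ * q x| := neg_le_abs _
          _ = |q x| := by rw [abs_mul, hσ, one_mul]
          _ ≤ M * Real.exp (-(ν * (x - X))) := hq x hx
          _ ≤ M * Real.exp (-(ν / 2 * (x - X))) := by
              gcongr
              linarith
          _ ≤ 3 / 4 * ν ^ 2 * A * Real.exp (-(ν / 2 * (x - X))) := by gcongr
          _ = 3 / 4 * ν ^ 2 * φ := by rw [hφ]; ring
      have h4 : -(ν / 2) * (-(ν / 2) * φ) = ν ^ 2 / 4 * φ := by ring
      rw [h4]
      linarith
    · simp only [sub_self, mul_zero, neg_zero, Real.exp_zero, mul_one]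
      have h1 : σ * χ X ≤ |χ X| := by
        calc σ * χ X ≤ |σ * χ X| := le_abs_self _
          _ = |χ X| := by rw [abs_mul, hσ, one_mul]
      have h2 : S ≤ A := by
        rw [hA]
        have : 0 ≤ 2 * M / ν ^ 2 := by positivity
        linarith
      linarith
    · -- an integrable function is not eventually larger than `1`
      have h1 := (tendsto_exp_decay A X (half_pos hν)).eventually (gt_mem_nhds one_pos)
      have h2 := hlim.eventually (eventually_le_atBot (-1))
      have h3 : ∀ᶠ x in atTop, 0 ≤ A * Real.exp (-(ν / 2 * (x - X))) :=
        Eventually.of_forall fun x => by positivity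
      have h4 : ∀ᶠ x in atTop, (1 : ℝ) ≤ |χ x| := by
        filter_upwards [h2, h3] with x e2 e3
        have e4 : σ * χ x ≤ |χ x| := by
          calc σ * χ x ≤ |σ * χ x| := le_abs_self _
            _ = |χ x| := by rw [abs_mul, hσ, one_mul]
        linarith
      obtain ⟨T, hT⟩ := eventually_atTop.1 h4
      have h5 : IntegrableOn (fun _ : ℝ => (1 : ℝ)) (Ici T) := by
        refine Integrable.mono' hi.norm.integrableOn aestronglyMeasurable_const ?_
        exact (ae_restrict_iff' measurableSet_Ici).2 (ae_of_all _ fun x hx => by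
          simpa using hT x hx)
      rw [integrableOn_const_iff] at h5
      simp at h5
  have h1 := key 1 (by simp) x hx
  have h2 := key (-1) (by simp) x hx
  exact abs_le.2 ⟨by linarith, by linarith⟩

/-- A bound on `[0, X]` and exponential decay beyond `X` combine to exponential decay. -/
theorem exp_decay_glue {u : ℝ → ℝ} {S B μ X : ℝ} (hμ : 0 < μ) (hSB : S ≤ B)
    (h1 : ∀ x, 0 ≤ x → x ≤ X → |u x| ≤ S)
    (h2 : ∀ x, X ≤ x → |u x| ≤ B * Real.exp (-(μ * (x - X)))) {x : ℝ} (hx : 0 ≤ x) :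
    |u x| ≤ B * Real.exp (μ * X) * Real.exp (-(μ * x)) := by
  have e : B * Real.exp (μ * X) * Real.exp (-(μ * x)) = B * Real.exp (-(μ * (x - X))) := by
    rw [mul_assoc, ← Real.exp_add]
    congr 2
    ring
  rw [e]
  rcases le_total x X with h | h
  · have h3 := (h1 x hx h).trans hSB
    have hB : 0 ≤ B := (abs_nonneg _).trans h3
    refine h3.trans (le_mul_of_one_le_right hB (Real.one_le_exp ?_))
    have : μ * (x - X) ≤ 0 := mul_nonpos_of_nonneg_of_nonpos hμ.le (by linarith)
    linarith
  · exact h2 x h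

/-- The tails of the waves are uniformly small, so that beyond some `X` the potential exceeds half
the smallest speed; there the wave and its speed derivative decay by comparison with exponentials,
and the profile equations pass the decay on to the derivatives. -/
theorem IsSolitaryWaveFamily.exists_uniformBounds (hf : IsNonlinearity f)
    (hQ : IsSolitaryWaveFamily f I₀ Q) {J : Set ℝ} (hJ : IsCompact J) (hJI : J ⊆ I₀) :
    ∃ ν A X, UniformBounds f Q J ν A X := by
  rcases J.eq_empty_or_nonempty with rfl | hne
  · exact ⟨1, 1, 1, by constructor <;> simp⟩
  have hw : ∀ c ∈ J, IsSolitaryWave f c (Q c) := fun c hc => hQ.isSolitaryWave c (hJI hc)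
  obtain ⟨c₀, hc₀J, hc₀⟩ := hJ.exists_isMinOn hne continuousOn_id
  have hc₀pos : 0 < c₀ := hQ.speed_pos c₀ (hJI hc₀J)
  have hc₀le : ∀ c ∈ J, c₀ ≤ c := fun c hc => hc₀ hc
  obtain ⟨c₁, hc₁⟩ := hJ.exists_bound_of_continuousOn (f := fun c : ℝ => c) continuousOn_id
  simp only [Real.norm_eq_abs] at hc₁
  have hc₁0 : 0 ≤ c₁ := (abs_nonneg _).trans (hc₁ c₀ hc₀J)
  obtain ⟨M, hM⟩ := hJ.exists_bound_of_continuousOn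
    ((continuousOn_slice hQ.continuousOn 0).mono hJI)
  simp only [Real.norm_eq_abs] at hM
  have hM0 : 0 ≤ M := (abs_nonneg _).trans (hM c₀ hc₀J)
  have habs : ∀ c ∈ J, ∀ x, Q c |x| = Q c x := fun c hc x => by
    rcases abs_choice x with h | h
    · rw [h]
    · rw [h, (hw c hc).even]
  have hQM : ∀ c ∈ J, ∀ x, Q c x ∈ Icc 0 M := fun c hc x => by
    refine ⟨((hw c hc).pos x).le, ?_⟩
    rw [← habs c hc]
    exact (((hw c hc).antitoneOn hf) self_mem_Ici (mem_Ici.2 (abs_nonneg x)) (abs_nonneg x)).trans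
      ((le_abs_self _).trans (hM c hc))
  obtain ⟨F, hF⟩ := (isCompact_Icc (a := (0 : ℝ)) (b := M)).exists_bound_of_continuousOn
    hf.continuous_deriv.continuousOn
  simp only [Real.norm_eq_abs] at hF
  have hF0 : 0 ≤ F := (abs_nonneg _).trans (hF 0 ⟨le_rfl, hM0⟩)
  have hfle : ∀ (b G : ℝ), (∀ u ∈ Icc 0 b, |deriv f u| ≤ G) → ∀ u ∈ Icc 0 b, |f u| ≤ G * u := by
    intro b G hG u hu
    have h1 := (convex_Icc (0 : ℝ) b).norm_image_sub_le_of_norm_hasDerivWithin_le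
      (f := f) (f' := deriv f) (C := G) (fun x _ => (hf.hasDerivAt x).hasDerivWithinAt) hG
      (x := 0) (y := u) ⟨le_rfl, hu.1.trans hu.2⟩ hu
    simpa [hf.map_zero, abs_of_nonneg hu.1] using h1
  obtain ⟨ε, hε, hεf⟩ : ∃ ε > 0, ∀ u ∈ Icc 0 ε, |deriv f u| ≤ c₀ / 2 := by
    have h1 : Tendsto (deriv f) (𝓝 0) (𝓝 0) := by
      simpa [hf.deriv_zero] using hf.continuous_deriv.tendsto 0
    obtain ⟨r, hr, h2⟩ := Metric.tendsto_nhds_nhds.1 h1 (c₀ / 2) (by positivity)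
    refine ⟨r / 2, by positivity, fun u hu => ?_⟩
    have h3 := h2 (x := u) (by
      rw [dist_zero_right, Real.norm_eq_abs, abs_of_nonneg hu.1]
      linarith [hu.2])
    rw [dist_zero_right, Real.norm_eq_abs] at h3
    exact h3.le
  obtain ⟨X, hX, hXε⟩ := hQ.exists_uniform_tail hf hJ hJI hε
  set ν := Real.sqrt (c₀ / 2) with hν
  have hν2 : ν ^ 2 = c₀ / 2 := Real.sq_sqrt (by positivity)
  have hνpos : 0 < ν := Real.sqrt_pos.2 (by positivity)
  have hQε : ∀ c ∈ J, ∀ x, X ≤ |x| → Q c x ∈ Icc 0 ε := fun c hc x hx => by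
    rw [← habs c hc]
    exact ⟨((hw c hc).pos _).le, hXε c hc _ hx⟩
  have hpot : ∀ c ∈ J, ∀ x, X ≤ |x| → ν ^ 2 ≤ c - deriv f (Q c x) := fun c hc x hx => by
    have h1 := hεf _ (hQε c hc x hx)
    have h2 := hc₀le c hc
    have h3 := (abs_le.1 h1).2
    rw [hν2]
    linarith
  have hdec : ∀ c ∈ J, ∀ x, X ≤ x → |Q c x| ≤ M * Real.exp (-(ν * (x - X))) := by
    intro c hc x hx
    rw [abs_of_pos ((hw c hc).pos x)]
    refine (hw c hc).le_exp hνpos (hQM c hc X).2 (fun y hy => ?_) hx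
    have h1 := hQε c hc y (hy.trans (le_abs_self y))
    have h2 := (abs_le.1 (hfle ε (c₀ / 2) hεf _ h1)).2
    have h3 : c₀ * Q c y ≤ c * Q c y := mul_le_mul_of_nonneg_right (hc₀le c hc) h1.1
    rw [hν2]
    linarith
  obtain ⟨S, hS⟩ := (hJ.prod (isCompact_Icc (a := (0 : ℝ)) (b := X))).exists_bound_of_continuousOn
    (hQ.continuousOn_speedDeriv.mono (prod_mono hJI (subset_univ _)))
  simp only [Real.norm_eq_abs] at hS
  have hS0 : 0 ≤ S := (abs_nonneg _).trans (hS (c₀, X) ⟨hc₀J, hX.le, le_rfl⟩)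
  set A₁ := S + 2 * M / ν ^ 2 with hA₁
  have hA₁0 : 0 ≤ A₁ := by positivity
  have hSA : S ≤ A₁ := by
    have : 0 ≤ 2 * M / ν ^ 2 := by positivity
    linarith
  have hcder := fun c (hc : c ∈ J) => hQ.hasDerivAt_speedDeriv hf (hJI hc)
  have hcder' := fun c (hc : c ∈ J) => hQ.hasDerivAt_speedDerivOne hf (hJI hc)
  have hint : ∀ c ∈ J, Integrable (speedDeriv Q c) := fun c hc => by
    have := hQ.integrable c (hJI hc) 1 (by simp) 0 (by simp)
    simp only [pow_zero, one_mul, iteratedDeriv_one] at this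
    exact this
  have hsdec : ∀ c ∈ J, ∀ x, X ≤ x →
      |speedDeriv Q c x| ≤ A₁ * Real.exp (-(ν / 2 * (x - X))) := fun c hc x hx =>
    abs_le_exp_of_linear hνpos hM0 (hcder c hc) (hcder' c hc) (hint c hc)
      (fun y hy => hpot c hc y (hy.trans (le_abs_self y))) (hdec c hc)
      (hS (c, X) ⟨hc, hX.le, le_rfl⟩) hx
  set μ := ν / 2 with hμ
  have hμpos : 0 < μ := half_pos hνpos
  have hQ1 : ∀ c ∈ J, ∀ x, 0 ≤ x → |Q c x| ≤ M * Real.exp (μ * X) * Real.exp (-(μ * x)) :=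
    fun c hc x hx => exp_decay_glue hμpos le_rfl
      (fun y _ _ => by rw [abs_of_nonneg (hQM c hc y).1]; exact (hQM c hc y).2)
      (fun y hy => (hdec c hc y hy).trans (by
        gcongr
        linarith)) hx
  have hχ1 : ∀ c ∈ J, ∀ x, 0 ≤ x →
      |speedDeriv Q c x| ≤ A₁ * Real.exp (μ * X) * Real.exp (-(μ * x)) :=
    fun c hc x hx => exp_decay_glue hμpos hSA (fun y h1 h2 => hS (c, y) ⟨hc, h1, h2⟩)
      (hsdec c hc) hx
  set T := Real.exp (μ * X) with hT
  have hTpos : 0 < T := Real.exp_pos _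
  have hpotb : ∀ c ∈ J, ∀ x, |c - deriv f (Q c x)| ≤ c₁ + F := fun c hc x =>
    (abs_sub _ _).trans (add_le_add (hc₁ c hc) (hF _ (hQM c hc x)))
  set A₀ := (c₁ + F + 1) * (A₁ + M) * T with hA₀
  have hA₀0 : 0 ≤ A₀ := by positivity
  have hMA : M * T ≤ A₀ := by
    rw [hA₀]
    refine mul_le_mul_of_nonneg_right ?_ hTpos.le
    calc M ≤ 1 * (A₁ + M) := by linarith
      _ ≤ _ := by gcongr; linarith
  have hAA : A₁ * T ≤ A₀ := by
    rw [hA₀]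
    refine mul_le_mul_of_nonneg_right ?_ hTpos.le
    calc A₁ ≤ 1 * (A₁ + M) := by linarith
      _ ≤ _ := by gcongr; linarith
  have hQ2 : ∀ c ∈ J, ∀ x, 0 ≤ x → |Q c x| ≤ A₀ * Real.exp (-(μ * x)) := fun c hc x hx =>
    (hQ1 c hc x hx).trans (by gcongr)
  have hχ2 : ∀ c ∈ J, ∀ x, 0 ≤ x → |speedDeriv Q c x| ≤ A₀ * Real.exp (-(μ * x)) :=
    fun c hc x hx => (hχ1 c hc x hx).trans (by gcongr)
  have hQ3 : ∀ c ∈ J, ∀ x, 0 ≤ x → |c * Q c x - f (Q c x)| ≤ A₀ * Real.exp (-(μ * x)) := by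
    intro c hc x hx
    have h1 := hfle M F hF _ (hQM c hc x)
    have h0 := (hQM c hc x).1
    calc |c * Q c x - f (Q c x)| ≤ |c * Q c x| + |f (Q c x)| := abs_sub _ _
      _ ≤ c₁ * Q c x + F * Q c x := by
          rw [abs_mul, abs_of_nonneg h0]
          exact add_le_add (mul_le_mul_of_nonneg_right (hc₁ c hc) h0) h1
      _ = (c₁ + F) * |Q c x| := by rw [abs_of_nonneg h0]; ring
      _ ≤ (c₁ + F) * (M * T * Real.exp (-(μ * x))) := by gcongr; exact hQ1 c hc x hx
      _ = (c₁ + F) * M * T * Real.exp (-(μ * x)) := by ring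
      _ ≤ (c₁ + F + 1) * (A₁ + M) * T * Real.exp (-(μ * x)) := by
          have : 0 ≤ (c₁ + F) * A₁ := by positivity
          exact mul_le_mul_of_nonneg_right (mul_le_mul_of_nonneg_right (by linarith) hTpos.le)
            (Real.exp_pos _).le
  have hχ3 : ∀ c ∈ J, ∀ x, 0 ≤ x → |speedDerivTwo f Q c x| ≤ A₀ * Real.exp (-(μ * x)) := by
    intro c hc x hx
    calc |speedDerivTwo f Q c x|
        ≤ |c - deriv f (Q c x)| * |speedDeriv Q c x| + |Q c x| := by
          rw [← abs_mul]; exact abs_add_le _ _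
      _ ≤ (c₁ + F) * (A₁ * T * Real.exp (-(μ * x))) + M * T * Real.exp (-(μ * x)) := by
          gcongr
          · exact hpotb c hc x
          · exact hχ1 c hc x hx
          · exact hQ1 c hc x hx
      _ = ((c₁ + F) * A₁ + M) * T * Real.exp (-(μ * x)) := by ring
      _ ≤ (c₁ + F + 1) * (A₁ + M) * T * Real.exp (-(μ * x)) := by
          gcongr
          have : 0 ≤ (c₁ + F) * M := by positivity
          linarith
  have ext : ∀ {u : ℝ → ℝ} {B : ℝ}, (∀ x, |u (-x)| = |u x|) →
      (∀ x, 0 ≤ x → |u x| ≤ B * Real.exp (-(μ * x))) → B ≤ 3 * A₀ + (c₁ + F) →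
      ∀ x, |u x| ≤ (3 * A₀ + (c₁ + F)) * Real.exp (-(μ * |x|)) := by
    intro u B h1 h2 h3 x
    have h4 : |u (|x|)| = |u x| := by
      rcases abs_choice x with h | h
      · rw [h]
      · rw [h, h1]
    rw [← h4]
    exact (h2 _ (abs_nonneg x)).trans (by gcongr)
  refine ⟨μ, 3 * A₀ + (c₁ + F), X, hμpos, hX, fun c hc => ?_, fun c hc => ?_, fun c hc => ?_,
    fun c hc => ?_, fun c hc => ?_, fun c hc x hx => ?_, fun c hc x => ?_⟩
  · exact ext (fun x => by rw [(hw c hc).even]) (hQ2 c hc) (by linarith)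
  · exact ext (fun x => by rw [(hw c hc).deriv_neg, abs_neg]) (fun x hx =>
      abs_deriv_le_of_exp_decay hμpos.le (hw c hc).hasDerivAt (hw c hc).hasDerivAt_deriv
        (hQ2 c hc) (hQ3 c hc) hx) (by linarith)
  · exact ext (u := fun x => c * Q c x - f (Q c x)) (fun x => by rw [(hw c hc).even]) (hQ3 c hc)
      (by linarith)
  · exact ext (fun x => by rw [hQ.speedDeriv_neg (hJI hc)]) (hχ2 c hc) (by linarith)
  · exact ext (fun x => by rw [hQ.speedDerivOne_neg (hJI hc), abs_neg]) (fun x hx =>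
      abs_deriv_le_of_exp_decay hμpos.le (hcder c hc) (hcder' c hc)
        (hχ2 c hc) (hχ3 c hc) hx) (by linarith)
  · refine le_trans ?_ (hpot c hc x hx)
    rw [hμ]
    nlinarith [sq_nonneg ν]
  · exact (hpotb c hc x).trans (by linarith)

end Family

/-! ### Coercivity on an interval and on the half-line -/

/-- The Cauchy–Schwarz bound for the increment of a function over `[0, ε]`. -/
theorem HasACDeriv.sq_le_mul_integral {n n' : ℝ → ℝ} (hn : HasACDeriv n n')
    (hi : Integrable fun x => n' x ^ 2) (h0 : n 0 = 0) {ε : ℝ} (hε : 0 < ε) :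
    n ε ^ 2 ≤ ε * ∫ x in (0 : ℝ)..ε, n' x ^ 2 := by
  have h1 : ∫ x in (0 : ℝ)..ε, n' x = n ε := by rw [hn.integral_eq, h0, sub_zero]
  have i1 : IntervalIntegrable (fun x => n' x ^ 2) volume 0 ε := hi.intervalIntegrable
  have i2 := hn.intervalIntegrable 0 ε
  have h2 : 0 ≤ ∫ x in (0 : ℝ)..ε, (n' x - n ε / ε) ^ 2 :=
    intervalIntegral.integral_nonneg hε.le fun x _ => sq_nonneg _
  have h3 : ∫ x in (0 : ℝ)..ε, (n' x - n ε / ε) ^ 2 =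
      (∫ x in (0 : ℝ)..ε, n' x ^ 2) - n ε ^ 2 / ε := by
    have e : (fun x => (n' x - n ε / ε) ^ 2) =
        fun x => n' x ^ 2 - (2 * (n ε / ε) * n' x - (n ε / ε) ^ 2) := by ext x; ring
    rw [e, intervalIntegral.integral_sub i1 ((i2.const_mul _).sub intervalIntegrable_const),
      intervalIntegral.integral_sub (i2.const_mul _) intervalIntegrable_const,
      intervalIntegral.integral_const_mul, h1, intervalIntegral.integral_const, smul_eq_mul]
    field_simp
    ring
  rw [h3, sub_nonneg, div_le_iff₀ hε] at h2
  linarith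

/-- If `ψ` is a positive solution of `ψ'' = V ψ` on `(0, X]` with a simple zero at the origin, then
the form `∫ n'² + V n²` is coercive on the functions on `[0, X]` vanishing at both ends. The square
is completed with the logarithmic derivative of `ψ`, lowered by a multiple of `x³ / ψ²` to gain a
positive remainder. -/
theorem interval_coercive {ψ ψ' V n n' : ℝ → ℝ} {X k₀ k₁ A : ℝ} (hX : 0 < X) (hk₀ : 0 < k₀)
    (hk₁ : 0 < k₁) (hψ : ∀ x, HasDerivAt ψ (ψ' x) x) (hψ' : ∀ x, HasDerivAt ψ' (V x * ψ x) x)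
    (hV : Continuous V) (hlow : ∀ x ∈ Icc 0 X, k₀ * x ≤ ψ x) (hup : ∀ x ∈ Icc 0 X, ψ x ≤ k₁ * x)
    (hA : ∀ x, |ψ' x| ≤ A) (hn : HasACDeriv n n') (hi : Integrable fun x => n' x ^ 2)
    (h0 : n 0 = 0) (hnX : n X = 0) :
    0 ≤ ∫ x in (0 : ℝ)..X, (n' x ^ 2 + V x * n x ^ 2 - 2 * k₀ ^ 4 / (k₁ ^ 4 * X ^ 2) * n x ^ 2) := by
  set κ := 2 * k₀ ^ 4 / (k₁ ^ 4 * X ^ 2) with hκ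
  set θ := k₀ ^ 4 / (k₁ ^ 2 * X ^ 2) with hθ
  have hθ0 : 0 < θ := by positivity
  have hnc := hn.continuous
  have hψc : Continuous ψ := continuous_iff_continuousAt.2 fun x => (hψ x).continuousAt
  have hψ'c : Continuous ψ' := continuous_iff_continuousAt.2 fun x => (hψ' x).continuousAt
  have hpos : ∀ x, 0 < x → x ≤ X → 0 < ψ x := fun x h1 h2 =>
    lt_of_lt_of_le (by positivity) (hlow x ⟨h1.le, h2⟩)
  set J : ℝ → ℝ := fun x => n' x ^ 2 + V x * n x ^ 2 - κ * n x ^ 2 with hJ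
  have hJi : ∀ a b, IntervalIntegrable J volume a b := fun a b =>
    (hi.intervalIntegrable.add ((hV.mul (hnc.pow 2)).intervalIntegrable a b)).sub
      ((continuous_const.mul (hnc.pow 2)).intervalIntegrable a b)
  have hn'i : ∀ a b, IntervalIntegrable (fun x => n' x ^ 2) volume a b := fun a b =>
    hi.intervalIntegrable
  -- `w` solves a Riccati inequality: `J - (n² w)'` is a square plus a nonnegative remainder
  set w : ℝ → ℝ := fun x => ψ' x / ψ x - θ * (x ^ 3 / ψ x ^ 2) with hw
  set w' : ℝ → ℝ := fun x => (V x * ψ x * ψ x - ψ' x * ψ' x) / ψ x ^ 2 -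
    θ * ((3 * x ^ 2 * ψ x ^ 2 - x ^ 3 * (2 * ψ x * ψ' x)) / (ψ x ^ 2) ^ 2) with hw'
  have hwd : ∀ x, 0 < x → x ≤ X → HasDerivAt w (w' x) x := by
    intro x h1 h2
    have h3 := (hpos x h1 h2).ne'
    have e1 := (hψ' x).fun_div (hψ x) h3
    have e2 : HasDerivAt (fun x => ψ x ^ 2) (2 * ψ x * ψ' x) x := by
      simpa using (hψ x).fun_pow 2
    have e3 : HasDerivAt (fun x : ℝ => x ^ 3) (3 * x ^ 2) x := by
      simpa using (hasDerivAt_id x).fun_pow 3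
    exact e1.fun_sub ((e3.fun_div e2 (pow_ne_zero 2 h3)).const_mul θ)
  -- `ψ` vanishes at the origin, so the identity is integrated from `ε`; the boundary term at `ε`
  -- tends to zero because `n(ε)²` is of smaller order than `ε`
  have main : ∀ ε, 0 < ε → ε < X → -(A / k₀ * ∫ x in (0 : ℝ)..ε, n' x ^ 2) ≤ ∫ x in ε..X, J x := by
    intro ε hε hεX
    have hmem : ∀ x ∈ uIcc ε X, 0 < x ∧ x ≤ X := fun x hx => by
      rw [uIcc_of_le hεX.le] at hx
      exact ⟨hε.trans_le hx.1, hx.2⟩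
    have hwac : AbsolutelyContinuousOnInterval w ε X := by
      have hw'c : ContinuousOn w' (uIcc ε X) := by
        intro x hx
        have h3 := (hpos x (hmem x hx).1 (hmem x hx).2).ne'
        have h4 : (ψ x ^ 2) ≠ 0 := pow_ne_zero 2 h3
        have h5 : (ψ x ^ 2) ^ 2 ≠ 0 := pow_ne_zero 2 h4
        refine ContinuousAt.continuousWithinAt ?_
        exact ((((hV.mul hψc).mul hψc).sub (hψ'c.mul hψ'c)).continuousAt.div
          (hψc.pow 2).continuousAt h4).sub (continuousAt_const.mul
            (ContinuousAt.div (by fun_prop) ((hψc.pow 2).pow 2).continuousAt h5))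
      obtain ⟨C, hC⟩ := isCompact_uIcc.exists_bound_of_continuousOn hw'c
      have hL := (convex_uIcc ε X).lipschitzOnWith_of_nnnorm_hasDerivWithin_le (f := w) (f' := w')
        (C := Real.toNNReal C)
        (fun x hx => (hwd x (hmem x hx).1 (hmem x hx).2).hasDerivWithinAt) (fun x hx => by
          rw [← NNReal.coe_le_coe, coe_nnnorm]
          exact (hC x hx).trans (Real.le_coe_toNNReal C))
      exact hL.absolutelyContinuousOnInterval
    have hF : AbsolutelyContinuousOnInterval (n * n * w) ε X :=
      ((hn.absCont ε X).mul (hn.absCont ε X)).mul hwac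
    set dF : ℝ → ℝ := fun x => (n' x * n x + n x * n' x) * w x + n x * n x * w' x with hdF
    have hdFae : ∀ᵐ x, x ∈ uIoc ε X → deriv (n * n * w) x = dF x := by
      filter_upwards [hn.ae_hasDerivAt] with x hx hxm
      have h1 := hmem x (uIoc_subset_uIcc hxm)
      exact ((hx.mul hx).mul (hwd x h1.1 h1.2)).deriv
    have hFint : ∫ x in ε..X, dF x = -(n ε * n ε * w ε) := by
      have h1 := hF.integral_deriv_eq_sub
      rw [intervalIntegral.integral_congr_ae hdFae] at h1
      rw [h1]
      simp [hnX]
    have hdFi : IntervalIntegrable dF volume ε X :=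
      hF.intervalIntegrable_deriv.congr_ae ((ae_restrict_iff' measurableSet_uIoc).2 hdFae)
    have hle : ∀ x ∈ Icc ε X, dF x ≤ J x := by
      intro x hx
      have hx0 : 0 < x := hε.trans_le hx.1
      have hψ0 := hpos x hx0 hx.2
      have h1 := hlow x ⟨hx0.le, hx.2⟩
      have h2 := hup x ⟨hx0.le, hx.2⟩
      have e1 : J x - dF x = (n' x - w x * n x) ^ 2 +
          (3 * θ * (x / ψ x) ^ 2 - (θ * x * (x / ψ x) ^ 2) ^ 2 - κ) * n x ^ 2 := by
        simp only [hJ, hdF, hw, hw']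
        field_simp
        ring
      have e2 : 1 / k₁ ≤ x / ψ x := by
        rw [div_le_div_iff₀ hk₁ hψ0]
        linarith
      have e3 : x / ψ x ≤ 1 / k₀ := by
        rw [div_le_div_iff₀ hψ0 hk₀]
        linarith
      have e4 : (1 / k₁) ^ 2 ≤ (x / ψ x) ^ 2 := pow_le_pow_left₀ (by positivity) e2 2
      have e5 : (x / ψ x) ^ 2 ≤ (1 / k₀) ^ 2 := pow_le_pow_left₀ (by positivity) e3 2
      have e6 : (θ * x * (x / ψ x) ^ 2) ^ 2 ≤ (θ * X * (1 / k₀) ^ 2) ^ 2 := by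
        have := hx.2
        gcongr
      have e7 : 3 * θ * (1 / k₁) ^ 2 - (θ * X * (1 / k₀) ^ 2) ^ 2 - κ = 0 := by
        rw [hθ, hκ]
        field_simp
        ring
      have e8 : 3 * θ * (1 / k₁) ^ 2 ≤ 3 * θ * (x / ψ x) ^ 2 := by gcongr
      have e9 : 0 ≤ (3 * θ * (x / ψ x) ^ 2 - (θ * x * (x / ψ x) ^ 2) ^ 2 - κ) * n x ^ 2 :=
        mul_nonneg (by linarith) (sq_nonneg _)
      linarith [sq_nonneg (n' x - w x * n x)]
    have h1 := intervalIntegral.integral_mono_on hεX.le hdFi (hJi ε X) hle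
    rw [hFint] at h1
    refine le_trans ?_ h1
    refine neg_le_neg ?_
    have hψε := hpos ε hε hεX.le
    have h2 : w ε ≤ A / (k₀ * ε) := by
      have h3 : 0 ≤ θ * (ε ^ 3 / ψ ε ^ 2) := by positivity
      have h4 : ψ' ε / ψ ε ≤ A / (k₀ * ε) :=
        div_le_div₀ ((abs_nonneg _).trans (hA ε)) ((le_abs_self _).trans (hA ε)) (by positivity)
          (hlow ε ⟨hε.le, hεX.le⟩)
      simp only [hw]
      linarith
    have hA0 : 0 ≤ A := (abs_nonneg _).trans (hA ε)
    calc n ε * n ε * w ε = n ε ^ 2 * w ε := by ring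
      _ ≤ n ε ^ 2 * (A / (k₀ * ε)) := mul_le_mul_of_nonneg_left h2 (sq_nonneg _)
      _ ≤ (ε * ∫ x in (0 : ℝ)..ε, n' x ^ 2) * (A / (k₀ * ε)) :=
          mul_le_mul_of_nonneg_right (hn.sq_le_mul_integral hi h0 hε) (by positivity)
      _ = A / k₀ * ∫ x in (0 : ℝ)..ε, n' x ^ 2 := by field_simp
  have hlim : Tendsto (fun ε => (∫ x in (0 : ℝ)..ε, J x) -
      A / k₀ * ∫ x in (0 : ℝ)..ε, n' x ^ 2) (𝓝[>] 0) (𝓝 0) := by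
    have c1 := intervalIntegral.continuous_primitive hJi 0
    have c2 := intervalIntegral.continuous_primitive hn'i 0
    have : Tendsto (fun ε => (∫ x in (0 : ℝ)..ε, J x) - A / k₀ * ∫ x in (0 : ℝ)..ε, n' x ^ 2)
        (𝓝 0) (𝓝 ((∫ x in (0 : ℝ)..0, J x) - A / k₀ * ∫ x in (0 : ℝ)..0, n' x ^ 2)) :=
      (c1.sub (continuous_const.mul c2)).tendsto 0
    simp only [intervalIntegral.integral_same, mul_zero, sub_zero] at this
    exact this.mono_left nhdsWithin_le_nhds
  refine le_of_tendsto hlim ?_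
  filter_upwards [Ioo_mem_nhdsGT hX] with ε hε
  have h1 := main ε hε.1 hε.2
  rw [← intervalIntegral.integral_add_adjacent_intervals (hJi 0 ε) (hJi ε X)]
  linarith

/-- Coercivity on the half-line for functions vanishing at `0` and at `X`, beyond which the
potential is bounded below. -/
theorem halfLine_coercive {ψ ψ' V n n' : ℝ → ℝ} {X k₀ k₁ A ν κ : ℝ} (hX : 0 < X) (hk₀ : 0 < k₀)
    (hk₁ : 0 < k₁) (hψ : ∀ x, HasDerivAt ψ (ψ' x) x) (hψ' : ∀ x, HasDerivAt ψ' (V x * ψ x) x)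
    (hV : Continuous V) (hlow : ∀ x ∈ Icc 0 X, k₀ * x ≤ ψ x) (hup : ∀ x ∈ Icc 0 X, ψ x ≤ k₁ * x)
    (hA : ∀ x, |ψ' x| ≤ A) (hVb : ∀ x, |V x| ≤ A) (hVν : ∀ x, X ≤ x → ν ^ 2 ≤ V x)
    (hκ₁ : κ ≤ 2 * k₀ ^ 4 / (k₁ ^ 4 * X ^ 2)) (hκ₂ : κ ≤ ν ^ 2)
    (hn : HasACDeriv n n') (hnL : MemLp n 2 volume) (hn'L : MemLp n' 2 volume)
    (h0 : n 0 = 0) (hnX : n X = 0) :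
    κ * ∫ x in Ioi 0, n x ^ 2 ≤ ∫ x in Ioi 0, (n' x ^ 2 + V x * n x ^ 2) := by
  have i1 : Integrable fun x => n' x ^ 2 := hn'L.integrable_sq
  have i2 : Integrable fun x => n x ^ 2 := hnL.integrable_sq
  have i3 : Integrable fun x => V x * n x ^ 2 :=
    i2.bdd_mul hV.aestronglyMeasurable (ae_of_all _ hVb)
  have i4 : Integrable fun x => n' x ^ 2 + V x * n x ^ 2 := i1.add i3
  set J : ℝ → ℝ := fun x => n' x ^ 2 + V x * n x ^ 2 - κ * n x ^ 2 with hJ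
  have i5 : Integrable J := i4.sub (i2.const_mul κ)
  have key : 0 ≤ ∫ x in Ioi 0, J x := by
    rw [← Ioc_union_Ioi_eq_Ioi hX.le, setIntegral_union (Ioc_disjoint_Ioi le_rfl)
      measurableSet_Ioi i5.integrableOn i5.integrableOn]
    refine add_nonneg ?_ (setIntegral_nonneg measurableSet_Ioi fun x hx => ?_)
    · rw [← intervalIntegral.integral_of_le hX.le]
      refine (interval_coercive hX hk₀ hk₁ hψ hψ' hV hlow hup hA hn i1 h0 hnX).trans ?_
      refine intervalIntegral.integral_mono_on hX.le
        (i4.sub (i2.const_mul _)).intervalIntegrable i5.intervalIntegrable fun x _ => ?_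
      exact sub_le_sub_left (mul_le_mul_of_nonneg_right hκ₁ (sq_nonneg _)) _
    · have h1 := mul_le_mul_of_nonneg_right (hκ₂.trans (hVν x (mem_Ioi.1 hx).le)) (sq_nonneg (n x))
      have h2 := sq_nonneg (n' x)
      simp only [hJ]
      linarith
  simp only [hJ] at key
  rw [integral_sub i4.integrableOn (i2.const_mul κ).integrableOn, integral_const_mul] at key
  linarith

/-! ### Integration by parts against a solution of the linearized equation -/

theorem HasACDeriv.exists_bound {u u' : ℝ → ℝ} (h : HasACDeriv u u') (hu : MemLp u 2 volume)
    (hu' : MemLp u' 2 volume) : ∃ C, ∀ x, |u x| ≤ C := by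
  have hi : Integrable fun x => u' x * u x + u x * u' x :=
    (memLp_mul_integrable hu' hu).add (memLp_mul_integrable hu hu')
  refine ⟨Real.sqrt (u 0 ^ 2 + ∫ x, |u' x * u x + u x * u' x|), fun x => ?_⟩
  refine Real.abs_le_sqrt ?_
  have h1 := (h.mul h).integral_eq 0 x
  have h2 : |∫ t in (0 : ℝ)..x, (u' t * u t + u t * u' t)| ≤
      ∫ x, |u' x * u x + u x * u' x| := by
    refine (intervalIntegral.norm_integral_le_integral_norm_uIoc (E := ℝ)).trans ?_
    exact setIntegral_le_integral hi.norm (ae_of_all _ fun x => norm_nonneg _)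
  have h3 := (le_abs_self _).trans h2
  simp only [Pi.mul_apply] at h1
  rw [h1] at h3
  nlinarith

/-- Integration by parts on the half-line against a solution of `g'' = s` whose derivative vanishes
at infinity. -/
theorem HasACDeriv.integral_Ioi_mul {g' s u u' : ℝ → ℝ} (hg' : ∀ x, HasDerivAt g' (s x) x)
    (hs : Continuous s) (hg'L : MemLp g' 2 volume) (hsL : MemLp s 2 volume)
    (hlim : Tendsto g' atTop (𝓝 0)) (h : HasACDeriv u u') (hu : MemLp u 2 volume)
    (hu' : MemLp u' 2 volume) :
    ∫ x in Ioi 0, (g' x * u' x + s x * u x) = -(g' 0 * u 0) := by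
  have hi : Integrable fun x => s x * u x + g' x * u' x :=
    (memLp_mul_integrable hsL hu).add (memLp_mul_integrable hg'L hu')
  obtain ⟨C, hC⟩ := h.exists_bound hu hu'
  have h1 := intervalIntegral_tendsto_integral_Ioi (0 : ℝ) hi.integrableOn tendsto_id
  have h2 : ∀ R : ℝ, ∫ x in (0 : ℝ)..R, (s x * u x + g' x * u' x) = g' R * u R - g' 0 * u 0 :=
    fun R => ((HasACDeriv.of_hasDerivAt hg' hs).mul h).integral_eq 0 R
  simp only [id, h2] at h1
  have h3 : Tendsto (fun R => g' R * u R) atTop (𝓝 0) := by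
    refine squeeze_zero_norm (a := fun R => |g' R| * C) (fun R => ?_) ?_
    · rw [Real.norm_eq_abs, abs_mul]
      exact mul_le_mul_of_nonneg_left (hC R) (abs_nonneg _)
    · simpa using hlim.abs.mul_const C
  have h4 := tendsto_nhds_unique h1 (h3.sub_const (g' 0 * u 0))
  rw [zero_sub] at h4
  rw [← h4]
  congr 1
  ext x
  ring

theorem memLp_comp_neg {u : ℝ → ℝ} (hu : MemLp u 2 volume) : MemLp (fun x => u (-x)) 2 volume :=
  hu.comp_measurePreserving (Measure.measurePreserving_neg volume)

theorem HasACDeriv.comp_neg {u u' : ℝ → ℝ} (h : HasACDeriv u u') (hu' : MemLp u' 2 volume) :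
    HasACDeriv (fun x => u (-x)) (fun x => -u' (-x)) := by
  have hv : LocallyIntegrable fun x => -u' (-x) :=
    (memLp_comp_neg hu').neg.locallyIntegrable (by norm_num)
  have h1 := (HasACDeriv.primitive hv).add (HasACDeriv.of_hasDerivAt (u := fun _ => u 0) (v := 0)
      (fun x => hasDerivAt_const x _) continuous_const)
  rw [add_zero] at h1
  convert h1 using 1
  ext x
  simp only [Pi.add_apply, intervalIntegral.integral_neg]
  rw [intervalIntegral.integral_comp_neg, neg_zero, h.integral_eq]
  ring

/-- Integration by parts on the line, without boundary terms. -/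
theorem HasACDeriv.integral_mul_add_mul {g' s u u' : ℝ → ℝ} (hg' : ∀ x, HasDerivAt g' (s x) x)
    (hs : Continuous s) (hg'L : MemLp g' 2 volume) (hsL : MemLp s 2 volume)
    (hlim : Tendsto g' atTop (𝓝 0)) (hlim' : Tendsto (fun x => g' (-x)) atTop (𝓝 0))
    (h : HasACDeriv u u') (hu : MemLp u 2 volume) (hu' : MemLp u' 2 volume) :
    ∫ x, (g' x * u' x + s x * u x) = 0 := by
  have hi : Integrable fun x => g' x * u' x + s x * u x :=
    (memLp_mul_integrable hg'L hu').add (memLp_mul_integrable hsL hu)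
  have h1 := integral_Ioi_mul hg' hs hg'L hsL hlim h hu hu'
  have h2 := integral_Ioi_mul (g' := fun x => g' (-x)) (s := fun x => -s (-x))
    (fun x => ((hg' (-x)).scomp x (hasDerivAt_neg x)).congr_deriv (by simp))
    (hs.comp continuous_neg).neg (memLp_comp_neg hg'L) (memLp_comp_neg hsL).neg hlim'
    (h.comp_neg hu') (memLp_comp_neg hu) (memLp_comp_neg hu').neg
  have h3 := integral_comp_neg_Iic (0 : ℝ) fun x => g' (-x) * u' (-x) + s (-x) * u (-x)
  simp only [neg_neg, neg_zero] at h2 h3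
  rw [← setIntegral_univ, ← Iic_union_Ioi (a := (0 : ℝ)),
    setIntegral_union (Iic_disjoint_Ioi le_rfl) measurableSet_Ioi hi.integrableOn
      hi.integrableOn, h1, h3]
  have h4 : ∫ x in Ioi (0 : ℝ), (g' (-x) * u' (-x) + s (-x) * u (-x)) =
      -∫ x in Ioi (0 : ℝ), (g' (-x) * -u' (-x) + -s (-x) * u (-x)) := by
    rw [← integral_neg]
    congr 1
    ext x
    ring
  rw [h4, h2]
  ring

/-! ### Integrals of exponentially decaying families -/

theorem integrable_exp_neg_abs {ν : ℝ} (hν : 0 < ν) :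
    Integrable fun x : ℝ => Real.exp (-(ν * |x|)) := by
  have h1 : IntegrableOn (fun x : ℝ => Real.exp (-(ν * |x|))) (Ioi 0) :=
    (exp_neg_integrableOn_Ioi 0 hν).congr_fun (fun x hx => by
      simp only [abs_of_pos (mem_Ioi.1 hx), neg_mul]) measurableSet_Ioi
  have h2 : IntegrableOn (fun x : ℝ => Real.exp (-(ν * |x|))) (Iic 0) :=
    (integrableOn_exp_mul_Iic hν 0).congr_fun (fun x hx => by
      simp only [abs_of_nonpos (mem_Iic.1 hx), mul_neg, neg_neg]) measurableSet_Iic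
  rw [← integrableOn_univ, ← Iic_union_Ioi (a := (0 : ℝ))]
  exact h2.union h1

/-- The integral of the exponential majorant `e^{-ν|x|}`. -/
def expMass (ν : ℝ) : ℝ := ∫ x : ℝ, Real.exp (-(ν * |x|))

theorem expMass_nonneg (ν : ℝ) : 0 ≤ expMass ν := integral_nonneg fun _ => (Real.exp_pos _).le

theorem integrable_of_exp_decay {u : ℝ → ℝ} {A ν : ℝ} (hν : 0 < ν) (hu : Continuous u)
    (h : ∀ x, |u x| ≤ A * Real.exp (-(ν * |x|))) : Integrable u :=
  ((integrable_exp_neg_abs hν).const_mul A).mono' hu.aestronglyMeasurable (ae_of_all _ h)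

theorem mul_exp_decay {u v : ℝ → ℝ} {A B ν : ℝ} (hν : 0 < ν)
    (h : ∀ x, |u x| ≤ A * Real.exp (-(ν * |x|))) (h' : ∀ x, |v x| ≤ B * Real.exp (-(ν * |x|)))
    (x : ℝ) : |u x * v x| ≤ A * B * Real.exp (-(ν * |x|)) := by
  have hA : 0 ≤ A := by simpa using (abs_nonneg _).trans (h 0)
  have hB : 0 ≤ B := by simpa using (abs_nonneg _).trans (h' 0)
  have h1 : Real.exp (-(ν * |x|)) ≤ 1 :=
    Real.exp_le_one_iff.2 (neg_nonpos.2 (mul_nonneg hν.le (abs_nonneg x)))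
  rw [abs_mul]
  calc |u x| * |v x| ≤ (A * Real.exp (-(ν * |x|))) * (B * Real.exp (-(ν * |x|))) :=
        mul_le_mul (h x) (h' x) (abs_nonneg _) (by positivity)
    _ ≤ (A * Real.exp (-(ν * |x|))) * (B * 1) := by gcongr
    _ = _ := by ring

theorem memLp_of_exp_decay {u : ℝ → ℝ} {A ν : ℝ} (hν : 0 < ν) (hu : Continuous u)
    (h : ∀ x, |u x| ≤ A * Real.exp (-(ν * |x|))) : MemLp u 2 volume := by
  rw [memLp_two_iff_integrable_sq hu.aestronglyMeasurable]
  refine integrable_of_exp_decay (A := A * A) hν (hu.pow 2) fun x => ?_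
  rw [sq]
  exact mul_exp_decay hν h h x

theorem abs_integral_le_expMass {u : ℝ → ℝ} {A ν : ℝ} (hν : 0 < ν)
    (h : ∀ x, |u x| ≤ A * Real.exp (-(ν * |x|))) : |∫ x, u x| ≤ A * expMass ν := by
  rw [expMass, ← integral_const_mul]
  exact norm_integral_le_of_norm_le (f := u) ((integrable_exp_neg_abs hν).const_mul A)
    (ae_of_all _ fun x => h x)

theorem integral_mul_le_expMass {u v : ℝ → ℝ} {A ν : ℝ} (hν : 0 < ν)
    (h : ∀ x, |u x| ≤ A * Real.exp (-(ν * |x|))) (h' : ∀ x, |v x| ≤ A * Real.exp (-(ν * |x|))) :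
    |∫ x, u x * v x| ≤ A * A * expMass ν :=
  abs_integral_le_expMass hν (mul_exp_decay hν h h')

theorem continuousOn_integral_of_exp_decay {F : ℝ → ℝ → ℝ} {J : Set ℝ} {A ν : ℝ} (hν : 0 < ν)
    (hF : ContinuousOn (fun p : ℝ × ℝ => F p.1 p.2) (J ×ˢ univ))
    (h : ∀ c ∈ J, ∀ x, |F c x| ≤ A * Real.exp (-(ν * |x|))) :
    ContinuousOn (fun c => ∫ x, F c x) J :=
  continuousOn_of_dominated (fun _ hc => (continuous_slice hF hc).aestronglyMeasurable)
    (fun c hc => ae_of_all _ (h c hc)) ((integrable_exp_neg_abs hν).const_mul A)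
    (ae_of_all _ fun x => continuousOn_slice hF x)

/-- A continuous positive function on a compact set is bounded below by a positive constant, also
if the set is empty. -/
theorem exists_pos_le_of_compact {T : Type*} [TopologicalSpace T] {F : T → ℝ} {J : Set T}
    (hJ : IsCompact J) (hF : ContinuousOn F J) (hpos : ∀ c ∈ J, 0 < F c) :
    ∃ k, 0 < k ∧ ∀ c ∈ J, k ≤ F c := by
  rcases J.eq_empty_or_nonempty with rfl | hne
  · exact ⟨1, one_pos, by simp⟩
  · obtain ⟨c₀, hc₀, h⟩ := hJ.exists_isMinOn hne hF
    exact ⟨F c₀, hpos c₀ hc₀, fun c hc => h hc⟩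

theorem integral_pos_of_continuous {u : ℝ → ℝ} (hu : Continuous u) (hi : Integrable u)
    (h0 : ∀ x, 0 ≤ u x) {x₀ : ℝ} (hx₀ : 0 < u x₀) : 0 < ∫ x, u x := by
  rw [integral_pos_iff_support_of_nonneg h0 hi]
  have h1 : IsOpen (Function.support u) := hu.isOpen_support
  exact h1.measure_pos volume ⟨x₀, hx₀.ne'⟩

theorem integral_eq_zero_of_odd {u : ℝ → ℝ} (h : ∀ x, u (-x) = -u x) : ∫ x, u x = 0 := by
  have h1 := integral_neg_eq_self u volume
  simp only [h, integral_neg] at h1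
  linarith

section Family

variable {f : ℝ → ℝ} {I₀ J : Set ℝ} {Q : ℝ → ℝ → ℝ} {ν A X : ℝ}

/-- The slope of the wave near the crest is comparable to the distance from the crest, uniformly
in the speed: the quotient `Q_c'(x) / x` extends continuously by the curvature at the crest. -/
theorem IsSolitaryWaveFamily.exists_slope_bounds (hf : IsNonlinearity f)
    (hQ : IsSolitaryWaveFamily f I₀ Q) (hJ : IsCompact J) (hJI : J ⊆ I₀) (X : ℝ) :
    ∃ k₀ k₁, 0 < k₀ ∧ 0 < k₁ ∧ ∀ c ∈ J, ∀ x ∈ Icc 0 X,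
      k₀ * x ≤ -deriv (Q c) x ∧ -deriv (Q c) x ≤ k₁ * x := by
  set g : ℝ → ℝ → ℝ := fun c x => -(c * Q c x - f (Q c x)) with hg
  set G : ℝ × ℝ → ℝ := fun p => ∫ s in (0 : ℝ)..1, g p.1 (s * p.2) with hG
  have hgc : ContinuousOn (fun p : ℝ × ℝ => g p.1 p.2) (I₀ ×ˢ univ) :=
    ((continuousOn_fst.mul hQ.continuousOn).sub (hf.continuous.comp_continuousOn
      hQ.continuousOn)).neg
  have hGc : ContinuousOn G (J ×ˢ Icc 0 X) := by
    rw [continuousOn_iff_continuous_domRestrict]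
    refine intervalIntegral.continuous_parametric_intervalIntegral_of_continuous'
      (f := fun (p : ↥(J ×ˢ Icc (0 : ℝ) X)) (s : ℝ) => g p.1.1 (s * p.1.2)) ?_ 0 1
    rw [← continuousOn_univ]
    exact hgc.comp (f := fun a : ↥(J ×ˢ Icc (0 : ℝ) X) × ℝ => (a.1.1.1, a.2 * a.1.1.2))
      (by fun_prop) fun a _ => ⟨hJI a.1.2.1, mem_univ _⟩
  have hslope : ∀ c ∈ J, ∀ x, -deriv (Q c) x = G (c, x) * x := by
    intro c hc x
    have hw := hQ.isSolitaryWave c (hJI hc)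
    have hgcc := continuous_slice hgc (hJI hc)
    have h1 : ∫ y in (0 : ℝ)..x, g c y = -deriv (Q c) x := by
      rw [intervalIntegral.integral_eq_sub_of_hasDerivAt (f := fun y => -deriv (Q c) y)
        (fun y _ => (hw.hasDerivAt_deriv y).fun_neg) (hgcc.intervalIntegrable _ _)]
      simp [hw.deriv_zero]
    have h2 := intervalIntegral.smul_integral_comp_mul_right (a := 0) (b := 1) (g c) x
    rw [zero_mul, one_mul, h1, smul_eq_mul] at h2
    rw [← h2, mul_comm]
  have hGpos : ∀ p ∈ J ×ˢ Icc (0 : ℝ) X, 0 < G p := by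
    rintro ⟨c, x⟩ ⟨hc, hx⟩
    have hw := hQ.isSolitaryWave c (hJI hc)
    rcases hx.1.eq_or_lt with h0 | h0
    · simp only [] at h0
      rw [← h0]
      have := hw.second_deriv_zero_neg hf
      simp only [hG, hg, mul_zero, intervalIntegral.integral_const, sub_zero, one_smul]
      linarith
    · have h1 := hw.deriv_neg_of_pos hf h0
      have h2 := hslope c hc x
      by_contra hcon
      have h3 := mul_nonpos_of_nonpos_of_nonneg (not_lt.1 hcon) hx.1
      simp only at h1
      linarith
  have hcomp := hJ.prod (isCompact_Icc (a := (0 : ℝ)) (b := X))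
  obtain ⟨k₀, hk₀, h0⟩ := exists_pos_le_of_compact hcomp hGc hGpos
  obtain ⟨k₁, h1⟩ := hcomp.exists_bound_of_continuousOn hGc
  refine ⟨k₀, max k₁ 1, hk₀, lt_max_of_lt_right one_pos, fun c hc x hx => ?_⟩
  rw [hslope c hc x]
  exact ⟨mul_le_mul_of_nonneg_right (h0 (c, x) ⟨hc, hx⟩) hx.1,
    mul_le_mul_of_nonneg_right (((le_abs_self _).trans (h1 (c, x) ⟨hc, hx⟩)).trans
      (le_max_left _ _)) hx.1⟩

end Family

/-! ### Coercivity of the Hessian at a centred wave -/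

section Family

variable {f : ℝ → ℝ} {I₀ J : Set ℝ} {Q : ℝ → ℝ → ℝ} {ν A X : ℝ}

theorem IsSolitaryWave.hasDerivAt_two {c : ℝ} {q : ℝ → ℝ} (hf : IsNonlinearity f)
    (h : IsSolitaryWave f c q) (x : ℝ) :
    HasDerivAt (fun x => c * q x - f (q x)) ((c - deriv f (q x)) * deriv q x) x := by
  refine (((h.hasDerivAt x).const_mul c).fun_sub
    ((hf.hasDerivAt (q x)).comp x (h.hasDerivAt x))).congr_deriv ?_
  ring

/-- The functions attached to the wave of speed `c`, with the properties on which the coercivity of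
the Hessian rests. Here `q` is the wave, `χ` its derivative with respect to the speed, `s` and `χ₁`
are the derivatives of `q'` and `χ`, and `V` is the potential of the Hessian. -/
structure LinearizedWave (q q' s χ χ₁ V : ℝ → ℝ) (ν A X k₀ k₁ : ℝ) : Prop where
  ν_pos : 0 < ν
  X_pos : 0 < X
  k₀_pos : 0 < k₀
  k₁_pos : 0 < k₁
  q_deriv : ∀ x, HasDerivAt q (q' x) x
  q'_deriv : ∀ x, HasDerivAt q' (s x) x
  s_deriv : ∀ x, HasDerivAt s (V x * q' x) x
  χ_deriv : ∀ x, HasDerivAt χ (χ₁ x) x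
  χ₁_deriv : ∀ x, HasDerivAt χ₁ (V x * χ x + q x) x
  V_cont : Continuous V
  q_even : ∀ x, q (-x) = q x
  q'_odd : ∀ x, q' (-x) = -q' x
  s_even : ∀ x, s (-x) = s x
  χ_even : ∀ x, χ (-x) = χ x
  χ₁_odd : ∀ x, χ₁ (-x) = -χ₁ x
  V_even : ∀ x, V (-x) = V x
  q_pos : ∀ x, 0 < q x
  q'_neg : ∀ x, 0 < x → q' x < 0
  q_decay : ∀ x, |q x| ≤ A * Real.exp (-(ν * |x|))
  q'_decay : ∀ x, |q' x| ≤ A * Real.exp (-(ν * |x|))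
  s_decay : ∀ x, |s x| ≤ A * Real.exp (-(ν * |x|))
  χ_decay : ∀ x, |χ x| ≤ A * Real.exp (-(ν * |x|))
  χ₁_decay : ∀ x, |χ₁ x| ≤ A * Real.exp (-(ν * |x|))
  V_ge : ∀ x, X ≤ x → ν ^ 2 ≤ V x
  V_le : ∀ x, |V x| ≤ A
  slope_ge : ∀ x ∈ Icc 0 X, k₀ * x ≤ -q' x
  slope_le : ∀ x ∈ Icc 0 X, -q' x ≤ k₁ * x

theorem UniformBounds.linearizedWave (hf : IsNonlinearity f) (hQ : IsSolitaryWaveFamily f I₀ Q)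
    (hJI : J ⊆ I₀) (U : UniformBounds f Q J ν A X) {k₀ k₁ : ℝ} (hk₀ : 0 < k₀) (hk₁ : 0 < k₁)
    (hk : ∀ c ∈ J, ∀ x ∈ Icc 0 X, k₀ * x ≤ -deriv (Q c) x ∧ -deriv (Q c) x ≤ k₁ * x)
    {c : ℝ} (hc : c ∈ J) :
    LinearizedWave (Q c) (deriv (Q c)) (fun x => c * Q c x - f (Q c x)) (speedDeriv Q c)
      (speedDerivOne f Q c) (fun x => c - deriv f (Q c x)) ν A X k₀ k₁ := by
  have hw := hQ.isSolitaryWave c (hJI hc)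
  exact
  { ν_pos := U.ν_pos
    X_pos := U.X_pos
    k₀_pos := hk₀
    k₁_pos := hk₁
    q_deriv := hw.hasDerivAt
    q'_deriv := hw.hasDerivAt_deriv
    s_deriv := hw.hasDerivAt_two hf
    χ_deriv := hQ.hasDerivAt_speedDeriv hf (hJI hc)
    χ₁_deriv := hQ.hasDerivAt_speedDerivOne hf (hJI hc)
    V_cont := continuous_const.sub (hf.continuous_deriv.comp hw.continuous)
    q_even := hw.even
    q'_odd := hw.deriv_neg
    s_even := fun x => by simp only [hw.even]
    χ_even := hQ.speedDeriv_neg (hJI hc)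
    χ₁_odd := hQ.speedDerivOne_neg (hJI hc)
    V_even := fun x => by simp only [hw.even]
    q_pos := hw.pos
    q'_neg := fun x hx => hw.deriv_neg_of_pos hf hx
    q_decay := U.wave c hc
    q'_decay := U.wave_deriv c hc
    s_decay := U.wave_deriv_two c hc
    χ_decay := U.speed c hc
    χ₁_decay := U.speed_deriv c hc
    V_ge := fun x hx => U.potential_ge c hc x (hx.trans (le_abs_self x))
    V_le := U.potential_le c hc
    slope_ge := fun x hx => (hk c hc x hx).1
    slope_le := fun x hx => (hk c hc x hx).2 }

end Family

namespace LinearizedWave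

variable {q q' s χ χ₁ V : ℝ → ℝ} {ν A X k₀ k₁ : ℝ}
variable (W : LinearizedWave q q' s χ χ₁ V ν A X k₀ k₁)
include W

theorem q_cont : Continuous q := continuous_iff_continuousAt.2 fun x => (W.q_deriv x).continuousAt

theorem q'_cont : Continuous q' :=
  continuous_iff_continuousAt.2 fun x => (W.q'_deriv x).continuousAt

theorem s_cont : Continuous s := continuous_iff_continuousAt.2 fun x => (W.s_deriv x).continuousAt

theorem χ_cont : Continuous χ := continuous_iff_continuousAt.2 fun x => (W.χ_deriv x).continuousAt

theorem χ₁_cont : Continuous χ₁ :=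
  continuous_iff_continuousAt.2 fun x => (W.χ₁_deriv x).continuousAt

theorem q_L2 : MemLp q 2 volume := memLp_of_exp_decay W.ν_pos W.q_cont W.q_decay

theorem q'_L2 : MemLp q' 2 volume := memLp_of_exp_decay W.ν_pos W.q'_cont W.q'_decay

theorem s_L2 : MemLp s 2 volume := memLp_of_exp_decay W.ν_pos W.s_cont W.s_decay

theorem χ_L2 : MemLp χ 2 volume := memLp_of_exp_decay W.ν_pos W.χ_cont W.χ_decay

theorem χ₁_L2 : MemLp χ₁ 2 volume := memLp_of_exp_decay W.ν_pos W.χ₁_cont W.χ₁_decay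

theorem V_mul_L2 {u : ℝ → ℝ} (hu : MemLp u 2 volume) : MemLp (fun x => V x * u x) 2 volume := by
  have h1 : MemLp V ⊤ volume :=
    memLp_top_of_bound W.V_cont.aestronglyMeasurable A (ae_of_all _ W.V_le)
  exact hu.mul h1

theorem q'_AC : HasACDeriv q' s := HasACDeriv.of_hasDerivAt W.q'_deriv W.s_cont

theorem χ_AC : HasACDeriv χ χ₁ := HasACDeriv.of_hasDerivAt W.χ_deriv W.χ₁_cont

theorem q'_zero : q' 0 = 0 := by
  have := W.q'_odd 0
  rw [neg_zero] at this
  linarith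

theorem tendsto_zero_of_decay {u : ℝ → ℝ} (hu : ∀ x, |u x| ≤ A * Real.exp (-(ν * |x|))) :
    Tendsto u atTop (𝓝 0) := by
  refine squeeze_zero_norm' (a := fun x => A * Real.exp (-(ν * (x - 0)))) ?_
    (tendsto_exp_decay A 0 W.ν_pos)
  filter_upwards [eventually_ge_atTop 0] with x hx
  have := hu x
  rw [abs_of_nonneg hx] at this
  simpa using this

/-- The integrand of the bilinear form of the Hessian is integrable. -/
theorem integrable_form {u u' v v' : ℝ → ℝ} (hu : MemLp u 2 volume) (hu' : MemLp u' 2 volume)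
    (hv : MemLp v 2 volume) (hv' : MemLp v' 2 volume) :
    Integrable fun x => u' x * v' x + V x * u x * v x :=
  (memLp_mul_integrable hu' hv').add (memLp_mul_integrable (W.V_mul_L2 hu) hv)

/-- On the half-line, functions vanishing at the origin are orthogonal to `q'` for the form. -/
theorem integral_Ioi_q' {v v' : ℝ → ℝ} (h : HasACDeriv v v') (hv : MemLp v 2 volume)
    (hv' : MemLp v' 2 volume) (h0 : v 0 = 0) :
    ∫ x in Ioi 0, (s x * v' x + V x * q' x * v x) = 0 := by
  have := HasACDeriv.integral_Ioi_mul (g' := s) (s := fun x => V x * q' x) W.s_deriv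
    (W.V_cont.mul W.q'_cont) W.s_L2 (W.V_mul_L2 W.q'_L2) (W.tendsto_zero_of_decay W.s_decay) h hv hv'
  rwa [h0, mul_zero, neg_zero] at this

/-- The equation `ℒ q' = 0` in weak form. -/
theorem integral_form_q' {v v' : ℝ → ℝ} (h : HasACDeriv v v') (hv : MemLp v 2 volume)
    (hv' : MemLp v' 2 volume) :
    ∫ x, (s x * v' x + V x * q' x * v x) = 0 :=
  HasACDeriv.integral_mul_add_mul W.s_deriv (W.V_cont.mul W.q'_cont) W.s_L2 (W.V_mul_L2 W.q'_L2)
    (W.tendsto_zero_of_decay W.s_decay)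
    (W.tendsto_zero_of_decay fun x => by rw [W.s_even]; exact W.s_decay x) h hv hv'

/-- The equation `ℒ χ = -q` in weak form. -/
theorem integral_form_χ {v v' : ℝ → ℝ} (h : HasACDeriv v v') (hv : MemLp v 2 volume)
    (hv' : MemLp v' 2 volume) :
    ∫ x, (χ₁ x * v' x + V x * χ x * v x) = -∫ x, q x * v x := by
  have hg : MemLp (fun x => V x * χ x + q x) 2 volume := (W.V_mul_L2 W.χ_L2).add W.q_L2
  have h1 : ∫ x, (χ₁ x * v' x + (V x * χ x + q x) * v x) = 0 :=
    HasACDeriv.integral_mul_add_mul W.χ₁_deriv ((W.V_cont.mul W.χ_cont).add W.q_cont) W.χ₁_L2 hg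
      (W.tendsto_zero_of_decay W.χ₁_decay)
      (W.tendsto_zero_of_decay fun x => by rw [W.χ₁_odd, abs_neg]; exact W.χ₁_decay x) h hv hv'
  have i2 := W.integrable_form W.χ_L2 W.χ₁_L2 hv hv'
  have i3 := memLp_mul_integrable W.q_L2 hv
  have h4 : ∫ x, (χ₁ x * v' x + (V x * χ x + q x) * v x) =
      (∫ x, (χ₁ x * v' x + V x * χ x * v x)) + ∫ x, q x * v x := by
    rw [← integral_add i2 i3]
    congr 1
    ext x
    ring
  linarith

/-- On the half-line the form of a function vanishing at the origin controls the function up to a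
multiple of `q'`, which spans the kernel. -/
theorem halfLine_bound {κ : ℝ} (hκ₁ : κ ≤ 2 * k₀ ^ 4 / (k₁ ^ 4 * X ^ 2)) (hκ₂ : κ ≤ ν ^ 2)
    {v v' : ℝ → ℝ} (h : HasACDeriv v v') (hv : MemLp v 2 volume) (hv' : MemLp v' 2 volume)
    (h0 : v 0 = 0) : ∃ β : ℝ, κ * ∫ x in Ioi 0, (v x + β * q' x) ^ 2 ≤
      ∫ x in Ioi 0, (v' x ^ 2 + V x * v x ^ 2) := by
  have hqX : q' X ≠ 0 := (W.q'_neg X W.X_pos).ne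
  set β := -(v X / q' X) with hβ
  refine ⟨β, ?_⟩
  have hn : HasACDeriv (v + β • q') (v' + β • s) := h.add (W.q'_AC.const_smul β)
  have hnL : MemLp (v + β • q') 2 volume := hv.add (W.q'_L2.const_smul β)
  have hn'L : MemLp (v' + β • s) 2 volume := hv'.add (W.s_L2.const_smul β)
  have hn0 : (v + β • q') 0 = 0 := by simp [h0, W.q'_zero]
  have hsA : ∀ x, |s x| ≤ A := fun x => by
    have hA : 0 ≤ A := (abs_nonneg _).trans (W.V_le 0)
    refine (W.s_decay x).trans (mul_le_of_le_one_right hA ?_)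
    exact Real.exp_le_one_iff.2 (neg_nonpos.2 (mul_nonneg W.ν_pos.le (abs_nonneg x)))
  have h1 := halfLine_coercive (ψ := fun x => -q' x) (ψ' := fun x => -s x) (V := V)
    W.X_pos W.k₀_pos W.k₁_pos (fun x => (W.q'_deriv x).fun_neg) (fun x => by
      refine (W.s_deriv x).fun_neg.congr_deriv ?_
      ring) W.V_cont W.slope_ge W.slope_le (fun x => by rw [abs_neg]; exact hsA x) W.V_le W.V_ge
    hκ₁ hκ₂ hn hnL hn'L hn0 (by
      simp only [Pi.add_apply, Pi.smul_apply, smul_eq_mul, hβ]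
      field_simp
      ring)
  simp only [Pi.add_apply, Pi.smul_apply, smul_eq_mul] at h1
  refine h1.trans_eq ?_
  have i1 := (W.integrable_form hv hv' hv hv').integrableOn (s := Ioi 0)
  have i2 := (W.integrable_form W.q'_L2 W.s_L2 hv hv').integrableOn (s := Ioi 0)
  have i3 := (W.integrable_form W.q'_L2 W.s_L2 W.q'_L2 W.s_L2).integrableOn (s := Ioi 0)
  have e1 : ∀ x, (v' x + β * s x) ^ 2 + V x * (v x + β * q' x) ^ 2 =
      (v' x * v' x + V x * v x * v x) + (2 * β * (s x * v' x + V x * q' x * v x) +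
        β ^ 2 * (s x * s x + V x * q' x * q' x)) := fun x => by ring
  have e2 : ∀ x, v' x ^ 2 + V x * v x ^ 2 = v' x * v' x + V x * v x * v x := fun x => by ring
  simp only [e1, e2]
  have j2 := i2.const_mul (2 * β)
  have j3 := i3.const_mul (β ^ 2)
  have j23 : IntegrableOn (fun x => 2 * β * (s x * v' x + V x * q' x * v x) +
    β ^ 2 * (s x * s x + V x * q' x * q' x)) (Ioi 0) := j2.add j3
  rw [integral_add i1 j23, integral_add j2 j3, integral_const_mul, integral_const_mul,
    W.integral_Ioi_q' h hv hv' h0, W.integral_Ioi_q' W.q'_AC W.q'_L2 W.s_L2 W.q'_zero]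
  ring

/-- The form is nonnegative on functions vanishing at the origin, and controls such a function up
to multiples of `q'` and `|q'|`, its two null directions. -/
theorem bound_of_zero {κ : ℝ} (hκ₁ : κ ≤ 2 * k₀ ^ 4 / (k₁ ^ 4 * X ^ 2)) (hκ₂ : κ ≤ ν ^ 2)
    {v v' : ℝ → ℝ} (h : HasACDeriv v v') (hv : MemLp v 2 volume) (hv' : MemLp v' 2 volume)
    (h0 : v 0 = 0) : ∃ d t : ℝ, κ * ∫ x, (v x + d * q' x - t * |q' x|) ^ 2 ≤
      ∫ x, (v' x ^ 2 + V x * v x ^ 2) := by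
  obtain ⟨β, hβ⟩ := W.halfLine_bound hκ₁ hκ₂ h hv hv' h0
  obtain ⟨β', hβ'⟩ := W.halfLine_bound hκ₁ hκ₂ (h.comp_neg hv') (memLp_comp_neg hv)
    (memLp_comp_neg hv').neg (by simpa using h0)
  set d := (β - β') / 2 with hd
  set t := (β + β') / 2 with ht
  refine ⟨d, t, ?_⟩
  have hL : MemLp (fun x => v x + d * q' x - t * |q' x|) 2 volume :=
    (hv.add (W.q'_L2.const_mul d)).sub (W.q'_L2.norm.const_mul t)
  have i1 := hL.integrable_sq
  have i2 : Integrable fun x => v' x ^ 2 + V x * v x ^ 2 := by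
    refine (W.integrable_form hv hv' hv hv').congr (ae_of_all _ fun x => ?_)
    simp only
    ring
  have split : ∀ {F : ℝ → ℝ}, Integrable F →
      ∫ x, F x = (∫ x in Ioi 0, F (-x)) + ∫ x in Ioi 0, F x := by
    intro F hF
    rw [← setIntegral_univ, ← Iic_union_Ioi (a := (0 : ℝ)),
      setIntegral_union (Iic_disjoint_Ioi le_rfl) measurableSet_Ioi hF.integrableOn
        hF.integrableOn]
    congr 1
    have := integral_comp_neg_Iic (0 : ℝ) fun x => F (-x)
    simp only [neg_neg, neg_zero] at this
    exact this
  rw [split i1, split i2, mul_add]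
  refine add_le_add (le_trans (le_of_eq ?_) (hβ'.trans (le_of_eq ?_))) (le_trans (le_of_eq ?_) hβ)
  · congr 1
    refine setIntegral_congr_fun measurableSet_Ioi fun x hx => ?_
    simp only [W.q'_odd, abs_neg, abs_of_neg (W.q'_neg x hx), hd, ht]
    ring
  · refine setIntegral_congr_fun measurableSet_Ioi fun x _ => ?_
    simp only [W.V_even, neg_sq]
  · congr 1
    refine setIntegral_congr_fun measurableSet_Ioi fun x hx => ?_
    simp only [abs_of_neg (W.q'_neg x hx), hd, ht]
    ring

/-- Coercivity of the form on the orthogonal complement of `q` and `q'`, if `⟨q, χ⟩ > 0`. Since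
`ℒ χ = -q`, subtracting from `u ⊥ q` the multiple of `χ` with the same value at the origin lowers
the form by a multiple of `⟨q, χ⟩`, and leaves a function to which `bound_of_zero` applies. -/
theorem coercive {κ k K : ℝ} (hκ : 0 < κ) (hκ₁ : κ ≤ 2 * k₀ ^ 4 / (k₁ ^ 4 * X ^ 2))
    (hκ₂ : κ ≤ ν ^ 2) (hk : 0 < k) (hK : 1 ≤ K) (hκk : κ ≤ k) (hδ : k ≤ ∫ x, q x * χ x)
    (hδK : ∫ x, q x * χ x ≤ K) (hm : k ≤ ∫ x, |q' x| * q x) (hp : 0 < ∫ x, q' x ^ 2)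
    (hpK : ∫ x, q' x ^ 2 ≤ K)
    (hqK : ∫ x, q x ^ 2 ≤ K) (hχK : ∫ x, χ x ^ 2 ≤ K) {u u' : ℝ → ℝ} (h : HasACDeriv u u')
    (hu : MemLp u 2 volume) (hu' : MemLp u' 2 volume) (huq : ∫ x, u x * q x = 0)
    (huq' : ∫ x, u x * q' x = 0) :
    κ / (4 * (K + 2 + 4 * K ^ 3 / k ^ 2)) * ∫ x, u x ^ 2 ≤ ∫ x, (u' x ^ 2 + V x * u x ^ 2) := by
  have hK0 : 0 < K := one_pos.trans_le hK
  set δ := ∫ x, q x * χ x with hδdef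
  -- `u` and `χ` are orthogonal for the form, since `ℒ χ = -q` and `u ⊥ q`
  have expand : ∀ t : ℝ, ∫ x, ((u' x - t * χ₁ x) ^ 2 + V x * (u x - t * χ x) ^ 2) =
      (∫ x, (u' x ^ 2 + V x * u x ^ 2)) - t ^ 2 * δ := by
    intro t
    have i1 := W.integrable_form hu hu' hu hu'
    have i2 := W.integrable_form W.χ_L2 W.χ₁_L2 hu hu'
    have i3 := W.integrable_form W.χ_L2 W.χ₁_L2 W.χ_L2 W.χ₁_L2
    have e1 : ∀ x, (u' x - t * χ₁ x) ^ 2 + V x * (u x - t * χ x) ^ 2 =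
        (u' x * u' x + V x * u x * u x) + ((-(2 * t)) * (χ₁ x * u' x + V x * χ x * u x) +
          t ^ 2 * (χ₁ x * χ₁ x + V x * χ x * χ x)) := fun x => by ring
    have e2 : ∀ x, u' x ^ 2 + V x * u x ^ 2 = u' x * u' x + V x * u x * u x := fun x => by ring
    have e3 : ∫ x, q x * u x = 0 := by rw [← huq]; congr 1; ext x; ring
    simp only [e1, e2]
    have j2 := i2.const_mul (-(2 * t))
    have j3 := i3.const_mul (t ^ 2)
    have j23 : Integrable fun x => (-(2 * t)) * (χ₁ x * u' x + V x * χ x * u x) +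
      t ^ 2 * (χ₁ x * χ₁ x + V x * χ x * χ x) := j2.add j3
    rw [integral_add i1 j23, integral_add j2 j3, integral_const_mul, integral_const_mul,
      W.integral_form_χ h hu hu', W.integral_form_χ W.χ_AC W.χ_L2 W.χ₁_L2, e3]
    ring
  -- if `χ` vanished at the origin, its form would be nonnegative, but it equals `-⟨q, χ⟩ < 0`
  have hχ0 : χ 0 ≠ 0 := by
    intro hχ0
    obtain ⟨d, t, hb⟩ := W.bound_of_zero hκ₁ hκ₂ W.χ_AC W.χ_L2 W.χ₁_L2 hχ0
    have e1 : ∫ x, (χ₁ x ^ 2 + V x * χ x ^ 2) = -δ := by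
      rw [hδdef, ← W.integral_form_χ W.χ_AC W.χ_L2 W.χ₁_L2]
      congr 1
      ext x
      ring
    rw [e1] at hb
    have e2 : 0 ≤ κ * ∫ x, (χ x + d * q' x - t * |q' x|) ^ 2 :=
      mul_nonneg hκ.le (integral_nonneg fun x => sq_nonneg _)
    linarith
  set t := u 0 / χ 0 with ht
  have hζL : MemLp (u - t • χ) 2 volume := hu.sub (W.χ_L2.const_smul t)
  have hζ'L : MemLp (u' - t • χ₁) 2 volume := hu'.sub (W.χ₁_L2.const_smul t)
  obtain ⟨d, σ, hb⟩ := W.bound_of_zero hκ₁ hκ₂ (h.sub (W.χ_AC.const_smul t)) hζL hζ'L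
    (by simp [ht, hχ0])
  simp only [Pi.sub_apply, Pi.smul_apply, smul_eq_mul] at hb
  rw [expand t] at hb
  set n : ℝ → ℝ := fun x => u x - t * χ x + d * q' x - σ * |q' x| with hn
  have hnL : MemLp n 2 volume := (hζL.add (W.q'_L2.const_mul d)).sub (W.q'_L2.norm.const_mul σ)
  set N := ∫ x, n x ^ 2 with hN
  have hN0 : 0 ≤ N := integral_nonneg fun x => sq_nonneg _
  have haL : MemLp (fun x => |q' x|) 2 volume := W.q'_L2.norm
  -- the two orthogonality conditions determine `σ` and `d`
  have hu_eq : ∀ x, u x = t * χ x + n x - d * q' x + σ * |q' x| := fun x => by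
    simp only [hn]; ring
  have pair : ∀ {g : ℝ → ℝ}, MemLp g 2 volume → ∫ x, u x * g x = t * (∫ x, χ x * g x) +
      (∫ x, n x * g x) - d * (∫ x, q' x * g x) + σ * ∫ x, |q' x| * g x := by
    intro g hg
    have i1 := (memLp_mul_integrable W.χ_L2 hg).const_mul t
    have i2 := memLp_mul_integrable hnL hg
    have i3 := (memLp_mul_integrable W.q'_L2 hg).const_mul d
    have i4 := (memLp_mul_integrable haL hg).const_mul σ
    have l1 : Integrable fun x => t * (χ x * g x) + n x * g x := i1.add i2
    have l2 : Integrable fun x => t * (χ x * g x) + n x * g x - d * (q' x * g x) := l1.sub i3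
    rw [← integral_const_mul, ← integral_const_mul, ← integral_const_mul, ← integral_add i1 i2,
      ← integral_sub l1 i3, ← integral_add l2 i4]
    congr 1
    ext x
    rw [hu_eq x]
    ring
  set P := ∫ x, q' x ^ 2 with hP
  set μ := ∫ x, |q' x| * q x with hμ
  have hrel1 : t * δ + (∫ x, n x * q x) + σ * μ = 0 := by
    have h1 := pair W.q_L2
    rw [huq, integral_eq_zero_of_odd (u := fun x => q' x * q x)
      (fun x => by rw [W.q'_odd, W.q_even]; ring)] at h1
    have e1 : ∫ x, χ x * q x = δ := by rw [hδdef]; congr 1; ext x; ring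
    rw [e1] at h1
    linarith
  have hrel2 : d * P = ∫ x, n x * q' x := by
    have h1 := pair W.q'_L2
    rw [huq', integral_eq_zero_of_odd (u := fun x => χ x * q' x)
      (fun x => by rw [W.q'_odd, W.χ_even]; ring),
      integral_eq_zero_of_odd (u := fun x => |q' x| * q' x)
      (fun x => by rw [W.q'_odd, abs_neg]; ring)] at h1
    have e1 : ∫ x, q' x * q' x = P := by rw [hP]; congr 1; ext x; ring
    rw [e1] at h1
    linarith
  have hcs1 : (∫ x, n x * q x) ^ 2 ≤ N * K :=
    (sq_integral_mul_le hnL W.q_L2).trans (mul_le_mul_of_nonneg_left hqK hN0)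
  have hd2 : d ^ 2 * P ≤ N := by
    have h1 : (d * P) ^ 2 ≤ N * P := by
      rw [hrel2]
      exact sq_integral_mul_le hnL W.q'_L2
    have h2 : (d ^ 2 * P) * P ≤ N * P := by linarith
    exact le_of_mul_le_mul_right h2 hp
  have hσ2 : σ ^ 2 * P ≤ 4 * K ^ 3 / k ^ 2 * (t ^ 2 + N) := by
    have h1 : σ ^ 2 * k ^ 2 ≤ 2 * t ^ 2 * K ^ 2 + 2 * (N * K) := by
      calc σ ^ 2 * k ^ 2 ≤ σ ^ 2 * μ ^ 2 :=
            mul_le_mul_of_nonneg_left (pow_le_pow_left₀ hk.le hm 2) (sq_nonneg _)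
        _ = (t * δ + ∫ x, n x * q x) ^ 2 := by
            have : σ * μ = -(t * δ + ∫ x, n x * q x) := by linarith
            rw [← mul_pow, this, neg_sq]
        _ ≤ 2 * (t * δ) ^ 2 + 2 * (∫ x, n x * q x) ^ 2 := by
            linarith [sq_nonneg (t * δ - ∫ x, n x * q x)]
        _ ≤ 2 * (t ^ 2 * K ^ 2) + 2 * (N * K) := by
            rw [mul_pow]
            have : δ ^ 2 ≤ K ^ 2 := pow_le_pow_left₀ (hk.le.trans hδ) hδK 2
            have := mul_le_mul_of_nonneg_left this (sq_nonneg t)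
            linarith
        _ = _ := by ring
    have h2 : σ ^ 2 * P * k ^ 2 ≤ 4 * K ^ 3 * (t ^ 2 + N) := by
      have hKK : K ≤ K ^ 2 := by rw [sq]; exact le_mul_of_one_le_left hK0.le hK
      calc σ ^ 2 * P * k ^ 2 = (σ ^ 2 * k ^ 2) * P := by ring
        _ ≤ (2 * t ^ 2 * K ^ 2 + 2 * (N * K)) * K := by gcongr
        _ ≤ (2 * t ^ 2 * K ^ 2 + 2 * (N * K ^ 2)) * K := by gcongr
        _ = 2 * K ^ 3 * (t ^ 2 + N) := by ring
        _ ≤ 4 * K ^ 3 * (t ^ 2 + N) := by gcongr; norm_num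
    rw [div_mul_eq_mul_div, le_div_iff₀ (by positivity)]
    exact h2
  have hnorm : ∫ x, u x ^ 2 ≤ 4 * (t ^ 2 * K + N + d ^ 2 * P + σ ^ 2 * P) := by
    have i1 := W.χ_L2.integrable_sq
    have i2 := hnL.integrable_sq
    have i3 := W.q'_L2.integrable_sq
    have j1 := i1.const_mul (t ^ 2)
    have j3 := i3.const_mul (d ^ 2)
    have j4 := i3.const_mul (σ ^ 2)
    have e1 : ∫ x, 4 * (t ^ 2 * χ x ^ 2 + n x ^ 2 + d ^ 2 * q' x ^ 2 + σ ^ 2 * q' x ^ 2) =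
        4 * (t ^ 2 * (∫ x, χ x ^ 2) + N + d ^ 2 * P + σ ^ 2 * P) := by
      have l1 : Integrable fun x => t ^ 2 * χ x ^ 2 + n x ^ 2 := j1.add i2
      have l2 : Integrable fun x => t ^ 2 * χ x ^ 2 + n x ^ 2 + d ^ 2 * q' x ^ 2 := l1.add j3
      rw [integral_const_mul, integral_add l2 j4, integral_add l1 j3, integral_add j1 i2,
        integral_const_mul, integral_const_mul, integral_const_mul]
    have e2 : ∫ x, u x ^ 2 ≤
        ∫ x, 4 * (t ^ 2 * χ x ^ 2 + n x ^ 2 + d ^ 2 * q' x ^ 2 + σ ^ 2 * q' x ^ 2) := by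
      refine integral_mono hu.integrable_sq ((((j1.add i2).add j3).add j4).const_mul 4) fun x => ?_
      simp only
      rw [hu_eq x]
      have := sq_abs (q' x)
      nlinarith [sq_nonneg (t * χ x - n x), sq_nonneg (t * χ x + d * q' x),
        sq_nonneg (t * χ x - σ * |q' x|), sq_nonneg (n x + d * q' x),
        sq_nonneg (n x - σ * |q' x|), sq_nonneg (d * q' x + σ * |q' x|)]
    rw [e1] at e2
    have := mul_le_mul_of_nonneg_left hχK (sq_nonneg t)
    linarith
  set R := K + 2 + 4 * K ^ 3 / k ^ 2 with hR
  have hR0 : 0 < R := by positivity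
  have hfin : ∫ x, u x ^ 2 ≤ 4 * R * (t ^ 2 + N) := by
    have h1 : t ^ 2 * K + N + d ^ 2 * P + σ ^ 2 * P ≤ R * (t ^ 2 + N) := by
      rw [hR]
      have : 0 ≤ K * N := by positivity
      have := sq_nonneg t
      linarith
    linarith
  have hlow : κ * (t ^ 2 + N) ≤ ∫ x, (u' x ^ 2 + V x * u x ^ 2) := by
    have h1 : κ * t ^ 2 ≤ t ^ 2 * δ := by
      rw [mul_comm]
      exact mul_le_mul_of_nonneg_left (hκk.trans hδ) (sq_nonneg t)
    linarith
  refine le_trans ?_ hlow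
  calc κ / (4 * R) * ∫ x, u x ^ 2 ≤ κ / (4 * R) * (4 * R * (t ^ 2 + N)) :=
        mul_le_mul_of_nonneg_left hfin (by positivity)
    _ = κ * (t ^ 2 + N) := by
        rw [← mul_assoc, div_mul_cancel₀ κ (mul_pos four_pos hR0).ne']

/-- The `H¹` version of `LinearizedWave.coercive`. -/
theorem coercive_h1 {κ : ℝ} (hκ : 0 < κ) {u u' : ℝ → ℝ} (hu : MemLp u 2 volume)
    (hu' : MemLp u' 2 volume)
    (hb : κ * ∫ x, u x ^ 2 ≤ ∫ x, (u' x ^ 2 + V x * u x ^ 2)) :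
    κ / (κ + 1 + A) * ((∫ x, u x ^ 2) + ∫ x, u' x ^ 2) ≤ ∫ x, (u' x ^ 2 + V x * u x ^ 2) := by
  have hA : 0 ≤ A := (abs_nonneg _).trans (W.V_le 0)
  have i1 := hu.integrable_sq
  have i2 := hu'.integrable_sq
  have i3 : Integrable fun x => V x * u x ^ 2 :=
    i1.bdd_mul W.V_cont.aestronglyMeasurable (ae_of_all _ W.V_le)
  have h1 : ∫ x, (u' x ^ 2 + V x * u x ^ 2) = (∫ x, u' x ^ 2) + ∫ x, V x * u x ^ 2 :=
    integral_add i2 i3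
  have h2 : -(A * ∫ x, u x ^ 2) ≤ ∫ x, V x * u x ^ 2 := by
    rw [← integral_const_mul, ← integral_neg]
    refine integral_mono (i1.const_mul A).neg i3 fun x => ?_
    have := mul_le_mul_of_nonneg_right (abs_le.1 (W.V_le x)).1 (sq_nonneg (u x))
    simp only
    linarith
  have h0 : 0 ≤ ∫ x, u x ^ 2 := integral_nonneg fun x => sq_nonneg _
  rw [div_mul_eq_mul_div, div_le_iff₀ (by positivity)]
  set a := ∫ x, u x ^ 2
  set b := ∫ x, u' x ^ 2
  set F := ∫ x, (u' x ^ 2 + V x * u x ^ 2)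
  have h3 : b ≤ F + A * a := by linarith
  have h4 : κ * b ≤ κ * F + A * F := by
    have := mul_le_mul_of_nonneg_left h3 hκ.le
    have := mul_le_mul_of_nonneg_left hb hA
    linarith
  linarith

end LinearizedWave

/-! ### Bounds uniform in the speed -/

section Family

variable {f : ℝ → ℝ} {I₀ I : Set ℝ} {Q : ℝ → ℝ → ℝ}

/-- The derivative of the momentum with respect to the speed. -/
theorem IsSolitaryWaveFamily.deriv_momentum (hf : IsNonlinearity f)
    (hQ : IsSolitaryWaveFamily f I₀ Q) {c : ℝ} (hc : c ∈ I₀) :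
    deriv (fun c' => momentum (Q c')) c = ∫ x, Q c x * speedDeriv Q c x := by
  obtain ⟨ε, hε, hball⟩ := Metric.nhds_basis_closedBall.mem_iff.1 (hQ.isOpen.mem_nhds hc)
  obtain ⟨ν, A, X, U⟩ := hQ.exists_uniformBounds hf (isCompact_closedBall c ε) hball
  have hcont : ∀ c' ∈ I₀, Continuous (Q c') := fun c' hc' => (hQ.isSolitaryWave c' hc').continuous
  have hcball : c ∈ Metric.closedBall c ε := Metric.mem_closedBall_self hε.le
  have key := hasDerivAt_integral_of_dominated_loc_of_deriv_le (μ := volume) (x₀ := c)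
    (s := Metric.closedBall c ε) (F := fun c' x => Q c' x ^ 2)
    (F' := fun c' x => 2 * (Q c' x * speedDeriv Q c' x))
    (bound := fun x => 2 * (A * A * Real.exp (-(ν * |x|)))) (Metric.closedBall_mem_nhds c hε)
    (by
      filter_upwards [hQ.isOpen.mem_nhds hc] with c' hc'
      exact ((hcont c' hc').pow 2).aestronglyMeasurable)
    (memLp_of_exp_decay U.ν_pos (hcont c hc) (U.wave c hcball)).integrable_sq
    ((((hcont c hc).mul (continuous_slice hQ.continuousOn_speedDeriv hc)).const_mul
      2).aestronglyMeasurable)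
    (ae_of_all _ fun x c' hc' => by
      rw [Real.norm_eq_abs, abs_mul, abs_two]
      exact mul_le_mul_of_nonneg_left
        (mul_exp_decay U.ν_pos (U.wave c' hc') (U.speed c' hc') x) two_pos.le)
    (((integrable_exp_neg_abs U.ν_pos).const_mul _).const_mul _)
    (ae_of_all _ fun x c' hc' => by
      refine ((hQ.hasDerivAt_speed (hball hc') x).fun_pow 2).congr_deriv ?_
      simp only [Nat.cast_ofNat, Nat.add_one_sub_one, pow_one]
      ring)
  have h1 := (key.2.const_mul (1 / 2 : ℝ)).deriv
  rw [integral_const_mul] at h1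
  have h2 : (fun c' => momentum (Q c')) = fun c' => 1 / 2 * ∫ x, Q c' x ^ 2 := rfl
  rw [h2, h1]
  ring

/-- On a compact set of speeds with increasing momentum, the wave functions satisfy uniform bounds,
and the integrals that enter the coercivity estimates are bounded below. -/
theorem IsSolitaryWaveFamily.exists_linearizedWave (hf : IsNonlinearity f)
    (hQ : IsSolitaryWaveFamily f I₀ Q) (hI : IsCompact I) (hII₀ : I ⊆ I₀)
    (hδ : ∀ c ∈ I, 0 < deriv (fun c' => momentum (Q c')) c) :
    ∃ ν A X k₀ k₁ k, 0 < k ∧ ∀ c ∈ I,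
      LinearizedWave (Q c) (deriv (Q c)) (fun x => c * Q c x - f (Q c x)) (speedDeriv Q c)
        (speedDerivOne f Q c) (fun x => c - deriv f (Q c x)) ν A X k₀ k₁ ∧
      k ≤ (∫ x, Q c x * speedDeriv Q c x) ∧ k ≤ |∫ x, speedDeriv Q c x| ∧
      k ≤ (∫ x, |deriv (Q c) x| * Q c x) ∧ k ≤ (∫ x, deriv (Q c) x ^ 2) ∧
      k ≤ ∫ x, Q c x ^ 2 := by
  obtain ⟨ν, A, X, U⟩ := hQ.exists_uniformBounds hf hI hII₀
  obtain ⟨k₀, k₁, hk₀, hk₁, hk⟩ := hQ.exists_slope_bounds hf hI hII₀ X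
  have hW := fun c (hc : c ∈ I) => U.linearizedWave hf hQ hII₀ hk₀ hk₁ hk hc
  have hsub : I ×ˢ (univ : Set ℝ) ⊆ I₀ ×ˢ univ := prod_mono hII₀ subset_rfl
  have c0 := hQ.continuousOn.mono hsub
  have c1 := hQ.continuousOn_deriv.mono hsub
  have c2 := hQ.continuousOn_speedDeriv.mono hsub
  obtain ⟨a₁, p₁, b₁⟩ := exists_pos_le_of_compact hI
    (continuousOn_integral_of_exp_decay (F := fun c x => Q c x * speedDeriv Q c x) U.ν_pos
      (c0.mul c2) fun c hc => mul_exp_decay U.ν_pos (U.wave c hc) (U.speed c hc))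
    fun c hc => by
      rw [← hQ.deriv_momentum hf (hII₀ hc)]
      exact hδ c hc
  obtain ⟨a₂, p₂, b₂⟩ := exists_pos_le_of_compact hI
    (continuousOn_integral_of_exp_decay (F := speedDeriv Q) U.ν_pos c2 U.speed).abs
    fun c hc => abs_pos.2 (hQ.integral_ne_zero c (hII₀ hc))
  have hne : ∀ c ∈ I, deriv (Q c) 1 ≠ 0 := fun c hc => ((hW c hc).q'_neg 1 one_pos).ne
  obtain ⟨a₃, p₃, b₃⟩ := exists_pos_le_of_compact hI
    (continuousOn_integral_of_exp_decay (F := fun c x => |deriv (Q c) x| * Q c x) U.ν_pos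
      (c1.abs.mul c0) fun c hc => mul_exp_decay U.ν_pos
        (fun x => by rw [abs_abs]; exact U.wave_deriv c hc x) (U.wave c hc))
    fun c hc => integral_pos_of_continuous (x₀ := 1) ((hW c hc).q'_cont.abs.mul (hW c hc).q_cont)
      (memLp_mul_integrable (hW c hc).q'_L2.norm (hW c hc).q_L2)
      (fun x => mul_nonneg (abs_nonneg _) ((hW c hc).q_pos x).le)
      (mul_pos (abs_pos.2 (hne c hc)) ((hW c hc).q_pos 1))
  obtain ⟨a₄, p₄, b₄⟩ := exists_pos_le_of_compact hI
    (continuousOn_integral_of_exp_decay (F := fun c x => deriv (Q c) x ^ 2) (A := A * A) U.ν_pos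
      (c1.pow 2) fun c hc x => by
        rw [sq]
        exact mul_exp_decay U.ν_pos (U.wave_deriv c hc) (U.wave_deriv c hc) x)
    fun c hc => integral_pos_of_continuous (x₀ := 1) ((hW c hc).q'_cont.pow 2)
      (hW c hc).q'_L2.integrable_sq (fun x => sq_nonneg _) (sq_pos_of_ne_zero (hne c hc))
  obtain ⟨a₅, p₅, b₅⟩ := exists_pos_le_of_compact hI
    (continuousOn_integral_of_exp_decay (F := fun c x => Q c x ^ 2) (A := A * A) U.ν_pos
      (c0.pow 2) fun c hc x => by
        rw [sq]
        exact mul_exp_decay U.ν_pos (U.wave c hc) (U.wave c hc) x)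
    fun c hc => integral_pos_of_continuous (x₀ := 1) ((hW c hc).q_cont.pow 2)
      (hW c hc).q_L2.integrable_sq (fun x => sq_nonneg _) (pow_pos ((hW c hc).q_pos 1) 2)
  refine ⟨ν, A, X, k₀, k₁, min a₁ (min a₂ (min a₃ (min a₄ a₅))), by positivity,
    fun c hc => ⟨hW c hc, ?_, ?_, ?_, ?_, ?_⟩⟩
  · exact (min_le_left _ _).trans (b₁ c hc)
  · exact (min_le_right _ _).trans ((min_le_left _ _).trans (b₂ c hc))
  · exact (min_le_right _ _).trans ((min_le_right _ _).trans ((min_le_left _ _).trans (b₃ c hc)))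
  · exact (min_le_right _ _).trans ((min_le_right _ _).trans ((min_le_right _ _).trans
      ((min_le_left _ _).trans (b₄ c hc))))
  · exact (min_le_right _ _).trans ((min_le_right _ _).trans ((min_le_right _ _).trans
      ((min_le_right _ _).trans (b₅ c hc))))

end Family

/-! ### The resolvent applied to an exponentially decaying function -/

theorem expMass_eq {ν : ℝ} (hν : 0 < ν) : expMass ν = 2 / ν := by
  rw [expMass, integral_comp_abs (f := fun x => Real.exp (-(ν * x)))]
  have := integral_exp_mul_Ioi (neg_lt_zero.2 hν) 0
  simp only [neg_mul, mul_zero, Real.exp_zero] at this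
  rw [this]
  field_simp

theorem abs_setIntegral_le_integral {u g : ℝ → ℝ} {s : Set ℝ} (hs : MeasurableSet s)
    (hg : Integrable g) (h0 : ∀ y, 0 ≤ g y) (h : ∀ y ∈ s, |u y| ≤ g y) :
    |∫ y in s, u y| ≤ ∫ y, g y :=
  (norm_integral_le_of_norm_le (f := u) hg.integrableOn
    ((ae_restrict_iff' hs).2 (ae_of_all _ h))).trans
    (setIntegral_le_integral hg (ae_of_all _ h0))

section Resolvent

variable {χ : ℝ → ℝ} {ν A α : ℝ}

/-- The integrand of the resolvent, bounded by a fixed integrable function times the decay of the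
resolvent. -/
theorem resolvent_integrand_le (hα : 0 < α) (hαν : α ≤ ν / 2)
    (h : ∀ x, |χ x| ≤ A * Real.exp (-(ν * |x|))) {x y : ℝ} (hy : y ≤ x) :
    |χ y * Real.exp (α * (y - x))| ≤
      A * Real.exp (-(α * |x|)) * Real.exp (-(ν / 2 * |y|)) := by
  have hA : 0 ≤ A := by simpa using (abs_nonneg _).trans (h 0)
  rw [abs_mul, abs_of_pos (Real.exp_pos _)]
  refine (mul_le_mul_of_nonneg_right (h y) (Real.exp_pos _).le).trans ?_
  rw [mul_assoc, mul_assoc, ← Real.exp_add, ← Real.exp_add]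
  refine mul_le_mul_of_nonneg_left (Real.exp_le_exp.2 ?_) hA
  rcases le_total 0 x with hx | hx
  · rw [abs_of_nonneg hx]
    have h1 := mul_le_mul_of_nonneg_left (le_abs_self y) hα.le
    have h2 := mul_le_mul_of_nonneg_right hαν (abs_nonneg y)
    linarith
  · rw [abs_of_nonpos hx, abs_of_nonpos (hy.trans hx)]
    have h1 := mul_le_mul_of_nonneg_left hy (by linarith : (0 : ℝ) ≤ α + ν / 2)
    have h2 := mul_le_mul_of_nonpos_right hαν hx
    linarith

theorem integrable_weighted (hα : 0 < α) (hαν : α ≤ ν / 2) (hχ : Continuous χ)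
    (h : ∀ x, |χ x| ≤ A * Real.exp (-(ν * |x|))) : Integrable fun y => χ y * Real.exp (α * y) := by
  have hν : 0 < ν / 2 := hα.trans_le hαν
  have hA : 0 ≤ A := by simpa using (abs_nonneg _).trans (h 0)
  refine integrable_of_exp_decay (A := A) hν (by fun_prop) fun y => ?_
  rw [abs_mul, abs_of_pos (Real.exp_pos _)]
  refine (mul_le_mul_of_nonneg_right (h y) (Real.exp_pos _).le).trans ?_
  rw [mul_assoc, ← Real.exp_add]
  refine mul_le_mul_of_nonneg_left (Real.exp_le_exp.2 ?_) hA
  have h1 := mul_le_mul_of_nonneg_left (le_abs_self y) hα.le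
  have h2 := mul_le_mul_of_nonneg_right hαν (abs_nonneg y)
  linarith

theorem opResolvent_eq (χ : ℝ → ℝ) (α x : ℝ) :
    opResolvent α χ x = Real.exp (-(α * x)) * ∫ y in Iic x, χ y * Real.exp (α * y) := by
  rw [opResolvent, ← integral_const_mul]
  congr 1
  ext y
  rw [mul_sub, sub_eq_add_neg, Real.exp_add]
  ring

/-- The resolvent solves `w' + α w = χ`. -/
theorem hasDerivAt_opResolvent (hα : 0 < α) (hαν : α ≤ ν / 2) (hχ : Continuous χ)
    (h : ∀ x, |χ x| ≤ A * Real.exp (-(ν * |x|))) (x : ℝ) :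
    HasDerivAt (opResolvent α χ) (χ x - α * opResolvent α χ x) x := by
  have hi := integrable_weighted hα hαν hχ h
  have hg : Continuous fun y => χ y * Real.exp (α * y) := by fun_prop
  have h1 : HasDerivAt (fun x => ∫ y in Iic x, χ y * Real.exp (α * y))
      (χ x * Real.exp (α * x)) x := by
    have e : (fun x => ∫ y in Iic x, χ y * Real.exp (α * y)) = fun x =>
        (∫ y in Iic (0 : ℝ), χ y * Real.exp (α * y)) + ∫ y in (0 : ℝ)..x, χ y * Real.exp (α * y) := by
      ext x
      rw [← intervalIntegral.integral_Iic_sub_Iic hi.integrableOn hi.integrableOn, add_sub_cancel]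
    rw [e]
    exact (hg.integral_hasStrictDerivAt 0 x).hasDerivAt.const_add _
  have h2 : HasDerivAt (fun x : ℝ => Real.exp (-(α * x))) (Real.exp (-(α * x)) * -α) x :=
    (((hasDerivAt_id x).const_mul α).fun_neg.congr_deriv (by rw [mul_one])).exp
  have e : opResolvent α χ = fun x =>
      Real.exp (-(α * x)) * ∫ y in Iic x, χ y * Real.exp (α * y) := by
    ext x
    exact opResolvent_eq χ α x
  rw [e]
  refine (h2.mul h1).congr_deriv ?_
  have : Real.exp (-(α * x)) * (χ x * Real.exp (α * x)) = χ x := by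
    rw [mul_left_comm, ← Real.exp_add, neg_add_cancel, Real.exp_zero, mul_one]
  rw [this]
  ring

theorem abs_opResolvent_le (hα : 0 < α) (hαν : α ≤ ν / 2)
    (h : ∀ x, |χ x| ≤ A * Real.exp (-(ν * |x|))) (x : ℝ) :
    |opResolvent α χ x| ≤ A * expMass (ν / 2) * Real.exp (-(α * |x|)) := by
  have hν : 0 < ν / 2 := hα.trans_le hαν
  have hA : 0 ≤ A := by simpa using (abs_nonneg _).trans (h 0)
  have hi := (integrable_exp_neg_abs hν).const_mul (A * Real.exp (-(α * |x|)))
  refine (abs_setIntegral_le_integral measurableSet_Iic hi (fun y => by positivity)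
    fun y hy => resolvent_integrand_le hα hαν h hy).trans_eq ?_
  rw [integral_const_mul, expMass]
  ring

theorem exp_bound_mul_le {t : ℝ} (ht : 0 ≤ t) {β y : ℝ} (hβ : 0 < β) (htβ : t ≤ β) :
    |Real.exp (t * y) - 1| ≤ t * (1 / β * Real.exp (2 * β * |y|)) := by
  have h1 : |Real.exp (t * y) - 1| ≤ t * |y| * Real.exp (t * |y|) := by
    rcases le_total 0 y with hy | hy
    · rw [abs_of_nonneg hy, abs_of_nonneg (sub_nonneg.2 (Real.one_le_exp (mul_nonneg ht hy)))]
      have h2 := Real.add_one_le_exp (-(t * y))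
      have h3 := mul_le_mul_of_nonneg_right h2 (Real.exp_pos (t * y)).le
      rw [← Real.exp_add, neg_add_cancel, Real.exp_zero] at h3
      linarith
    · rw [abs_of_nonpos hy, abs_of_nonpos (sub_nonpos.2 (Real.exp_le_one_iff.2
        (mul_nonpos_of_nonneg_of_nonpos ht hy)))]
      have h2 := Real.add_one_le_exp (t * y)
      have h4 : 0 ≤ t * -y := mul_nonneg ht (neg_nonneg.2 hy)
      have h3 := le_mul_of_one_le_right h4 (Real.one_le_exp h4)
      linarith
  have h2 : β * |y| ≤ Real.exp (β * |y|) := by linarith [Real.add_one_le_exp (β * |y|)]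
  have h3 : Real.exp (t * |y|) ≤ Real.exp (β * |y|) :=
    Real.exp_le_exp.2 (mul_le_mul_of_nonneg_right htβ (abs_nonneg y))
  have h4 : |y| ≤ 1 / β * Real.exp (β * |y|) := by
    rw [one_div, ← div_eq_inv_mul, le_div_iff₀ hβ]
    linarith
  calc |Real.exp (t * y) - 1| ≤ t * (|y| * Real.exp (t * |y|)) := by rw [← mul_assoc]; exact h1
    _ ≤ t * ((1 / β * Real.exp (β * |y|)) * Real.exp (β * |y|)) := by gcongr
    _ = t * (1 / β * Real.exp (2 * β * |y|)) := by
        rw [mul_assoc (1 / β), ← Real.exp_add]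
        ring_nf

/-- Far to the right the resolvent is close to `e^{-αx}` times the total mass of `χ`. -/
theorem abs_weighted_sub_le (hα : 0 < α) (hαν : α ≤ ν / 4) (hχ : Continuous χ)
    (h : ∀ x, |χ x| ≤ A * Real.exp (-(ν * |x|))) (x : ℝ) :
    |(∫ y in Iic x, χ y * Real.exp (α * y)) - ∫ y, χ y| ≤
      α * (A * (4 / ν) * expMass (ν / 2)) + A * expMass (ν / 2) * Real.exp (-(ν / 2 * x)) := by
  have hν : 0 < ν := by linarith
  have hA : 0 ≤ A := by simpa using (abs_nonneg _).trans (h 0)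
  have i1 := integrable_weighted hα (hαν.trans (by linarith)) hχ h
  have i2 := integrable_of_exp_decay hν hχ h
  have i3 := integrable_exp_neg_abs (half_pos hν)
  have e1 : (∫ y in Iic x, χ y * Real.exp (α * y)) - ∫ y, χ y =
      (∫ y in Iic x, χ y * (Real.exp (α * y) - 1)) - ∫ y in Ioi x, χ y := by
    rw [← intervalIntegral.integral_Iic_add_Ioi i2.integrableOn i2.integrableOn (b := x),
      sub_add_eq_sub_sub, ← integral_sub i1.integrableOn i2.integrableOn]
    congr 2
    ext y
    ring
  rw [e1]
  refine (abs_sub _ _).trans (add_le_add ?_ ?_)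
  · have hb : ∀ y, |χ y * (Real.exp (α * y) - 1)| ≤
        α * (A * (4 / ν)) * Real.exp (-(ν / 2 * |y|)) := fun y => by
      rw [abs_mul]
      refine (mul_le_mul (h y) (exp_bound_mul_le hα.le (by linarith : (0 : ℝ) < ν / 4) hαν)
        (abs_nonneg _) (by positivity)).trans_eq ?_
      have : Real.exp (-(ν / 2 * |y|)) = Real.exp (-(ν * |y|)) * Real.exp (2 * (ν / 4) * |y|) := by
        rw [← Real.exp_add]
        ring_nf
      rw [this]
      field_simp
    have i4 := i3.const_mul (α * (A * (4 / ν)))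
    refine (abs_setIntegral_le_integral measurableSet_Iic i4 (fun y => by positivity)
      fun y _ => hb y).trans_eq ?_
    rw [integral_const_mul, expMass]
    ring
  · have i4 := i3.const_mul (A * Real.exp (-(ν / 2 * x)))
    refine (abs_setIntegral_le_integral measurableSet_Ioi i4 (fun y => by positivity)
      fun y hy => ?_).trans_eq ?_
    · refine (h y).trans ?_
      rw [mul_assoc, ← Real.exp_add]
      refine mul_le_mul_of_nonneg_left (Real.exp_le_exp.2 ?_) hA
      have h1 : x ≤ |y| := (mem_Ioi.1 hy).le.trans (le_abs_self y)
      have := mul_le_mul_of_nonneg_left h1 (half_pos hν).le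
      linarith
    · rw [integral_const_mul, expMass]
      ring

theorem opResolvent_memLp (hα : 0 < α) (hαν : α ≤ ν / 2) (hχ : Continuous χ)
    (h : ∀ x, |χ x| ≤ A * Real.exp (-(ν * |x|))) : MemLp (opResolvent α χ) 2 volume :=
  memLp_of_exp_decay hα (continuous_iff_continuousAt.2 fun x =>
    (hasDerivAt_opResolvent hα hαν hχ h x).continuousAt) (abs_opResolvent_le hα hαν h)

/-- The resolvent is bounded, uniformly in `α`, by a multiple of `e^{-α|x|}`. -/
theorem integral_opResolvent_sq_le (hα : 0 < α) (hαν : α ≤ ν / 2)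
    (h : ∀ x, |χ x| ≤ A * Real.exp (-(ν * |x|))) :
    ∫ x, opResolvent α χ x ^ 2 ≤ (A * expMass (ν / 2)) ^ 2 / α := by
  have h2α : 0 < 2 * α := by linarith
  have h1 := abs_integral_le_expMass (u := fun x => opResolvent α χ x ^ 2)
    (A := (A * expMass (ν / 2)) ^ 2) h2α fun x => by
      rw [abs_pow]
      refine (pow_le_pow_left₀ (abs_nonneg _) (abs_opResolvent_le hα hαν h x) 2).trans_eq ?_
      rw [mul_pow, ← Real.exp_nat_mul]
      congr 2
      push_cast
      ring
  rw [expMass_eq h2α] at h1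
  refine ((le_abs_self _).trans h1).trans_eq ?_
  field_simp

/-- The square of the resolvent has an integral of the order `1/α`, because the resolvent decays
only at the rate `α` on the right if the mass of `χ` does not vanish. -/
theorem le_integral_opResolvent_sq {k R : ℝ} (hα : 0 < α) (hα1 : α ≤ 1) (hαν : α ≤ ν / 4)
    (hχ : Continuous χ) (h : ∀ x, |χ x| ≤ A * Real.exp (-(ν * |x|))) (hk : 0 < k)
    (hm : k ≤ |∫ x, χ x|) (hR : 0 ≤ R) (hαk : α * (A * (4 / ν) * expMass (ν / 2)) ≤ k / 4)
    (hRk : A * expMass (ν / 2) * Real.exp (-(ν / 2 * R)) ≤ k / 4) :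
    k ^ 2 / 8 * Real.exp (-(2 * R)) / α ≤ ∫ x, opResolvent α χ x ^ 2 := by
  have hν : 0 < ν := by linarith
  have hA : 0 ≤ A := by simpa using (abs_nonneg _).trans (h 0)
  have hL := (opResolvent_memLp hα (hαν.trans (by linarith)) hχ h).integrable_sq
  have h2α : -(2 * α) < 0 := by linarith
  have hi : IntegrableOn (fun x => (k / 2) ^ 2 * Real.exp (-(2 * α) * x)) (Ioi R) :=
    (integrableOn_exp_mul_Ioi h2α R).const_mul _
  have h1 : ∫ x in Ioi R, (k / 2) ^ 2 * Real.exp (-(2 * α) * x) ≤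
      ∫ x in Ioi R, opResolvent α χ x ^ 2 := by
    refine setIntegral_mono_on hi hL.integrableOn measurableSet_Ioi fun x hx => ?_
    have hx0 : R ≤ x := (mem_Ioi.1 hx).le
    have h2 := abs_weighted_sub_le hα hαν hχ h x
    have h3 : A * expMass (ν / 2) * Real.exp (-(ν / 2 * x)) ≤ k / 4 := by
      refine le_trans (mul_le_mul_of_nonneg_left (Real.exp_le_exp.2 ?_)
        (mul_nonneg hA (expMass_nonneg _))) hRk
      have := mul_le_mul_of_nonneg_left hx0 (half_pos hν).le
      linarith
    have h4 : k / 2 ≤ |∫ y in Iic x, χ y * Real.exp (α * y)| := by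
      have := abs_sub_abs_le_abs_sub (∫ y, χ y) (∫ y in Iic x, χ y * Real.exp (α * y))
      rw [abs_sub_comm] at this
      linarith
    rw [opResolvent_eq, mul_pow, ← Real.exp_nat_mul, ← sq_abs (∫ y in Iic x, _), mul_comm]
    have e : ((2 : ℕ) : ℝ) * -(α * x) = -(2 * α) * x := by push_cast; ring
    rw [e]
    exact mul_le_mul_of_nonneg_left (pow_le_pow_left₀ (half_pos hk).le h4 2) (Real.exp_pos _).le
  have h2 := setIntegral_le_integral (s := Ioi R) hL (ae_of_all _ fun x => sq_nonneg _)
  have h3 : ∫ x in Ioi R, (k / 2) ^ 2 * Real.exp (-(2 * α) * x) =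
      k ^ 2 / 8 * Real.exp (-(2 * α) * R) / α := by
    rw [integral_const_mul, integral_exp_mul_Ioi h2α]
    field_simp
    norm_num
  refine le_trans ?_ (h3.symm.le.trans (h1.trans h2))
  gcongr
  have := mul_le_mul_of_nonneg_right hα1 hR
  linarith

theorem abs_integral_opResolvent_mul_le {q : ℝ → ℝ} (hα : 0 < α) (hαν : α ≤ ν / 2)
    (h : ∀ x, |χ x| ≤ A * Real.exp (-(ν * |x|))) (hq : ∀ x, |q x| ≤ A * Real.exp (-(ν * |x|))) :
    |∫ x, opResolvent α χ x * q x| ≤ A * expMass (ν / 2) * A * expMass ν := by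
  have hν : 0 < ν := by linarith
  have hA : 0 ≤ A := by simpa using (abs_nonneg _).trans (h 0)
  refine abs_integral_le_expMass hν fun x => ?_
  rw [abs_mul, mul_assoc]
  refine mul_le_mul ((abs_opResolvent_le hα hαν h x).trans (mul_le_of_le_one_right
    (mul_nonneg hA (expMass_nonneg _)) (Real.exp_le_one_iff.2 ?_))) (hq x) (abs_nonneg _)
    (mul_nonneg hA (expMass_nonneg _))
  exact neg_nonpos.2 (mul_nonneg hα.le (abs_nonneg x))

/-- The pairing of the resolvent with the derivative of a function. -/
theorem integral_deriv_mul_opResolvent {q q' : ℝ → ℝ} (hα : 0 < α) (hαν : α ≤ ν / 2)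
    (hχ : Continuous χ) (h : ∀ x, |χ x| ≤ A * Real.exp (-(ν * |x|)))
    (hq : ∀ x, HasDerivAt q (q' x) x) (hqL : MemLp q 2 volume) (hq'L : MemLp q' 2 volume) :
    ∫ x, q' x * opResolvent α χ x = α * (∫ x, opResolvent α χ x * q x) - ∫ x, q x * χ x := by
  have hν : 0 < ν := by linarith
  have hw := opResolvent_memLp hα hαν hχ h
  have hχL := memLp_of_exp_decay hν hχ h
  have hw' : MemLp (fun x => χ x - α * opResolvent α χ x) 2 volume := hχL.sub (hw.const_mul α)
  have h1 := integral_mul_deriv_eq_deriv_mul_of_integrable (u := opResolvent α χ) (v := q)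
    (fun x _ => hasDerivAt_opResolvent hα hαν hχ h x) (fun x _ => hq x)
    (memLp_mul_integrable hw hq'L) (memLp_mul_integrable hw' hqL) (memLp_mul_integrable hw hqL)
  have i1 := memLp_mul_integrable hqL hχL
  have i2 := (memLp_mul_integrable hw hqL).const_mul α
  have e1 : ∫ x, (χ x - α * opResolvent α χ x) * q x =
      (∫ x, q x * χ x) - α * ∫ x, opResolvent α χ x * q x := by
    rw [← integral_const_mul, ← integral_sub i1 i2]
    congr 1
    ext x
    ring
  have e2 : ∫ x, q' x * opResolvent α χ x = ∫ x, opResolvent α χ x * q' x := by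
    congr 1
    ext x
    ring
  rw [e2, h1, e1]
  ring

end Resolvent

/-! ### Translations and the constraint -/

theorem memLp_comp_add {u : ℝ → ℝ} (hu : MemLp u 2 volume) (a : ℝ) :
    MemLp (fun x => u (x + a)) 2 volume :=
  hu.comp_measurePreserving (measurePreserving_add_right volume a)

theorem memLp_comp_sub {u : ℝ → ℝ} (hu : MemLp u 2 volume) (a : ℝ) :
    MemLp (fun x => u (x - a)) 2 volume := by
  simpa only [sub_eq_add_neg] using memLp_comp_add hu (-a)

theorem HasACDeriv.comp_add {u u' : ℝ → ℝ} (h : HasACDeriv u u') (hu' : MemLp u' 2 volume)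
    (a : ℝ) : HasACDeriv (fun x => u (x + a)) (fun x => u' (x + a)) := by
  have hv : LocallyIntegrable fun x => u' (x + a) :=
    (memLp_comp_add hu' a).locallyIntegrable (by norm_num)
  have h1 := (HasACDeriv.primitive hv).add (HasACDeriv.of_hasDerivAt (u := fun _ => u a) (v := 0)
      (fun x => hasDerivAt_const x _) continuous_const)
  rw [add_zero] at h1
  convert h1 using 1
  ext x
  simp only [Pi.add_apply]
  rw [intervalIntegral.integral_comp_add_right, zero_add, h.integral_eq]
  ring

theorem inner2_comp_sub (u v : ℝ → ℝ) (a : ℝ) :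
    inner2 (fun x => u (x - a)) (fun x => v (x - a)) = inner2 u v :=
  integral_sub_right_eq_self (fun x => u x * v x) a

theorem opResolvent_comp_sub (α : ℝ) (g : ℝ → ℝ) (a : ℝ) :
    opResolvent α (fun x => g (x - a)) = fun x => opResolvent α g (x - a) := by
  ext x
  simp only [opResolvent]
  have h := (measurePreserving_sub_right volume a).setIntegral_preimage_emb
    (MeasurableEquiv.subRight a).measurableEmbedding
    (fun y => g y * Real.exp (α * (y - (x - a)))) (Iic (x - a))
  rw [← h, show (fun y => y - a) ⁻¹' Iic (x - a) = Iic x by ext y; simp]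
  congr 1
  ext y
  congr 3
  ring

theorem opResolvent_smul (α t : ℝ) (g : ℝ → ℝ) : opResolvent α (t • g) = t • opResolvent α g := by
  ext x
  simp only [opResolvent, Pi.smul_apply, smul_eq_mul, mul_assoc, integral_const_mul]

theorem opK_smul (t : ℝ) (g : ℝ → ℝ) : opK (t • g) = t • opK g := by
  ext x
  simp only [opK, Pi.smul_apply, smul_eq_mul, integral_const_mul]

theorem zetaN_eq (Q : ℝ → ℝ → ℝ) (c a : ℝ) : zetaN Q c a = fun x => speedDeriv Q c (x - a) := rfl

theorem zetaTr_eq {Q : ℝ → ℝ → ℝ} {c : ℝ} (h : ∀ x, HasDerivAt (Q c) (deriv (Q c) x) x) (a : ℝ) :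
    zetaTr Q c a = fun x => -deriv (Q c) (x - a) := by
  ext x
  have h1 : HasDerivAt (fun a' => Q c (x - a')) (-deriv (Q c) (x - a)) a :=
    ((h (x - a)).scomp a ((hasDerivAt_id a).const_sub x)).congr_deriv (by simp)
  exact h1.deriv

section Wave

variable {Q : ℝ → ℝ → ℝ} {s χ₁ V : ℝ → ℝ} {c ν A X k₀ k₁ α : ℝ}
variable (W : LinearizedWave (Q c) (deriv (Q c)) s (speedDeriv Q c) χ₁ V ν A X k₀ k₁)
include W

theorem LinearizedWave.opK_zetaTr (a : ℝ) : opK (zetaTr Q c a) = -wave Q c a := by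
  ext x
  have hL := W.q'_cont
  have hi : Integrable fun y => -deriv (Q c) (y - a) :=
    (integrable_of_exp_decay W.ν_pos hL W.q'_decay).neg.comp_sub_right a
  have hd : ∀ y ∈ Iic x, HasDerivAt (fun y => -Q c (y - a)) (-deriv (Q c) (y - a)) y :=
    fun y _ => ((W.q_deriv (y - a)).scomp y ((hasDerivAt_id y).sub_const a)).fun_neg.congr_deriv
      (by simp)
  have h0 := W.tendsto_zero_of_decay (u := fun y => Q c (-y)) fun y => by
    rw [W.q_even]; exact W.q_decay y
  have h1 : Tendsto (fun y => Q c (y - a)) atBot (𝓝 0) := by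
    have := h0.comp (tendsto_neg_atBot_atTop.comp (tendsto_atBot_add_const_right atBot (-a)
      tendsto_id))
    refine this.congr fun y => ?_
    simp [sub_eq_add_neg]
  have := integral_Iic_of_hasDerivAt_of_tendsto' hd hi.integrableOn (by simpa using h1.neg)
  rw [opK, zetaTr_eq W.q_deriv, this]
  simp [wave]

theorem LinearizedWave.inner2_zetaTr_self (a : ℝ) :
    inner2 (zetaTr Q c a) (zetaTr Q c a) = ∫ x, deriv (Q c) x ^ 2 := by
  rw [zetaTr_eq W.q_deriv, inner2_comp_sub (fun x => -deriv (Q c) x) fun x => -deriv (Q c) x]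
  simp only [inner2, neg_mul_neg, sq]

theorem LinearizedWave.inner2_zetaN_zetaTr (a : ℝ) :
    inner2 (zetaN Q c a) (zetaTr Q c a) = 0 := by
  rw [zetaTr_eq W.q_deriv, zetaN_eq, inner2_comp_sub (speedDeriv Q c) fun x => -deriv (Q c) x]
  refine integral_eq_zero_of_odd fun x => ?_
  simp only [W.χ_even, W.q'_odd]
  ring

theorem LinearizedWave.zetaTr_memLp (a : ℝ) : MemLp (zetaTr Q c a) 2 volume := by
  rw [zetaTr_eq W.q_deriv]
  exact (memLp_comp_sub W.q'_L2 a).neg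

/-- The regularized operator maps the translation vector to minus the wave, and acts on the
normalization vector, which is orthogonal to the translation vector, as the resolvent. -/
theorem LinearizedWave.opKα_eq (hp : 0 < ∫ x, deriv (Q c) x ^ 2) (a r t : ℝ) :
    opKα Q c a α (r • zetaTr Q c a + t • zetaN Q c a) =
      (-r) • wave Q c a + t • fun x => opResolvent α (speedDeriv Q c) (x - a) := by
  have hz := W.zetaTr_memLp a
  have hn : MemLp (zetaN Q c a) 2 volume := memLp_comp_sub W.χ_L2 a
  have h1 : inner2 (r • zetaTr Q c a + t • zetaN Q c a) (zetaTr Q c a) =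
      r * inner2 (zetaTr Q c a) (zetaTr Q c a) := by
    have i1 := (memLp_mul_integrable hz hz).const_mul r
    have i2 := (memLp_mul_integrable hn hz).const_mul t
    have e : inner2 (r • zetaTr Q c a + t • zetaN Q c a) (zetaTr Q c a) =
        r * inner2 (zetaTr Q c a) (zetaTr Q c a) + t * inner2 (zetaN Q c a) (zetaTr Q c a) := by
      simp only [inner2]
      rw [← integral_const_mul, ← integral_const_mul, ← integral_add i1 i2]
      congr 1
      ext x
      simp only [Pi.add_apply, Pi.smul_apply, smul_eq_mul]
      ring
    rw [e, W.inner2_zetaN_zetaTr, mul_zero, add_zero]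
  have h2 : projLine (zetaTr Q c a) (r • zetaTr Q c a + t • zetaN Q c a) = r • zetaTr Q c a := by
    rw [projLine, h1, mul_div_cancel_right₀]
    rw [W.inner2_zetaTr_self]
    exact hp.ne'
  rw [opKα, h2, add_sub_cancel_left, opK_smul, opResolvent_smul, W.opK_zetaTr, zetaN_eq,
    opResolvent_comp_sub, smul_neg, neg_smul]

/-- The constraint consists of orthogonality to the wave and to the resolvent of the speed
derivative. -/
theorem LinearizedWave.isSymplOrthogonal_iff (hp : 0 < ∫ x, deriv (Q c) x ^ 2) (hα : 0 < α)
    (hαν : α ≤ ν / 2) (a : ℝ) {ξ : ℝ → ℝ} (hξ : MemLp ξ 2 volume) :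
    IsSymplOrthogonal Q c a α ξ ↔ inner2 ξ (wave Q c a) = 0 ∧
      inner2 ξ (fun x => opResolvent α (speedDeriv Q c) (x - a)) = 0 := by
  have hw := memLp_comp_sub (opResolvent_memLp hα hαν W.χ_cont W.χ_decay) a
  have hq : MemLp (wave Q c a) 2 volume := memLp_comp_sub W.q_L2 a
  have key : ∀ r t : ℝ, inner2 ξ (opKα Q c a α (r • zetaTr Q c a + t • zetaN Q c a)) =
      -r * inner2 ξ (wave Q c a) +
        t * inner2 ξ (fun x => opResolvent α (speedDeriv Q c) (x - a)) := by
    intro r t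
    have i1 := (memLp_mul_integrable hξ hq).const_mul (-r)
    have i2 := (memLp_mul_integrable hξ hw).const_mul t
    rw [W.opKα_eq hp]
    simp only [inner2]
    rw [← integral_const_mul, ← integral_const_mul, ← integral_add i1 i2]
    congr 1
    ext x
    simp only [Pi.add_apply, Pi.smul_apply, smul_eq_mul]
    ring
  constructor
  · intro h
    have h1 := h (zetaTr Q c a) (Submodule.subset_span (by simp))
    have h2 := h (zetaN Q c a) (Submodule.subset_span (by simp))
    have k1 := key 1 0
    have k2 := key 0 1
    simp only [one_smul, zero_smul, add_zero, zero_add] at k1 k2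
    rw [h1] at k1
    rw [h2] at k2
    constructor <;> linarith
  · rintro ⟨h1, h2⟩ v hv
    obtain ⟨r, t, rfl⟩ := Submodule.mem_span_pair.1 hv
    rw [key, h1, h2]
    ring

end Wave

/-- Coercivity of the Hessian in `H¹` on the orthogonal complement of the wave and its derivative,
with a constant that depends only on the constants of the bounds. -/
theorem LinearizedWave.exists_coercive {ν A X k₀ k₁ k : ℝ} (hk : 0 < k) : ∃ κ, 0 < κ ∧
    ∀ {q q' s χ χ₁ V : ℝ → ℝ}, LinearizedWave q q' s χ χ₁ V ν A X k₀ k₁ →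
      k ≤ (∫ x, q x * χ x) → k ≤ (∫ x, |q' x| * q x) → k ≤ (∫ x, q' x ^ 2) →
      ∀ {u u' : ℝ → ℝ}, HasACDeriv u u' → MemLp u 2 volume → MemLp u' 2 volume →
      (∫ x, u x * q x = 0) → (∫ x, u x * q' x = 0) →
      κ * ((∫ x, u x ^ 2) + ∫ x, u' x ^ 2) ≤ ∫ x, (u' x ^ 2 + V x * u x ^ 2) := by
  by_cases hW : ∃ q q' s χ χ₁ V : ℝ → ℝ, LinearizedWave q q' s χ χ₁ V ν A X k₀ k₁
  swap
  · exact ⟨1, one_pos, fun {q q' s χ χ₁ V} W => (hW ⟨q, q', s, χ, χ₁, V, W⟩).elim⟩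
  obtain ⟨q, q', s, χ, χ₁, V, W⟩ := hW
  have hν := W.ν_pos
  have hX := W.X_pos
  have hk₀ := W.k₀_pos
  have hk₁ := W.k₁_pos
  have hA : 0 ≤ A := (abs_nonneg _).trans (W.V_le 0)
  clear W
  set K := max 1 (A * A * expMass ν) with hK
  have hK1 : 1 ≤ K := le_max_left _ _
  have hK0 : 0 < K := one_pos.trans_le hK1
  set κ := min (min (2 * k₀ ^ 4 / (k₁ ^ 4 * X ^ 2)) (ν ^ 2)) k with hκ
  have hκ0 : 0 < κ := by positivity
  set κ' := κ / (4 * (K + 2 + 4 * K ^ 3 / k ^ 2)) with hκ'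
  have hκ'0 : 0 < κ' := by positivity
  refine ⟨κ' / (κ' + 1 + A), by positivity, fun {q q' s χ χ₁ V} W hδ hm hp u u' h hu hu' huq huq' =>
    W.coercive_h1 hκ'0 hu hu' ?_⟩
  have sqK : ∀ {g : ℝ → ℝ}, (∀ x, |g x| ≤ A * Real.exp (-(ν * |x|))) → ∫ x, g x ^ 2 ≤ K := by
    intro g hg
    have := (le_abs_self _).trans (integral_mul_le_expMass hν hg hg)
    simp only [← sq] at this
    exact (this.trans_eq (by ring)).trans (le_max_right _ _)
  exact W.coercive hκ0 ((min_le_left _ _).trans (min_le_left _ _))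
    ((min_le_left _ _).trans (min_le_right _ _)) hk hK1 (min_le_right _ _) hδ
    (((le_abs_self _).trans (integral_mul_le_expMass hν W.q_decay W.χ_decay)).trans
      (le_max_right _ _)) hm (hk.trans_le hp) (sqK W.q'_decay) (sqK W.q_decay) (sqK W.χ_decay)
    h hu hu' huq huq'

/-! ### The Hessian as an anisotropic form -/

theorem HasACDeriv.comp_sub {u u' : ℝ → ℝ} (h : HasACDeriv u u') (hu' : MemLp u' 2 volume)
    (a : ℝ) : HasACDeriv (fun x => u (x - a)) (fun x => u' (x - a)) := by
  simpa only [sub_eq_add_neg] using h.comp_add hu' (-a)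

theorem h1Form_self_of_hasACDeriv {u : h1Space} {v : ℝ → ℝ} (h : HasACDeriv u v)
    (hv : MemLp v 2 volume) : h1Form u u = (∫ x, (u : ℝ → ℝ) x ^ 2) + ∫ x, v x ^ 2 := by
  rw [h1Form, LinearMap.add_apply, LinearMap.add_apply, l2Form_apply, derivForm_apply]
  simp only [inner2, ← sq]
  congr 1
  refine integral_congr_ae ?_
  filter_upwards [weakDeriv_ae_eq hv h.hasWeakDeriv] with x hx
  rw [hx]

theorem derivForm_comm (u v : h1Space) : derivForm u v = derivForm v u := derivForm_psd.1.eq u v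

theorem weightForm_comm {W : ℝ → ℝ} (hW : Continuous W) (hWb : ∃ C, ∀ x, |W x| ≤ C)
    (u v : h1Space) : weightForm W hW hWb u v = weightForm W hW hWb v u := by
  simp only [weightForm_apply]
  congr 1
  ext x
  ring

/-- The bilinear form `∫ u' v' + V u v` on `H¹`. -/
def potentialForm (V : ℝ → ℝ) (hV : Continuous V) (hVb : ∃ C, ∀ x, |V x| ≤ C) :
    h1Space →ₗ[ℝ] h1Space →ₗ[ℝ] ℝ :=
  derivForm + weightForm V hV hVb

section PotentialForm

variable {V : ℝ → ℝ} (hV : Continuous V) (hVb : ∃ C, ∀ x, |V x| ≤ C)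

theorem potentialForm_comm (u v : h1Space) :
    potentialForm V hV hVb u v = potentialForm V hV hVb v u := by
  simp only [potentialForm, LinearMap.add_apply, derivForm_comm u v, weightForm_comm hV hVb u v]

theorem potentialForm_eq (u v : h1Space) {u' v' : ℝ → ℝ} (hu' : weakDeriv u =ᵐ[volume] u')
    (hv' : weakDeriv v =ᵐ[volume] v') : potentialForm V hV hVb u v =
      ∫ x, (u' x * v' x + V x * ((u : ℝ → ℝ) x * (v : ℝ → ℝ) x)) := by
  have i1 := memLp_mul_integrable (h1Space_memLp_weakDeriv u) (h1Space_memLp_weakDeriv v)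
  have i2 : Integrable fun x => V x * ((u : ℝ → ℝ) x * (v : ℝ → ℝ) x) :=
    (memLp_mul_integrable (h1Space_memLp u) (h1Space_memLp v)).bdd_mul
      hV.aestronglyMeasurable (ae_of_all _ hVb.choose_spec)
  rw [potentialForm, LinearMap.add_apply, LinearMap.add_apply, derivForm_apply, weightForm_apply,
    ← integral_add i1 i2]
  refine integral_congr_ae ?_
  filter_upwards [hu', hv'] with x hx hx'
  rw [hx, hx']

theorem abs_potentialForm_self_le {A : ℝ} (hA : ∀ x, |V x| ≤ A) (u : h1Space) :
    |potentialForm V hV hVb u u| ≤ (1 + A) * h1Form u u := by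
  have hA0 : 0 ≤ A := (abs_nonneg _).trans (hA 0)
  have i1 := memLp_mul_integrable (h1Space_memLp u) (h1Space_memLp u)
  have h1 : |weightForm V hV hVb u u| ≤ A * l2Form u u := by
    rw [weightForm_apply, l2Form_apply, inner2, ← integral_const_mul]
    refine norm_integral_le_of_norm_le (f := fun x => V x * ((u : ℝ → ℝ) x * (u : ℝ → ℝ) x))
      (i1.const_mul A) (ae_of_all _ fun x => ?_)
    rw [Real.norm_eq_abs, abs_mul, abs_mul_self]
    exact mul_le_mul_of_nonneg_right (hA x) (mul_self_nonneg _)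
  have h2 := derivForm_psd.2.nonneg u
  have h3 := l2Form_psd.2.nonneg u
  simp only [potentialForm, h1Form, LinearMap.add_apply]
  refine (abs_add_le _ _).trans ?_
  rw [abs_of_nonneg h2]
  have h4 := mul_nonneg hA0 h2
  linarith

end PotentialForm

section Wave

variable {Q : ℝ → ℝ → ℝ} {s χ₁ V : ℝ → ℝ} {c ν A X k₀ k₁ α : ℝ}
variable (W : LinearizedWave (Q c) (deriv (Q c)) s (speedDeriv Q c) χ₁ V ν A X k₀ k₁)
include W

theorem LinearizedWave.hasACDeriv_wave (a : ℝ) :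
    HasACDeriv (wave Q c a) fun x => deriv (Q c) (x - a) :=
  (HasACDeriv.of_hasDerivAt W.q_deriv W.q'_cont).comp_sub W.q'_L2 a

theorem LinearizedWave.hasACDeriv_zetaTr (a : ℝ) :
    HasACDeriv (zetaTr Q c a) fun x => -s (x - a) := by
  have h := (W.q'_AC.comp_sub W.s_L2 a).const_smul (-1)
  have e : zetaTr Q c a = (-1 : ℝ) • fun x => deriv (Q c) (x - a) := by
    rw [zetaTr_eq W.q_deriv]
    ext x
    simp
  have e' : (fun x => -s (x - a)) = (-1 : ℝ) • fun x => s (x - a) := by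
    ext x
    simp
  rwa [e, e']

theorem LinearizedWave.opResolvent_L2 (hα : 0 < α) (hαν : α ≤ ν / 2) :
    MemLp (opResolvent α (speedDeriv Q c)) 2 volume :=
  opResolvent_memLp hα hαν W.χ_cont W.χ_decay

theorem LinearizedWave.opResolvent_deriv_L2 (hα : 0 < α) (hαν : α ≤ ν / 2) :
    MemLp (fun x => speedDeriv Q c x - α * opResolvent α (speedDeriv Q c) x) 2 volume :=
  W.χ_L2.sub ((W.opResolvent_L2 hα hαν).const_mul α)

theorem LinearizedWave.hasACDeriv_opResolvent (hα : 0 < α) (hαν : α ≤ ν / 2) (a : ℝ) :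
    HasACDeriv (fun x => opResolvent α (speedDeriv Q c) (x - a))
      fun x => speedDeriv Q c (x - a) - α * opResolvent α (speedDeriv Q c) (x - a) := by
  have hd := hasDerivAt_opResolvent hα hαν W.χ_cont W.χ_decay
  have hc : Continuous (opResolvent α (speedDeriv Q c)) :=
    continuous_iff_continuousAt.2 fun x => (hd x).continuousAt
  exact (HasACDeriv.of_hasDerivAt hd (W.χ_cont.sub (hc.const_mul α))).comp_sub
    (W.opResolvent_deriv_L2 hα hαν) a

theorem LinearizedWave.continuous_potential (a : ℝ) : Continuous fun x => V (x - a) :=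
  W.V_cont.comp (continuous_id.sub continuous_const)

theorem LinearizedWave.bounded_potential (a : ℝ) : ∃ C, ∀ x, |V (x - a)| ≤ C :=
  ⟨A, fun x => W.V_le (x - a)⟩

/-- The translation vector is in the kernel of the Hessian. -/
theorem LinearizedWave.potentialForm_zetaTr (a : ℝ) {z : h1Space}
    (hz : (z : ℝ → ℝ) = zetaTr Q c a) (u : h1Space) :
    potentialForm (fun x => V (x - a)) (W.continuous_potential a) (W.bounded_potential a) z u =
      0 := by
  obtain ⟨U, hU, hUd⟩ := MemH1.exists_hasACDeriv u.2
  have hz' : weakDeriv z =ᵐ[volume] fun x => -s (x - a) := by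
    rw [hz]
    exact weakDeriv_ae_eq (memLp_comp_sub W.s_L2 a).neg (W.hasACDeriv_zetaTr a).hasWeakDeriv
  have hu' := h1Space_memLp_weakDeriv u
  have h1 := W.integral_form_q' (hUd.comp_add hu' a)
    (memLp_comp_add ((memLp_congr_ae hU).2 (h1Space_memLp u)) a) (memLp_comp_add hu' a)
  have h2 := integral_sub_right_eq_self (μ := volume)
    (fun x => s x * weakDeriv u (x + a) + V x * deriv (Q c) x * U (x + a)) a
  rw [h1] at h2
  simp only [sub_add_cancel] at h2
  rw [potentialForm_eq _ _ z u hz' (ae_eq_refl _), ← neg_eq_zero, ← integral_neg, ← h2]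
  refine integral_congr_ae ?_
  filter_upwards [hU] with x hx
  rw [hx, hz, zetaTr_eq W.q_deriv]
  ring

theorem LinearizedWave.coercive_translate {κ : ℝ}
    (hκ : ∀ {u u' : ℝ → ℝ}, HasACDeriv u u' → MemLp u 2 volume → MemLp u' 2 volume →
      (∫ x, u x * Q c x = 0) → (∫ x, u x * deriv (Q c) x = 0) →
      κ * ((∫ x, u x ^ 2) + ∫ x, u' x ^ 2) ≤ ∫ x, (u' x ^ 2 + V x * u x ^ 2)) (a : ℝ)
    (u : h1Space) (huq : inner2 u (wave Q c a) = 0) (huz : inner2 u (zetaTr Q c a) = 0) :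
    κ * h1Form u u ≤ potentialForm (fun x => V (x - a)) (W.continuous_potential a)
      (W.bounded_potential a) u u := by
  obtain ⟨U, hU, hUd⟩ := MemH1.exists_hasACDeriv u.2
  have hu' := h1Space_memLp_weakDeriv u
  have shift : ∀ F : ℝ → ℝ, ∫ x, F x = ∫ x, F (x + a) := fun F =>
    (integral_add_right_eq_self F a).symm
  have h := hκ (hUd.comp_add hu' a) (memLp_comp_add ((memLp_congr_ae hU).2 (h1Space_memLp u)) a)
    (memLp_comp_add hu' a) (by
      rw [← huq, inner2, shift fun x => (u : ℝ → ℝ) x * wave Q c a x]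
      refine integral_congr_ae ?_
      filter_upwards [(measurePreserving_add_right volume a).quasiMeasurePreserving.ae hU]
        with x hx
      rw [hx, wave, add_sub_cancel_right]) (by
      rw [← neg_eq_zero, ← integral_neg, ← huz, inner2,
        shift fun x => (u : ℝ → ℝ) x * zetaTr Q c a x]
      refine integral_congr_ae ?_
      filter_upwards [(measurePreserving_add_right volume a).quasiMeasurePreserving.ae hU]
        with x hx
      simp only [hx, zetaTr_eq W.q_deriv, add_sub_cancel_right, mul_neg])
  have e1 : h1Form u u = (∫ x, U (x + a) ^ 2) + ∫ x, weakDeriv u (x + a) ^ 2 := by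
    rw [← shift fun x => U x ^ 2, ← shift fun x => weakDeriv u x ^ 2, h1Form,
      LinearMap.add_apply, LinearMap.add_apply, l2Form_apply, derivForm_apply]
    simp only [inner2, ← sq]
    congr 1
    refine integral_congr_ae ?_
    filter_upwards [hU] with x hx
    rw [hx]
  rw [e1]
  refine h.trans_eq ?_
  rw [potentialForm_eq _ _ u u (ae_eq_refl _) (ae_eq_refl _),
    shift fun x => weakDeriv u x * weakDeriv u x +
      V (x - a) * ((u : ℝ → ℝ) x * (u : ℝ → ℝ) x)]
  refine integral_congr_ae ?_
  filter_upwards [(measurePreserving_add_right volume a).quasiMeasurePreserving.ae hU] with x hx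
  rw [hx, add_sub_cancel_right]
  ring

end Wave

/-! ### The hypotheses of the abstract theory -/

/-- The hypotheses of the abstract theory hold for the Hessian at a translated wave, with constants
that depend only on the bounds for the wave functions. -/
theorem LinearizedWave.exists_anisotropicForm {ν A X k₀ k₁ k : ℝ} (hk : 0 < k) :
    ∃ α₁ k' K, 0 < α₁ ∧ 0 < k' ∧ 1 ≤ K ∧ ∀ {Q : ℝ → ℝ → ℝ} {s χ₁ V : ℝ → ℝ} {c : ℝ}
      (W : LinearizedWave (Q c) (deriv (Q c)) s (speedDeriv Q c) χ₁ V ν A X k₀ k₁),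
      k ≤ (∫ x, Q c x * speedDeriv Q c x) → k ≤ |∫ x, speedDeriv Q c x| →
      k ≤ (∫ x, |deriv (Q c) x| * Q c x) → k ≤ (∫ x, deriv (Q c) x ^ 2) →
      k ≤ (∫ x, Q c x ^ 2) → ∀ α, 0 < α → α < α₁ → α ≤ ν / 2 ∧ ∀ a, ∃ z q w : h1Space,
        (z : ℝ → ℝ) = zetaTr Q c a ∧ (q : ℝ → ℝ) = wave Q c a ∧
        (w : ℝ → ℝ) = (fun x => opResolvent α (speedDeriv Q c) (x - a)) ∧
        AnisotropicForm l2Form h1Form (potentialForm (fun x => V (x - a))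
          (W.continuous_potential a) (W.bounded_potential a)) z q w k' K α := by
  -- for other values of the parameters there is no `LinearizedWave`
  by_cases hA' : 0 < ν ∧ 0 ≤ A
  swap
  · exact ⟨1, 1, 1, one_pos, one_pos, le_rfl, fun W => (hA' ⟨W.ν_pos,
      (abs_nonneg _).trans (W.V_le 0)⟩).elim⟩
  obtain ⟨hν, hA⟩ := hA'
  obtain ⟨κ, hκ, hcoer⟩ := LinearizedWave.exists_coercive (ν := ν) (A := A) (X := X) (k₀ := k₀)
    (k₁ := k₁) hk
  set M := A * expMass (ν / 2) with hM
  set E := expMass ν with hE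
  have hM0 : 0 ≤ M := mul_nonneg hA (expMass_nonneg _)
  have hE0 : 0 ≤ E := expMass_nonneg _
  -- the distance beyond which at most a quarter of the mass of the speed derivative is left
  obtain ⟨R, hR, hRk⟩ : ∃ R, 0 ≤ R ∧ M * Real.exp (-(ν / 2 * R)) ≤ k / 4 := by
    have h1 := tendsto_exp_decay M 0 (half_pos hν)
    obtain ⟨R, hR, hRk⟩ := ((eventually_ge_atTop 0).and
      (h1.eventually_le_const (by positivity : (0 : ℝ) < k / 4))).exists
    exact ⟨R, hR, by simpa using hRk⟩
  -- `α P` bounds the error of replacing the resolvent by `e^{-αx}` times the total mass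
  set P := A * (4 / ν) * expMass (ν / 2) with hP
  have hP0 : 0 ≤ P := mul_nonneg (by positivity) (expMass_nonneg _)
  have hS0 : 0 ≤ M * A * E := by positivity
  have hAE0 : 0 ≤ A * A * E := by positivity
  have hM2 : 0 ≤ M ^ 2 := sq_nonneg _
  refine ⟨min (min 1 (ν / 4)) (min (k / (4 * (P + 1))) (k / (2 * (M * A * E + 1)))),
    min (min 1 κ) (min (k / 2) (k ^ 2 / 8 * Real.exp (-(2 * R)))),
    1 + A + 2 * (A * A * E) + 3 * M ^ 2 + M * A * E, by positivity, by positivity, by linarith,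
    fun {Q s χ₁ V c} W hδ hm hq'q hp hq2 α hα hαlt => ?_⟩
  set K := 1 + A + 2 * (A * A * E) + 3 * M ^ 2 + M * A * E with hK
  set k' := min (min 1 κ) (min (k / 2) (k ^ 2 / 8 * Real.exp (-(2 * R)))) with hk'
  have hk'1 : k' ≤ 1 := (min_le_left _ _).trans (min_le_left _ _)
  have hk'κ : k' ≤ κ := (min_le_left _ _).trans (min_le_right _ _)
  have hk'k : k' ≤ k / 2 := (min_le_right _ _).trans (min_le_left _ _)
  have hk'e : k' ≤ k ^ 2 / 8 * Real.exp (-(2 * R)) := (min_le_right _ _).trans (min_le_right _ _)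
  have hα1 : α ≤ 1 := hαlt.le.trans ((min_le_left _ _).trans (min_le_left _ _))
  have hα4 : α ≤ ν / 4 := hαlt.le.trans ((min_le_left _ _).trans (min_le_right _ _))
  have hαP : α * P ≤ k / 4 := by
    have := hαlt.le.trans ((min_le_right _ _).trans (min_le_left _ _))
    rw [le_div_iff₀ (by positivity)] at this
    linarith
  have hαS : α * (M * A * E) ≤ k / 2 := by
    have := hαlt.le.trans ((min_le_right _ _).trans (min_le_right _ _))
    rw [le_div_iff₀ (by positivity)] at this
    linarith
  have hα2 : α ≤ ν / 2 := by linarith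
  refine ⟨hα2, fun a => ?_⟩
  -- the functions, their translates, and the integrals of their squares
  have hwL := W.opResolvent_L2 hα hα2
  have hw'L := W.opResolvent_deriv_L2 hα hα2
  set w₀ := opResolvent α (speedDeriv Q c) with hw₀
  have hz := W.hasACDeriv_zetaTr a
  have hq := W.hasACDeriv_wave a
  have hw := W.hasACDeriv_opResolvent hα hα2 a
  have hz' : MemLp (fun x => -s (x - a)) 2 volume := (memLp_comp_sub W.s_L2 a).neg
  have hq' : MemLp (fun x => deriv (Q c) (x - a)) 2 volume := memLp_comp_sub W.q'_L2 a
  have hw' : MemLp (fun x => speedDeriv Q c (x - a) - α * w₀ (x - a)) 2 volume :=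
    memLp_comp_sub hw'L a
  have shift : ∀ F : ℝ → ℝ, ∫ x, F (x - a) = ∫ x, F x := fun F => integral_sub_right_eq_self F a
  have sq_le : ∀ {g : ℝ → ℝ}, (∀ x, |g x| ≤ A * Real.exp (-(ν * |x|))) →
      ∫ x, g x ^ 2 ≤ A * A * E := by
    intro g hg
    have := (le_abs_self _).trans (integral_mul_le_expMass hν hg hg)
    simpa only [← sq] using this
  have hw2 : ∫ x, w₀ x ^ 2 ≤ M ^ 2 / α := integral_opResolvent_sq_le hα hα2 W.χ_decay
  have hw'2 : ∫ x, (speedDeriv Q c x - α * w₀ x) ^ 2 ≤ 2 * (A * A * E) + 2 * α * M ^ 2 := by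
    have i1 := W.χ_L2.integrable_sq.const_mul 2
    have i2 := hwL.integrable_sq.const_mul (2 * α ^ 2)
    have h1 : ∫ x, (speedDeriv Q c x - α * w₀ x) ^ 2 ≤
        ∫ x, (2 * speedDeriv Q c x ^ 2 + 2 * α ^ 2 * w₀ x ^ 2) :=
      integral_mono hw'L.integrable_sq (i1.add i2) fun x => by
        simp only
        linarith [sq_nonneg (speedDeriv Q c x + α * w₀ x)]
    rw [integral_add i1 i2, integral_const_mul, integral_const_mul] at h1
    have h2 := mul_le_mul_of_nonneg_left hw2 (by positivity : 0 ≤ 2 * α ^ 2)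
    have h3 : 2 * α ^ 2 * (M ^ 2 / α) = 2 * α * M ^ 2 := by field_simp
    linarith [sq_le W.χ_decay]
  have hwq : |∫ x, w₀ x * Q c x| ≤ M * A * E :=
    abs_integral_opResolvent_mul_le hα hα2 W.χ_decay W.q_decay
  have hzw : inner2 (zetaTr Q c a) (fun x => w₀ (x - a)) =
      (∫ x, Q c x * speedDeriv Q c x) - α * ∫ x, w₀ x * Q c x := by
    rw [zetaTr_eq W.q_deriv, inner2_comp_sub (fun x => -deriv (Q c) x) w₀]
    have := integral_deriv_mul_opResolvent hα hα2 W.χ_cont W.χ_decay W.q_deriv W.q_L2 W.q'_L2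
    simp only [inner2, neg_mul, integral_neg]
    linarith
  have hzsq : ∫ x, zetaTr Q c a x ^ 2 = ∫ x, deriv (Q c) x ^ 2 := by
    rw [← W.inner2_zetaTr_self a]
    simp only [inner2, ← sq]
  have hzq : inner2 (zetaTr Q c a) (wave Q c a) = 0 := by
    rw [zetaTr_eq W.q_deriv]
    refine (inner2_comp_sub (fun x => -deriv (Q c) x) (Q c) a).trans
      (integral_eq_zero_of_odd fun x => ?_)
    simp only [W.q'_odd, W.q_even]
    ring
  have hδK : ∫ x, Q c x * speedDeriv Q c x ≤ A * A * E :=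
    (le_abs_self _).trans (integral_mul_le_expMass hν W.q_decay W.χ_decay)
  have hαwq : α * |∫ x, w₀ x * Q c x| ≤ α * (M * A * E) := mul_le_mul_of_nonneg_left hwq hα.le
  have hαwq' : α * (M * A * E) ≤ M * A * E := mul_le_of_le_one_left hS0 hα1
  have hzw_abs : k / 2 ≤ inner2 (zetaTr Q c a) (fun x => w₀ (x - a)) ∧
      inner2 (zetaTr Q c a) (fun x => w₀ (x - a)) ≤ A * A * E + M * A * E := by
    have h1 := mul_le_mul_of_nonneg_left (le_abs_self (∫ x, w₀ x * Q c x)) hα.le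
    have h2 := mul_le_mul_of_nonneg_left (neg_abs_le (∫ x, w₀ x * Q c x)) hα.le
    rw [hzw]
    constructor <;> linarith
  refine ⟨⟨zetaTr Q c a, MemH1.of_hasACDeriv hz (W.zetaTr_memLp a) hz'⟩,
    ⟨wave Q c a, MemH1.of_hasACDeriv hq (memLp_comp_sub W.q_L2 a) hq'⟩,
    ⟨fun x => w₀ (x - a), MemH1.of_hasACDeriv hw (memLp_comp_sub hwL a) hw'⟩,
    rfl, rfl, rfl, ?_⟩
  exact
  { k_pos := by positivity
    k_le := hk'1
    le_K := by linarith
    α_pos := hα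
    m_psd := l2Form_psd
    h_psd := h1Form_psd
    B_symm := potentialForm_comm _ _
    m_le_h := l2Form_le_h1Form
    complete := h1Space_complete
    B_bound := fun u => by
      refine (abs_potentialForm_self_le _ _ (fun x => W.V_le (x - a)) u).trans
        (mul_le_mul_of_nonneg_right ?_ (h1Form_psd.2.nonneg u))
      linarith
    B_z := W.potentialForm_zetaTr a rfl
    z_q := by
      rw [l2Form_apply]
      exact hzq
    coercive := fun u huq huz => by
      rw [l2Form_apply] at huq huz
      exact (mul_le_mul_of_nonneg_right hk'κ (h1Form_psd.2.nonneg u)).trans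
        (W.coercive_translate (hcoer W hδ hq'q hp) a u huq huz)
    h_z := by
      rw [h1Form_self_of_hasACDeriv hz hz']
      simp only [neg_sq]
      rw [hzsq, shift fun x => s x ^ 2]
      linarith [sq_le W.q'_decay, sq_le W.s_decay]
    m_z := by
      rw [l2Form_apply, W.inner2_zetaTr_self]
      linarith
    h_q := by
      rw [h1Form_self_of_hasACDeriv hq hq']
      simp only [wave]
      rw [shift fun x => deriv (Q c) x ^ 2, shift fun x => Q c x ^ 2]
      linarith [sq_le W.q'_decay, sq_le W.q_decay]
    m_q := by
      rw [l2Form_apply]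
      refine le_trans ?_ (inner2_comp_sub (Q c) (Q c) a).ge
      simp only [inner2, ← sq]
      linarith
    h_w := by
      rw [h1Form_self_of_hasACDeriv hw hw', shift fun x => w₀ x ^ 2,
        shift fun x => (speedDeriv Q c x - α * w₀ x) ^ 2, le_div_iff₀ hα]
      rw [le_div_iff₀ hα] at hw2
      have h1 := mul_le_mul_of_nonneg_right hw'2 hα.le
      have h2 : (2 * (A * A * E) + 2 * α * M ^ 2) * α ≤ (2 * (A * A * E) + 2 * 1 * M ^ 2) * 1 := by
        gcongr
      linarith
    m_w := by
      rw [l2Form_apply]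
      refine le_trans ?_ (inner2_comp_sub w₀ w₀ a).ge
      simp only [inner2, ← sq]
      exact (div_le_div_of_nonneg_right hk'e hα.le).trans
        (le_integral_opResolvent_sq hα hα1 hα4 W.χ_cont W.χ_decay hk hm hR hαP hRk)
    m_w_q := by
      rw [l2Form_apply]
      refine (le_of_eq_of_le (congrArg abs (inner2_comp_sub w₀ (Q c) a)) hwq).trans ?_
      linarith
    m_z_w := by
      rw [l2Form_apply]
      exact hk'k.trans (hzw_abs.1.trans (le_abs_self _))
    m_z_w' := by
      rw [l2Form_apply]
      refine abs_le.2 ⟨?_, ?_⟩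
      · linarith [hzw_abs.1]
      · linarith [hzw_abs.2] }

theorem hessianForm_eq_potentialForm (f : ℝ → ℝ) (Q : ℝ → ℝ → ℝ) (c a : ℝ)
    (hV : Continuous fun x => c - deriv f (Q c (x - a)))
    (hVb : ∃ C, ∀ x, |c - deriv f (Q c (x - a))| ≤ C) (u : h1Space) :
    hessianForm f Q c a u = potentialForm _ hV hVb u u := by
  rw [potentialForm_eq hV hVb u u (ae_eq_refl _) (ae_eq_refl _)]
  simp only [hessianForm, wave, sq]

/-- A vector that is null for the `H¹` pairing vanishes almost everywhere; it need not vanish, since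
`h1Space` consists of functions rather than classes. -/
theorem ae_eq_zero_of_h1Form {u : h1Space} (h : h1Form u u = 0) : (u : ℝ → ℝ) =ᵐ[volume] 0 := by
  have h1 : ∫ x, (u : ℝ → ℝ) x ^ 2 = 0 := by
    have h2 := l2Form_le_h1Form u
    rw [l2Form_apply, h] at h2
    simp only [inner2, ← sq] at h2
    exact le_antisymm h2 (integral_nonneg fun x => sq_nonneg _)
  rw [integral_eq_zero_iff_of_nonneg (fun x => sq_nonneg _) (h1Space_memLp u).integrable_sq] at h1
  filter_upwards [h1] with x hx
  exact pow_eq_zero_iff two_ne_zero |>.1 hx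

/-- The minimizers of the Hessian are the minimizers of the abstract theory. -/
theorem isMinimizer_iff {f : ℝ → ℝ} {Q : ℝ → ℝ → ℝ} {c a α : ℝ} {B : h1Space →ₗ[ℝ] h1Space →ₗ[ℝ] ℝ}
    {q w : h1Space} (hB : ∀ u : h1Space, hessianForm f Q c a u = B u u)
    (hc : ∀ u : h1Space, IsSymplOrthogonal Q c a α u ↔ l2Form u q = 0 ∧ l2Form u w = 0)
    (u : h1Space) : IsMinimizer f Q c a α u ↔ AnisotropicForm.IsMin l2Form B q w u := by
  constructor
  · rintro ⟨⟨-, ho, h1⟩, hmin⟩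
    refine ⟨((hc u).1 ho).1, ((hc u).1 ho).2, (l2Form_apply u u).trans h1, fun v hvq hvw hv1 => ?_⟩
    rw [← hB, ← hB]
    exact hmin ⟨v.2, (hc v).2 ⟨hvq, hvw⟩, (l2Form_apply v v).symm.trans hv1⟩
  · rintro ⟨huq, huw, h1, hmin⟩
    refine ⟨⟨u.2, (hc u).2 ⟨huq, huw⟩, (l2Form_apply u u).symm.trans h1⟩, ?_⟩
    rintro v ⟨hv, ho, hv1⟩
    have := hmin ⟨v, hv⟩ ((hc ⟨v, hv⟩).1 ho).1 ((hc ⟨v, hv⟩).1 ho).2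
      ((l2Form_apply ⟨v, hv⟩ ⟨v, hv⟩).trans hv1)
    rwa [← hB, ← hB] at this

end BKdV

end

theorem mainTheorem3 (f : ℝ → ℝ) (hf : BKdV.IsNonlinearity f)
    (I₀ : Set ℝ) (Q : ℝ → ℝ → ℝ) (hQ : BKdV.IsSolitaryWaveFamily f I₀ Q)
    (I : Set ℝ) (hI : IsCompact I) (hII₀ : I ⊆ I₀)
    (hδ : ∀ c ∈ I, 0 < deriv (fun c' => BKdV.momentum (Q c')) c) :
    ∃ α₀ C₁ C₂ C₃ C C' : ℝ, 0 < α₀ ∧ 0 < C₁ ∧ 0 < C₂ ∧ 0 < C₃ ∧ 0 < C ∧ 0 < C' ∧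
    ∃ ϱ : ℝ → ℝ, ∀ α : ℝ, 0 < α → α < α₀ →
      (C₁ * α ≤ ϱ α ∧ ϱ α ≤ C₂ * α) ∧
      ∀ c ∈ I, ∀ a : ℝ,
        -- coercivity of the Hessian
        (∀ ξ : ℝ → ℝ, BKdV.MemH1 ξ → BKdV.IsSymplOrthogonal Q c a α ξ →
          ϱ α * BKdV.normH1 ξ ^ 2 ≤ BKdV.hessianForm f Q c a ξ) ∧
        -- the infimum is attained
        (∃ η : ℝ → ℝ, BKdV.IsMinimizer f Q c a α η) ∧
        -- the minimizer is unique up to sign, as an element of `L²`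
        (∀ η η' : ℝ → ℝ, BKdV.IsMinimizer f Q c a α η → BKdV.IsMinimizer f Q c a α η' →
          η' =ᵐ[volume] η ∨ η' =ᵐ[volume] -η) ∧
        ∀ η : ℝ → ℝ, BKdV.IsMinimizer f Q c a α η →
          -- the minimizer is approximately a multiple of the translation vector
          (∃ (γ : ℝ) (ηperp : ℝ → ℝ), η = γ • BKdV.zetaTr Q c a + ηperp ∧
            BKdV.inner2 ηperp (BKdV.zetaTr Q c a) = 0 ∧ BKdV.MemH1 ηperp ∧
            |γ| ≤ C' ∧ BKdV.normH1 ηperp ≤ C' * Real.sqrt α) ∧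
          -- coercivity on the good part, and anisotropic coercivity
          ∀ ξ : ℝ → ℝ, BKdV.MemH1 ξ → BKdV.IsSymplOrthogonal Q c a α ξ →
            C₃ * BKdV.normH1 (BKdV.goodPart η ξ) ^ 2 ≤
                BKdV.hessianForm f Q c a (BKdV.goodPart η ξ) ∧
            C₃ * BKdV.normH1 (BKdV.goodPart η ξ) ^ 2 +
                C * α * BKdV.normH1 (BKdV.badPart η ξ) ^ 2 ≤
              BKdV.hessianForm f Q c a ξ := by
  obtain ⟨ν, A, X, k₀, k₁, k, hk, hW⟩ := hQ.exists_linearizedWave hf hI hII₀ hδ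
  obtain ⟨α₁, k', K, hα₁, hk', hK, hform⟩ := BKdV.LinearizedWave.exists_anisotropicForm
    (ν := ν) (A := A) (X := X) (k₀ := k₀) (k₁ := k₁) hk
  have hK0 : 0 < K := one_pos.trans_le hK
  refine ⟨min α₁ (k' ^ 5 / (128 * K ^ 5)), k' ^ 3 / (4 * K ^ 2), k' ^ 3 / (4 * K ^ 2),
    k' ^ 2 / (4 * K), k' ^ 3 / (4 * K ^ 2), 32 * K ^ 4 / k' ^ 4, by positivity, by positivity,
    by positivity, by positivity, by positivity, by positivity,
    fun α => k' ^ 3 / (4 * K ^ 2) * α, fun α hα hαlt => ⟨⟨le_rfl, le_rfl⟩, fun c hc a => ?_⟩⟩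
  have hα1 : α < α₁ := hαlt.trans_le (min_le_left _ _)
  have hα2 : α < k' ^ 5 / (128 * K ^ 5) := hαlt.trans_le (min_le_right _ _)
  obtain ⟨W, hδc, hmc, hqc, hpc, hq2c⟩ := hW c hc
  obtain ⟨hαν, hf'⟩ := hform W hδc hmc hqc hpc hq2c α hα hα1
  obtain ⟨z, q, w, hz, hq, hw, F⟩ := hf' a
  set B := BKdV.potentialForm (fun x => c - deriv f (Q c (x - a))) (W.continuous_potential a)
    (W.bounded_potential a) with hB
  have hHB : ∀ u : BKdV.h1Space, BKdV.hessianForm f Q c a u = B u u := fun u =>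
    BKdV.hessianForm_eq_potentialForm f Q c a (W.continuous_potential a) (W.bounded_potential a) u
  have hortho : ∀ u : BKdV.h1Space, BKdV.IsSymplOrthogonal Q c a α u ↔
      BKdV.l2Form u q = 0 ∧ BKdV.l2Form u w = 0 := fun u => by
    rw [BKdV.l2Form_apply, BKdV.l2Form_apply, hq, hw]
    exact W.isSymplOrthogonal_iff (hk.trans_le hpc) hα hαν a (BKdV.h1Space_memLp u)
  have hmin := BKdV.isMinimizer_iff hHB hortho
  refine ⟨fun ξ hξ hξo => ?_, ?_, fun η η' hη hη' => ?_, fun η hη => ?_⟩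
  · have ho := (hortho ⟨ξ, hξ⟩).1 hξo
    have h1 := F.coercive_constraint (F.small hα2).1 ho.1 ho.2
    rw [BKdV.h1Form_self, ← hHB] at h1
    exact h1
  · obtain ⟨x, hx⟩ := F.exists_isMin hα2
    exact ⟨x, (hmin x).2 hx⟩
  · have h1 := (hmin ⟨η, hη.1.1⟩).1 hη
    have h2 := (hmin ⟨η', hη'.1.1⟩).1 hη'
    refine (h1.unique F hα2 h2).imp (fun h => ?_) fun h => ?_
    · filter_upwards [BKdV.ae_eq_zero_of_h1Form h] with x hx
      exact sub_eq_zero.1 hx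
    · filter_upwards [BKdV.ae_eq_zero_of_h1Form h] with x hx
      exact eq_neg_of_add_eq_zero_left hx
  · have hx := (hmin ⟨η, hη.1.1⟩).1 hη
    set x : BKdV.h1Space := ⟨η, hη.1.1⟩ with hxdef
    refine ⟨⟨BKdV.l2Form x z / BKdV.l2Form z z,
      (BKdV.AnisotropicForm.perp BKdV.l2Form z x : BKdV.h1Space),
      ?_, ?_, Subtype.prop _, hx.abs_coeff_le F, ?_⟩, fun ξ hξ hξo => ?_⟩
    · have := congrArg (Subtype.val) (BKdV.AnisotropicForm.eq_add_perp (m := BKdV.l2Form) (z := z) x)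
      rw [← hz]
      exact this
    · rw [← hz, ← BKdV.l2Form_apply]
      exact F.perp_z x
    · have h1 := hx.h_perp_le F hα2
      rw [BKdV.h1Form_self] at h1
      -- the constant is at least `1`, so that it is at most its square
      have hC : 1 ≤ 32 * K ^ 4 / k' ^ 4 := by
        rw [one_le_div (by positivity)]
        have h2 := pow_le_one₀ (n := 4) hk'.le F.k_le
        have h3 := one_le_pow₀ (n := 4) hK
        linarith
      refine le_of_sq_le_sq ?_ (by positivity)
      rw [mul_pow, Real.sq_sqrt hα.le, sq (32 * K ^ 4 / k' ^ 4)]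
      refine h1.trans (mul_le_mul_of_nonneg_right ?_ hα.le)
      exact le_mul_of_one_le_left (by positivity) hC
    · have ho := (hortho ⟨ξ, hξ⟩).1 hξo
      have h1 := hx.anisotropic F hα2 ho.1 ho.2
      have h2 := hx.coercive_orthogonal F hα2
        (y := ⟨ξ, hξ⟩ - BKdV.l2Form ⟨ξ, hξ⟩ x • x) (by simp [ho.1, hx.1])
        (by simp [hx.2.2.1])
      simp only [BKdV.h1Form_self, ← hHB, BKdV.l2Form_apply] at h1 h2
      exact ⟨h2, h1⟩
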